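/- Let $p$ be a prime, let $B$ be a perfect commutative ring of characteristic $p$, let $n\ge 0$, and let $C:=B[x_1^{p^{-\infty}},\ldots,x_n^{p^{-\infty}}]/(x_1,\ldots,x_n)$, where $B[x_1^{p^{-\infty}},\ldots,x_n^{p^{-\infty}}]$ is the ring of finite sums $\sum_\alpha b_\alpha x^\alpha$ with $b_\alpha\in B$, $\alpha\in(\mathbb{Z}_+[1/p])^n$, and $\mathbb{Z}_+[1/p]:=\{a\in\mathbb{Z}[1/p] : a\ge 0\}$. **Notation.** $C^\flat:=\varprojlim(\cdots\to C\to C\to C)$ (all maps are Frobenius), $\nu_m:C^\flat\to C$ is the map $(c_0,c_1,\ldots)\mapsto c_m$, and $W$ denotes $p$-typical Witt vectors. $A_{\rm cris}(C)$ is the $p$-adic completion of the PD hull (compatible with the divided powers $\gamma_m(p)=p^m/m!$) of the epimorphism $W(C^\flat)\to C$ induced by $\nu_0$. $F:A_{\rm cris}(C)\to A_{\rm cris}(C)$ is induced by the Frobenius of $C$, and $I_{\rm cris}(C):=\ker(A_{\rm cris}(C)\to C)$. For an $\mathbb{F}_p$-algebra $R$ let $W(R)[V^{-1}]:=\varinjlim(W(R)\xrightarrow{V}W(R)\xrightarrow{V}\cdots)$.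 The group $W(C^\flat/\ker\nu_m)[V^{-1}]$ carries operators $F,V$ and the action of $W(C^\flat)$ given by $u\cdot V^{-i}x=V^{-i}((F^{-i}u)x)$. Let $M(C)$ be the preimage of $W(C)\subset W(C)[V^{-1}]$ in $\varprojlim_m W(C^\flat/\ker\nu_m)[V^{-1}]$ (note that $C^\flat/\ker\nu_0=C$). It is a $W(C^\flat)$-module with operators $F,V$, and there is a canonical map $W(C^\flat)\to M(C)$. **Statement.** (a) There is a unique divided power structure $\gamma$ on the ideal $I_{\rm cris}(C)$ which extends the divided powers $\gamma_m(b)$, $b\in\ker(W(C^\flat)\to C)$, in the PD hull. (b) There is a unique $F$-linear map $F':I_{\rm cris}(C)\to A_{\rm cris}(C)$ such that $F'(pb)=F(b)$ for $b\in A_{\rm cris}(C)$, $F'(\gamma_m(b))=\frac{p^{m-1}}{m!}F'(b)^m$ for $b\in I_{\rm cris}(C)$ and $m\ge 1$, and $F'(b)=(p-1)!\,\gamma_p(b)+\frac{F(b)-b^p}{p}$ for $b\in\ker(W(C^\flat)\to C)$ (here $\frac{F(b)-b^p}{p}$ is computed in $W(C^\flat)$, which has no $p$-torsion). (c) There is a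 unique $W(C^\flat)$-linear map $f:M(C)\to A_{\rm cris}(C)$ which commutes with $F$ and has the following property: if $x\in M(C)$ and $m\ge 0$ are such that $V^mx$ is the image of some $w\in W(C^\flat)$, then $(F')^m$ is defined at the image of $w$ in $A_{\rm cris}(C)$, and $f(x)=(F')^m(w)$. (d) The map $f$ is injective, and its image is the set $A''_{\rm cris}(C)$ of all $u\in A_{\rm cris}(C)$ for which there is a sequence $v_0,v_1,\ldots\in A_{\rm cris}(C)$ converging to $0$ in the $p$-adic topology such that $p^mu=F^m(v_m)$ for all $m\ge 0$. In other words, $f$ is an isomorphism $M(C)\to A''_{\rm cris}(C)$. -/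

import Mathlib

noncomputable section

namespace Fontaine

open MvPolynomial

universe u

/-! ### Divided power hulls -/

section PDHull

variable (p : ℕ) {R : Type u} [CommRing R] (I : Ideal R)

/-- The relations which turn the divided power algebra `Γ_R(I)` into the PD hull of `(R, I)`
compatible with the divided powers `γ_m(p) = p ^ m / m!`.
First, `γ_1(x) = x` for `x ∈ I`. Second, `u * γ_m(p) = p ^ (m - v)`, where `m! = u * p ^ v`
with `u` prime to `p`. (The hull is only used for `p ∈ I` and for `R` in which all integers prime
to `p` are invertible; then the second relation says that `γ_m(p) = p ^ m / m!`.) -/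
inductive PDHullRel : DividedPowerAlgebra R I → DividedPowerAlgebra R I → Prop
  | one (x : I) : PDHullRel (DividedPowerAlgebra.dp R 1 x) (algebraMap R _ (x : R))
  | compat (x : I) (hx : (x : R) = (p : R)) (m : ℕ) :
      PDHullRel
        (((m.factorial / p ^ padicValNat p m.factorial : ℕ) : DividedPowerAlgebra R I) *
          DividedPowerAlgebra.dp R m x)
        ((p : DividedPowerAlgebra R I) ^ (m - padicValNat p m.factorial))

/-- The PD hull of `(R, I)`, with the condition `γ_m(p) = p ^ m / m!`:
the quotient of the divided power algebra of the module `I` by the relations above. -/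
def PDHull : Type u := DividedPowerAlgebra R I ⧸ Ideal.ofRel (PDHullRel p I)

instance : CommRing (PDHull p I) :=
  inferInstanceAs (CommRing (DividedPowerAlgebra R I ⧸ Ideal.ofRel (PDHullRel p I)))

instance : Algebra R (PDHull p I) :=
  inferInstanceAs (Algebra R (DividedPowerAlgebra R I ⧸ Ideal.ofRel (PDHullRel p I)))

/-- The quotient map from the divided power algebra to the PD hull. -/
def PDHull.mk : DividedPowerAlgebra R I →ₐ[R] PDHull p I :=
  Ideal.Quotient.mkₐ R (Ideal.ofRel (PDHullRel p I))

/-- The element `γ_n(x)` of the PD hull of `(R, I)`, for `x ∈ I`. -/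
def PDHull.dp (n : ℕ) (x : I) : PDHull p I := PDHull.mk p I (DividedPowerAlgebra.dp R n x)

variable {p I}

theorem PDHull.mk_eq_of_rel {a b : DividedPowerAlgebra R I} (h : PDHullRel p I a b) :
    PDHull.mk p I a = PDHull.mk p I b := by
  refine (Ideal.Quotient.eq).2 ?_
  exact Submodule.subset_span ⟨a, b, h, by simp⟩

/-- A ring homomorphism from the divided power algebra is given by a ring homomorphism `g` from `R`
and by images `d n x` of the elements `γ_n(x)` which satisfy the defining relations. -/
def PDHull.liftAux {S : Type u} [CommRing S] (g : R →+* S) (d : ℕ → I → S)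
    (zero : ∀ x, d 0 x = 1)
    (smul : ∀ (r : R) n x, d n (r • x) = g r ^ n * d n x)
    (mul : ∀ m n x, d m x * d n x = ((m + n).choose m : S) * d (m + n) x)
    (add : ∀ n x y,
      d n (x + y) = ∑ k ∈ Finset.HasAntidiagonal.antidiagonal n, d k.1 x * d k.2 y) :
    DividedPowerAlgebra R I →+* S :=
  RingCon.lift (DividedPowerAlgebra.ringCon R I)
    (MvPolynomial.eval₂Hom g (fun i : ℕ × I => d i.1 i.2)) (by
      refine RingCon.ringConGen_le.2 ?_
      intro a b h
      change (MvPolynomial.eval₂Hom g (fun i : ℕ × I => d i.1 i.2)) a =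
        (MvPolynomial.eval₂Hom g (fun i : ℕ × I => d i.1 i.2)) b
      cases h with
      | rfl_zero => rfl
      | zero => rw [MvPolynomial.eval₂Hom_X', map_one]; exact zero _
      | smul => simp [smul, MvPolynomial.smul_eq_C_mul]
      | mul => simp [mul]
      | add => simp [add])

/-- A ring homomorphism from the PD hull is given by a ring homomorphism `g` from `R` and
by images `d n x` of the elements `γ_n(x)` which satisfy the defining relations. -/
def PDHull.lift {S : Type u} [CommRing S] (g : R →+* S) (d : ℕ → I → S)
    (zero : ∀ x, d 0 x = 1)
    (smul : ∀ (r : R) n x, d n (r • x) = g r ^ n * d n x)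
    (mul : ∀ m n x, d m x * d n x = ((m + n).choose m : S) * d (m + n) x)
    (add : ∀ n x y,
      d n (x + y) = ∑ k ∈ Finset.HasAntidiagonal.antidiagonal n, d k.1 x * d k.2 y)
    (one : ∀ x : I, d 1 x = g x)
    (compat : ∀ x : I, (x : R) = p → ∀ m : ℕ,
      ((m.factorial / p ^ padicValNat p m.factorial : ℕ) : S) * d m x =
        (p : S) ^ (m - padicValNat p m.factorial)) :
    PDHull p I →+* S :=
  Ideal.Quotient.lift (Ideal.ofRel (PDHullRel p I)) (PDHull.liftAux g d zero smul mul add) (by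
    intro a ha
    have hdp : ∀ n (x : I), PDHull.liftAux g d zero smul mul add
        (DividedPowerAlgebra.dp R n x) = d n x := fun n x => by
      change MvPolynomial.eval₂Hom g (fun i : ℕ × I => d i.1 i.2) (X (n, x)) = d n x
      simp
    have halg : ∀ r : R, PDHull.liftAux g d zero smul mul add
        (algebraMap R _ r) = g r := fun r => by
      change MvPolynomial.eval₂Hom g (fun i : ℕ × I => d i.1 i.2) (C r) = g r
      simp
    rw [← RingHom.mem_ker]
    refine (Submodule.span_le (p := RingHom.ker _)).2 ?_ ha
    rintro _ ⟨a, b, h, hab⟩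
    rw [SetLike.mem_coe, RingHom.mem_ker, eq_sub_of_add_eq hab, map_sub, sub_eq_zero]
    cases h with
    | one x => rw [hdp, halg, one]
    | compat x hx m =>
      rw [map_mul, map_natCast, map_pow, map_natCast, hdp]
      exact compat x hx m)

@[simp]
theorem PDHull.lift_dp {S : Type u} [CommRing S] (g : R →+* S) (d : ℕ → I → S)
    (h1 h2 h3 h4 h5 h6) (n : ℕ) (x : I) :
    PDHull.lift (p := p) g d h1 h2 h3 h4 h5 h6 (PDHull.dp p I n x) = d n x := by
  change MvPolynomial.eval₂Hom g (fun i : ℕ × I => d i.1 i.2) (X (n, x)) = d n x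
  simp

@[simp]
theorem PDHull.lift_algebraMap {S : Type u} [CommRing S] (g : R →+* S) (d : ℕ → I → S)
    (h1 h2 h3 h4 h5 h6) (r : R) :
    PDHull.lift (p := p) g d h1 h2 h3 h4 h5 h6 (algebraMap R _ r) = g r := by
  change MvPolynomial.eval₂Hom g (fun i : ℕ × I => d i.1 i.2) (C r) = g r
  simp

/-- Functoriality of the PD hull. -/
def PDHull.map {R' : Type u} [CommRing R'] {I' : Ideal R'} (φ : R →+* R')
    (h : ∀ x ∈ I, φ x ∈ I') : PDHull p I →+* PDHull p I' :=
  PDHull.lift ((algebraMap R' (PDHull p I')).comp φ)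
    (fun n x => PDHull.dp p I' n ⟨φ x, h x x.2⟩)
    (fun x => by simp [PDHull.dp, DividedPowerAlgebra.dp_zero])
    (fun r n x => by
      have : (⟨φ (r • x : I), h _ (r • x).2⟩ : I') = φ r • ⟨φ x, h x x.2⟩ := by
        ext; simp
      rw [this, PDHull.dp, DividedPowerAlgebra.dp_smul, map_smul, Algebra.smul_def]
      simp [PDHull.dp])
    (fun m n x => by
      simp only [PDHull.dp]
      rw [← map_mul, DividedPowerAlgebra.dp_mul, map_nsmul, nsmul_eq_mul])
    (fun n x y => by
      have : (⟨φ (x + y : I), h _ (x + y).2⟩ : I') = ⟨φ x, h x x.2⟩ + ⟨φ y, h y y.2⟩ := by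
        ext; simp
      simp only [PDHull.dp]
      rw [this, DividedPowerAlgebra.dp_add, map_sum]
      simp)
    (fun x => by
      rw [PDHull.dp, PDHull.mk_eq_of_rel (PDHullRel.one _)]
      simp)
    (fun x hx m => by
      have := PDHull.mk_eq_of_rel (PDHullRel.compat (p := p) (I := I') ⟨φ x, h x x.2⟩
        (by simp [hx]) m)
      simpa [PDHull.dp] using this)

/-- For `p` prime, `T` of characteristic `p`, and `g : R →+* T` which vanishes on `I`,
the homomorphism from the PD hull of `(R, I)` to `T` which extends `g` and which is zero on
`γ_n(x)` for all `n ≥ 1` and `x ∈ I`. -/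
def PDHull.augmentation [Fact p.Prime] {T : Type u} [CommRing T] [CharP T p] (g : R →+* T)
    (h : ∀ x ∈ I, g x = 0) : PDHull p I →+* T :=
  PDHull.lift g (fun n _ => if n = 0 then 1 else 0)
    (fun _ => by simp)
    (fun r n x => by by_cases hn : n = 0 <;> simp [hn])
    (fun m n x => by
      by_cases hm : m = 0 <;> by_cases hn : n = 0 <;> simp [hm, hn])
    (fun n x y => by
      by_cases hn : n = 0
      · simp [hn]
      · rw [if_neg hn, Finset.sum_eq_zero]
        intro k hk
        rw [Finset.HasAntidiagonal.mem_antidiagonal] at hk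
        by_cases h1 : k.1 = 0
        · rw [if_neg (show k.2 ≠ 0 by omega), mul_zero]
        · rw [if_neg h1, zero_mul])
    (fun x => by simp [h x x.2])
    (fun x _ m => by
      by_cases hm : m = 0
      · simp [hm]
      · have := padicValNat_factorial_lt_of_ne_zero (p := p) hm
        rw [if_neg hm, CharP.cast_eq_zero T p, zero_pow (by omega), mul_zero])

end PDHull

/-! ### Functoriality of the `p`-adic completion -/

section Completion

variable (p : ℕ) {S T : Type u} [CommRing S] [CommRing T]

theorem padicMap_aux (φ : S →+* T) (n : ℕ) :
    Ideal.span {(p : S)} ^ n ≤ Ideal.comap φ (Ideal.span {(p : T)} ^ n) := by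
  rw [Ideal.span_singleton_pow, Ideal.span_singleton_pow, Ideal.span_singleton_le_iff_mem,
    Ideal.mem_comap, map_pow, map_natCast]
  exact Ideal.mem_span_singleton_self _

theorem padicMap_compat (φ : S →+* T) {m n : ℕ} (hle : m ≤ n) :
    (Ideal.Quotient.factorPow (Ideal.span {(p : T)}) hle).comp
      ((Ideal.quotientMap (Ideal.span {(p : T)} ^ n) φ (padicMap_aux p φ n)).comp
        (AdicCompletion.evalₐ (Ideal.span {(p : S)}) n).toRingHom) =
      (Ideal.quotientMap (Ideal.span {(p : T)} ^ m) φ (padicMap_aux p φ m)).comp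
        (AdicCompletion.evalₐ (Ideal.span {(p : S)}) m).toRingHom := by
  ext x
  obtain ⟨y, rfl⟩ := AdicCompletion.mk_surjective _ _ x
  have h := AdicCompletion.Ideal.mk_eq_mk (Ideal.span {(p : S)}) hle y
  simp only [AlgHom.toRingHom_eq_coe, RingHom.comp_apply, RingHom.coe_coe,
    AdicCompletion.evalₐ_mk, Ideal.quotientMap_mk]
  have h' := congrArg (Ideal.quotientMap (Ideal.span {(p : T)} ^ m) φ (padicMap_aux p φ m)) h
  rwa [Ideal.quotientMap_mk, Ideal.quotientMap_mk] at h'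

/-- The homomorphism of `p`-adic completions induced by a ring homomorphism. -/
def padicMap (φ : S →+* T) :
    AdicCompletion (Ideal.span {(p : S)}) S →+* AdicCompletion (Ideal.span {(p : T)}) T :=
  AdicCompletion.liftRingHom (Ideal.span {(p : T)})
    (fun n => (Ideal.quotientMap (Ideal.span {(p : T)} ^ n) φ (padicMap_aux p φ n)).comp
      (AdicCompletion.evalₐ (Ideal.span {(p : S)}) n).toRingHom)
    (padicMap_compat p φ)

end Completion

/-! ### `C^♭`, `W(C^♭)`, `A_cris(C)` -/

section Acris

variable (p : ℕ) [Fact p.Prime] (C : Type u) [CommRing C] [CharP C p]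

/-- The ring `W(C^♭)`. Here `C^♭ = lim (⋯ → C → C)` (the transition maps are the Frobenius maps)
is `Perfection C p`, and `ν_n : C^♭ → C` is `Perfection.coeff C p n`. -/
abbrev WFlat : Type u := WittVector p (Perfection C p)

/-- The canonical homomorphism `W(C^♭) → C` induced by `ν_0 : C^♭ → C`. -/
def theta : WFlat p C →+* C := (Perfection.coeff C p 0).comp WittVector.constantCoeff

/-- The ideal `Ker (W(C^♭) → C)`. -/
abbrev kerTheta : Ideal (WFlat p C) := RingHom.ker (theta p C)

/-- The PD hull of `W(C^♭) → C`. -/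
abbrev AcrisHull : Type u := PDHull p (kerTheta p C)

/-- `A_cris(C)`: the `p`-adic completion of the PD hull of `W(C^♭) → C`. -/
abbrev Acris : Type u := AdicCompletion (Ideal.span {(p : AcrisHull p C)}) (AcrisHull p C)

/-- The canonical homomorphism from the PD hull to its `p`-adic completion `A_cris(C)`. -/
def toAcris : AcrisHull p C →+* Acris p C := algebraMap (AcrisHull p C) (Acris p C)

/-- The canonical homomorphism from the PD hull to `C`. -/
def hullToC : AcrisHull p C →+* C :=
  PDHull.augmentation (theta p C) (fun _ h => h)

/-- The canonical homomorphism `A_cris(C) → C`. -/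
def acrisToC : Acris p C →+* C :=
  (Ideal.Quotient.lift (Ideal.span {(p : AcrisHull p C)}) (hullToC p C) (by
    intro a ha
    obtain ⟨b, rfl⟩ := Ideal.mem_span_singleton'.1 ha
    simp)).comp
    (AdicCompletion.evalOneₐ (Ideal.span {(p : AcrisHull p C)})).toRingHom

/-- The ideal `I_cris(C) = Ker (A_cris(C) → C)`. -/
abbrev Icris : Ideal (Acris p C) := RingHom.ker (acrisToC p C)

theorem theta_frobenius (x : WFlat p C) :
    theta p C (WittVector.frobenius x) = theta p C x ^ p := by
  rw [theta, RingHom.comp_apply, RingHom.comp_apply, ← map_pow]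
  congr 1
  change (WittVector.frobenius x).coeff 0 = x.coeff 0 ^ p
  exact WittVector.coeff_frobenius_charP p x 0

/-- The endomorphism of the PD hull induced by the Frobenius endomorphism of `C`; on `W(C^♭)` this
is the Witt vector Frobenius. -/
def hullFrobenius : AcrisHull p C →+* AcrisHull p C :=
  PDHull.map (WittVector.frobenius (R := Perfection C p)) (fun x hx => by
    rw [RingHom.mem_ker] at hx ⊢
    rw [theta_frobenius, hx, zero_pow (Fact.out : p.Prime).ne_zero])

/-- The endomorphism `F` of `A_cris(C)` induced by the Frobenius endomorphism of `C`. -/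
def acrisFrobenius : Acris p C →+* Acris p C := padicMap p (hullFrobenius p C)

end Acris

/-! ### The divided powers on `I_cris(C)` and the map `F'` -/

section FPrime

variable (p : ℕ) [Fact p.Prime] (C : Type u) [CommRing C] [CharP C p]

/-- `γ` is the canonical divided power structure on `I_cris(C)`, i.e., it extends the divided
powers of the elements of `Ker (W(C^♭) → C)` in the PD hull. -/
def IsCanonicalDividedPowers (γ : DividedPowers (Icris p C)) : Prop :=
  ∀ (n : ℕ) (b : kerTheta p C),
    γ.dpow n (algebraMap (WFlat p C) (Acris p C) b) = toAcris p C (PDHull.dp p (kerTheta p C) n b)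

/-- The three conditions which characterize the `F`-linear map `F' : I_cris(C) → A_cris(C)`.
In `dpow` the equality `F'(γ_n(b)) = (p ^ (n - 1) / n!) * F'(b) ^ n` is multiplied by the
prime-to-`p` part of `n!`, which is invertible in `A_cris(C)`.
In `theta` the element `d` is `δ(b) = (F(b) - b ^ p) / p` (recall that `W(C^♭)` has no
`p`-torsion). -/
structure IsFPrime (γ : DividedPowers (Icris p C))
    (F' : Icris p C →ₛₗ[acrisFrobenius p C] Acris p C) : Prop where
  mul_p : ∀ (b : Acris p C) (c : Icris p C), (c : Acris p C) = p * b → F' c = acrisFrobenius p C b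
  dpow : ∀ (n : ℕ), 1 ≤ n → ∀ b c : Icris p C, (c : Acris p C) = γ.dpow n b →
    ((n.factorial / p ^ padicValNat p n.factorial : ℕ) : Acris p C) * F' c =
      (p : Acris p C) ^ (n - 1 - padicValNat p n.factorial) * F' b ^ n
  theta : ∀ (b d : WFlat p C) (c : Icris p C), b ∈ kerTheta p C →
    (p : WFlat p C) * d = WittVector.frobenius b - b ^ p →
    (c : Acris p C) = algebraMap (WFlat p C) (Acris p C) b →
    F' c = ((p - 1).factorial : Acris p C) * γ.dpow p (c : Acris p C) +
      algebraMap (WFlat p C) (Acris p C) d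

variable {p C}

/-- `IteratesTo F' n a b` says that `(F') ^ n` is defined at `a` and that its value is `b`. -/
def IteratesTo (F' : Icris p C → Acris p C) : ℕ → Acris p C → Acris p C → Prop
  | 0, a, b => a = b
  | n + 1, a, b => ∃ h : a ∈ Icris p C, IteratesTo F' n (F' ⟨a, h⟩) b

variable (p C)

/-- `A''_cris(C)`: the set of all `u` such that `p ^ n * u = F ^ n (v_n)` for some sequence `v_n`
which converges to `0` in the `p`-adic topology of `A_cris(C)`. -/
def AcrisDoublePrime : Set (Acris p C) :=
  {u | ∃ v : ℕ → Acris p C,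
    (∀ k : ℕ, ∀ᶠ n in Filter.atTop, v n ∈ Ideal.span {(p : Acris p C)} ^ k) ∧
    ∀ n : ℕ, (p : Acris p C) ^ n * u = (acrisFrobenius p C)^[n] (v n)}

end FPrime

/-! ### `W(R)[V⁻¹]` -/

section WittVInv

variable (p : ℕ) [Fact p.Prime] (R : Type u) [CommRing R]

/-- The transition maps `V ^ (j - i)` of the inductive system `W(R) → W(R) → ⋯` -/
def verschiebungPow (i j : ℕ) (_ : i ≤ j) : WittVector p R →+ WittVector p R where
  toFun := WittVector.verschiebung^[j - i]
  map_zero' := iterate_map_zero _ _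
  map_add' := iterate_map_add _ _

variable {R} in
theorem verschiebungPow_apply (i j : ℕ) (h : i ≤ j) (x : WittVector p R) :
    verschiebungPow p R i j h x = WittVector.verschiebung^[j - i] x := rfl

variable {p R} in
theorem map_frobenius {S : Type u} [CommRing S] (φ : R →+* S) (x : WittVector p R) :
    WittVector.map φ (WittVector.frobenius x) = WittVector.frobenius (WittVector.map φ x) :=
  (WittVector.frobenius_isPoly p).map φ x

instance : DirectedSystem (fun _ : ℕ => WittVector p R) (fun i j h => verschiebungPow p R i j h) where
  map_self i x := by simp [verschiebungPow_apply]
  map_map i j k hij hjk x := by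
    simp only [verschiebungPow_apply, ← Function.iterate_add_apply]
    congr 1; omega

/-- `W(R)[V⁻¹]`, the inductive limit of `W(R) → W(R) → ⋯`, where all maps are equal to `V`. -/
def WittVInv : Type u :=
  AddCommGroup.DirectLimit (fun _ : ℕ => WittVector p R) (verschiebungPow p R)

instance : AddCommGroup (WittVInv p R) :=
  inferInstanceAs (AddCommGroup
    (AddCommGroup.DirectLimit (fun _ : ℕ => WittVector p R) (verschiebungPow p R)))

namespace WittVInv

variable {R}

/-- The element `V ^ (-n) x` of `W(R)[V⁻¹]`, for `x ∈ W(R)`. -/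
def of (n : ℕ) : WittVector p R →+ WittVInv p R :=
  AddCommGroup.DirectLimit.of (fun _ : ℕ => WittVector p R) (verschiebungPow p R) n

variable {p}

theorem exists_of (z : WittVInv p R) : ∃ (n : ℕ) (x : WittVector p R), z = of p n x :=
  AddCommGroup.DirectLimit.induction_on
    (C := fun z : WittVInv p R => ∃ (n : ℕ) (x : WittVector p R), z = of p n x) z
    fun n x => ⟨n, x, rfl⟩

variable (p)

/-- The additive map `W(R)[V⁻¹] → W(S)[V⁻¹]` given by `V ^ (-n) x ↦ V ^ (-n) (g_n x)`. -/
def mapAux {S : Type u} [CommRing S] (g : ℕ → WittVector p R →+ WittVector p S)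
    (hg : ∀ n x, g (n + 1) (WittVector.verschiebung x) = WittVector.verschiebung (g n x)) :
    WittVInv p R →+ WittVInv p S :=
  AddCommGroup.DirectLimit.map g (by
    intro i j h
    ext1 x
    obtain ⟨k, rfl⟩ := Nat.exists_eq_add_of_le h
    simp only [AddMonoidHom.comp_apply, verschiebungPow_apply, Nat.add_sub_cancel_left]
    clear h
    induction k with
    | zero => rfl
    | succ k ih =>
      rw [Function.iterate_succ_apply', Function.iterate_succ_apply', ← ih, ← hg]
      rfl)

@[simp]
theorem mapAux_of {S : Type u} [CommRing S] (g : ℕ → WittVector p R →+ WittVector p S) (hg)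
    (n : ℕ) (x : WittVector p R) : mapAux p g hg (of p n x) = of p n (g n x) :=
  AddCommGroup.DirectLimit.map_apply_of _ _ _

/-- Functoriality of `W(R)[V⁻¹]`: `V ^ (-n) x ↦ V ^ (-n) (W(φ) x)`. -/
def map {S : Type u} [CommRing S] (φ : R →+* S) : WittVInv p R →+ WittVInv p S :=
  mapAux p (fun _ => (WittVector.map φ).toAddMonoidHom)
    (fun _ x => WittVector.map_verschiebung φ x)

variable (R)

/-- The operator `V` on `W(R)[V⁻¹]`: `V ^ (-n) x ↦ V ^ (-n) (V x)`. -/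
def V : WittVInv p R →+ WittVInv p R :=
  mapAux p (fun _ => WittVector.verschiebung) (fun _ _ => rfl)

/-- The operator `F` on `W(R)[V⁻¹]`: `V ^ (-n) x ↦ V ^ (-n) (F x)`. -/
def F [CharP R p] : WittVInv p R →+ WittVInv p R :=
  mapAux p (fun _ => (WittVector.frobenius (R := R)).toAddMonoidHom)
    (fun _ x => (WittVector.verschiebung_frobenius_comm x).symm)

variable {R} {P : Type u} [CommRing P] [CharP P p] [PerfectRing P p] [Algebra P R]

/-- The action of `u ∈ W(P)` on `W(R)[V⁻¹]`, where `R` is an algebra over the perfect ring `P`: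
`u • V ^ (-n) x = V ^ (-n) ((F ^ (-n) u) * x)`. -/
def smulHom (u : WittVector p P) : WittVInv p R →+ WittVInv p R :=
  mapAux p (fun n => AddMonoidHom.mulLeft
      (WittVector.map (algebraMap P R) ((WittVector.frobeniusEquiv p P).symm^[n] u)))
    (fun n x => by
      simp only [AddMonoidHom.coe_mulLeft]
      conv_rhs => rw [← (WittVector.frobeniusEquiv p P).apply_symm_apply
        ((WittVector.frobeniusEquiv p P).symm^[n] u), WittVector.frobeniusEquiv_apply,
        map_frobenius, mul_comm, WittVector.verschiebung_mul_frobenius, mul_comm]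
      rw [Function.iterate_succ_apply'])

instance : SMul (WittVector p P) (WittVInv p R) := ⟨fun u => smulHom p u⟩

theorem smul_of (u : WittVector p P) (n : ℕ) (x : WittVector p R) :
    u • of p n x = of p n
      (WittVector.map (algebraMap P R) ((WittVector.frobeniusEquiv p P).symm^[n] u) * x) :=
  mapAux_of p _ _ n x

instance : Module (WittVector p P) (WittVInv p R) where
  one_smul z := by
    obtain ⟨n, x, rfl⟩ := exists_of z
    rw [smul_of, iterate_map_one, map_one, one_mul]
  mul_smul u v z := by
    obtain ⟨n, x, rfl⟩ := exists_of z
    rw [smul_of, smul_of, smul_of, iterate_map_mul, map_mul (WittVector.map (algebraMap P R)), mul_assoc]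
  smul_zero u := map_zero (smulHom p u)
  smul_add u := map_add (smulHom p u)
  add_smul u v z := by
    obtain ⟨n, x, rfl⟩ := exists_of z
    rw [smul_of, smul_of, smul_of, iterate_map_add, map_add (WittVector.map (algebraMap P R)), add_mul,
      map_add]
  zero_smul z := by
    obtain ⟨n, x, rfl⟩ := exists_of z
    rw [smul_of, iterate_map_zero, map_zero, zero_mul, map_zero]

end WittVInv

end WittVInv

/-! ### The module `M(C)` -/

section ModuleM

variable (p : ℕ) [Fact p.Prime] (C : Type u) [CommRing C] [CharP C p]

/-- The ideal `Ker ν_n` of `C^♭`. -/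
abbrev kerNu (n : ℕ) : Ideal (Perfection C p) := RingHom.ker (Perfection.coeff C p n)

/-- The ring `C^♭ / Ker ν_n`. -/
abbrev FlatQuot (n : ℕ) : Type u := Perfection C p ⧸ kerNu p C n

instance (n : ℕ) : CharP (FlatQuot p C n) p :=
  RingHom.charP _ (RingHom.kerLift_injective (Perfection.coeff C p n)) p

theorem kerNu_le (n : ℕ) : kerNu p C (n + 1) ≤ kerNu p C n := by
  intro x hx
  rw [RingHom.mem_ker] at hx ⊢
  rw [← Perfection.coeff_pow_p' x n, hx, zero_pow (Fact.out : p.Prime).ne_zero]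

/-- The map `W(C^♭ / Ker ν_(n + 1))[V⁻¹] → W(C^♭ / Ker ν_n)[V⁻¹]`. -/
def transition (n : ℕ) : WittVInv p (FlatQuot p C (n + 1)) →+ WittVInv p (FlatQuot p C n) :=
  WittVInv.map p (Ideal.Quotient.factor (kerNu_le p C n))

/-- The `W(C^♭)`-module `M(C)`: the preimage of
`W(C) ⊆ W(C)[V⁻¹]` in the projective limit of the modules `W(C^♭ / Ker ν_n)[V⁻¹]`.
(If `C` is semiperfect then `C^♭ / Ker ν_0 = C`.) -/
def M : Submodule (WFlat p C) (∀ n : ℕ, WittVInv p (FlatQuot p C n)) where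
  carrier := {x | (∀ n, transition p C n (x (n + 1)) = x n) ∧
    ∃ y : WittVector p (FlatQuot p C 0), x 0 = WittVInv.of p 0 y}
  add_mem' := by
    rintro x y ⟨hx, a, ha⟩ ⟨hy, b, hb⟩
    exact ⟨fun n => by simp [hx, hy], a + b, by simp [ha, hb]⟩
  zero_mem' := ⟨fun n => by simp, 0, by simp⟩
  smul_mem' := by
    rintro u x ⟨hx, a, ha⟩
    refine ⟨fun n => ?_, _, by rw [Pi.smul_apply, ha, WittVInv.smul_of]⟩
    rw [Pi.smul_apply, Pi.smul_apply, ← hx n]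
    obtain ⟨m, z, hz⟩ := WittVInv.exists_of (x (n + 1))
    rw [hz]
    rw [WittVInv.smul_of, transition, WittVInv.map, WittVInv.mapAux_of, WittVInv.mapAux_of,
      WittVInv.smul_of]
    congr 1
    change WittVector.map _ (_ * _) = _ * WittVector.map _ _
    rw [map_mul]
    congr 1

variable {p C} in
/-- The operator `F : M(C) → M(C)`. -/
def M.F (x : M p C) : M p C :=
  ⟨fun n => WittVInv.F p _ (x.1 n), by
    obtain ⟨x, hx, a, ha⟩ := x
    refine ⟨fun n => ?_, WittVector.frobenius a, by simp only [ha]; exact WittVInv.mapAux_of p _ _ _ _⟩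
    simp only
    rw [← hx n]
    obtain ⟨m, z, hz⟩ := WittVInv.exists_of (x (n + 1))
    rw [hz]
    rw [transition, WittVInv.map, WittVInv.F, WittVInv.F, WittVInv.mapAux_of, WittVInv.mapAux_of,
      WittVInv.mapAux_of, WittVInv.mapAux_of]
    congr 1
    exact map_frobenius _ _⟩

variable {p C} in
/-- The operator `V : M(C) → M(C)`. -/
def M.V (x : M p C) : M p C :=
  ⟨fun n => WittVInv.V p _ (x.1 n), by
    obtain ⟨x, hx, a, ha⟩ := x
    refine ⟨fun n => ?_, WittVector.verschiebung a, by simp only [ha]; exact WittVInv.mapAux_of p _ _ _ _⟩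
    simp only
    rw [← hx n]
    obtain ⟨m, z, hz⟩ := WittVInv.exists_of (x (n + 1))
    rw [hz]
    rw [transition, WittVInv.map, WittVInv.V, WittVInv.V, WittVInv.mapAux_of, WittVInv.mapAux_of,
      WittVInv.mapAux_of, WittVInv.mapAux_of]
    congr 1
    exact WittVector.map_verschiebung _ _⟩

/-- The canonical map `W(C^♭) → M(C)`. -/
def toM (w : WFlat p C) : M p C :=
  ⟨fun n => WittVInv.of p 0 (WittVector.map (Ideal.Quotient.mk (kerNu p C n)) w), fun n => by
    rw [transition, WittVInv.map, WittVInv.mapAux_of]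
    congr 1, _, rfl⟩

variable {p C}

/-- `f : M(C) → A_cris(C)` is the canonical `W(C^♭)[F]`-linear map: it commutes with `F`, and on the
submodule `M_0(C)` of all `x` such that `V ^ n x = w ∈ W(C^♭)` for some `n`, one has
`f(x) = (F') ^ n (V ^ n x)`. -/
structure IsCanonicalMap (F' : Icris p C → Acris p C) (f : M p C →ₗ[WFlat p C] Acris p C) :
    Prop where
  map_F : ∀ x : M p C, f (M.F x) = acrisFrobenius p C (f x)
  map_M₀ : ∀ (x : M p C) (n : ℕ) (w : WFlat p C), M.V^[n] x = toM p C w →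
    IteratesTo F' n (algebraMap (WFlat p C) (Acris p C) w) (f x)

end ModuleM

/-! ### The ring `B[x_1 ^ (p ^ (-∞)), …, x_n ^ (p ^ (-∞))] / (x_1, …, x_n)` -/

section KeyExample

variable (p : ℕ) [Fact p.Prime]

/-- The additive monoid `ℤ_+[1/p]` of all nonnegative elements of `ℤ[1/p]`. -/
def Exponent : AddSubmonoid ℚ where
  carrier := {α | ∃ m k : ℕ, α = m / (p : ℚ) ^ k}
  add_mem' := by
    rintro _ _ ⟨m, k, rfl⟩ ⟨m', k', rfl⟩
    have hp : (p : ℚ) ≠ 0 := by exact_mod_cast (Fact.out : p.Prime).ne_zero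
    refine ⟨m * p ^ k' + p ^ k * m', k + k', ?_⟩
    rw [div_add_div _ _ (pow_ne_zero _ hp) (pow_ne_zero _ hp), pow_add]
    push_cast
    rfl
  zero_mem' := ⟨0, 0, by simp⟩

theorem Exponent.nonneg (α : Exponent p) : (0 : ℚ) ≤ α := by
  obtain ⟨_, m, k, rfl⟩ := α
  positivity

variable (B : Type u) [CommRing B] (n : ℕ)

/-- The ring `B[x_1 ^ (p ^ (-∞)), …, x_n ^ (p ^ (-∞))]` of finite sums `∑ b_α x ^ α`, where
`b_α ∈ B` and `α ∈ (ℤ_+[1/p]) ^ n`. -/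
abbrev PerfectPolynomial : Type u := AddMonoidAlgebra B (Fin n → Exponent p)

/-- The element `x_i`. -/
def PerfectPolynomial.x (i : Fin n) : PerfectPolynomial p B n :=
  AddMonoidAlgebra.single (Pi.single i ⟨1, 1, 0, by simp⟩) 1

/-- The ring `C = B[x_1 ^ (p ^ (-∞)), …, x_n ^ (p ^ (-∞))] / (x_1, …, x_n)`. -/
abbrev KeyRing : Type u :=
  PerfectPolynomial p B n ⧸ Ideal.span (Set.range (PerfectPolynomial.x p B n))

open Classical in
/-- The retraction `C → B` which kills `x ^ α` for all `α ≠ 0`. -/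
def KeyRing.retraction : KeyRing p B n →+* B :=
  Ideal.Quotient.lift _
    (AddMonoidAlgebra.lift B B (Fin n → Exponent p)
      { toFun := fun α => if α.toAdd = 0 then 1 else 0
        map_one' := by simp
        map_mul' := fun α β => by
          have : α.toAdd + β.toAdd = 0 ↔ α.toAdd = 0 ∧ β.toAdd = 0 := by
            refine ⟨fun h => ?_, fun h => by simp [h]⟩
            have h' : ∀ i, (α.toAdd i : ℚ) + β.toAdd i = 0 := fun i => by
              simpa using congrArg (fun γ => ((γ i : Exponent p) : ℚ)) h
            constructor <;> ext i
            · have := Exponent.nonneg p (α.toAdd i)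
              have := Exponent.nonneg p (β.toAdd i)
              have := h' i
              change (α.toAdd i : ℚ) = 0
              linarith
            · have := Exponent.nonneg p (α.toAdd i)
              have := Exponent.nonneg p (β.toAdd i)
              have := h' i
              change (β.toAdd i : ℚ) = 0
              linarith
          rw [toAdd_mul]
          by_cases h1 : α.toAdd = 0 <;> by_cases h2 : β.toAdd = 0 <;> simp [this, h1, h2] }).toRingHom
    (by
      intro a ha
      rw [← RingHom.mem_ker]
      refine (Ideal.span_le (I := RingHom.ker _)).2 ?_ ha
      rintro _ ⟨i, rfl⟩
      rw [SetLike.mem_coe, RingHom.mem_ker]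
      have : (Pi.single i ⟨1, 1, 0, by simp⟩ : Fin n → Exponent p) ≠ 0 := by
        intro h
        have := congrArg (fun γ => ((γ i : Exponent p) : ℚ)) h
        simp at this
      simp [PerfectPolynomial.x, this])

instance [CharP B p] : CharP (KeyRing p B n) p :=
  charP_of_injective_ringHom (f := algebraMap B (KeyRing p B n))
    (Function.LeftInverse.injective (g := KeyRing.retraction p B n) (fun b => by
      change KeyRing.retraction p B n (Ideal.Quotient.mk _ (algebraMap B _ b)) = b
      rw [KeyRing.retraction, Ideal.Quotient.lift_mk]
      simp)) p

end KeyExample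

end Fontaine

/-! Four properties of A = `Acris p (KeyRing p B n)` carry the proof: A has no p-torsion and
integers prime to p are units in it (`acris_isFlatAt`); F is injective on A
(`acrisFrobenius_injective`); p ∣ F(a) implies a ∈ I_cris (`mem_Icris_of_p_dvd_acrisFrobenius`); ν_0
is surjective (`coeff_zero_surjective`).

In the absence of torsion γ_m(x) must be x^m/m! and F' must be F/p. So (a) and (b) are divisibility
statements, and these are checked on the generators p and γ_m(b) of I_cris (`Icris_le`).

For (c), the formula F'V = id on Witt vectors dictates f(V^(-N) w) = p^(-N) F^N(w). If w ∈ W(Ker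
ν_m), then F^N(w) ∈ p^(N+m) A (`pow_dvd_frobenius_iterate_of_mem_wittKer`), because [z]^k is
divisible by k! for z ∈ Ker ν_0. Hence the m-th component of x determines f(x) modulo p^m, and f
exists by p-adic completeness. It is unique because an element of M(C) whose m-th component vanishes
is in p^m M(C) (`M.exists_smul_pow_of_eq_zero`), so that the elements V^(-N) w are p-adically dense.

For (d), if f(x) = 0 then reduction to C shows that x_0 is in the image of V, so x = V y with f(y) =
0; iterating, x_0 = 0. Applying this to V^N F^(-1) x, whose vanishing at level m means that of x at
level m + 1, gives x = 0. In the other direction, u ∈ A'' comes with v_n such that F(v_(n+1)) = p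
v_n. Peeling off Teichmüller digits, every element of A'' is the image of a Witt vector up to an
element to which F' applies infinitely often (`exists_sub_mem_AcrisInfty`), and W(C^♭) meets the
group of such elements in W(Ker ν_0) (`mem_wittKer_of_algebraMap_mem`). So the quotients v_(N_r)/p^r
yield Witt vectors w_r, and the V^(-N_r)(p^r w_r) are the components of a preimage of u.

The properties of A come from a basis. Up to p-adic completion, A is free over W(B) on the monomials
∏ [x_i]^{α_i - ⌊α_i⌋} γ_{⌊α_i⌋}([x_i]). They generate modulo every p^k (`exists_hullSum_add`), and
they are independent modulo p^k (`pow_dvd_of_pow_dvd_hullSum`), as is seen in the completed ring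
`PDSeries` of divided power polynomials, to which W(C^♭) is mapped by Fontaine's θ. Frobenius sends
the monomial of α to ∏ ⌊pα_i⌋!/⌊α_i⌋! times that of pα. This integer is nonzero, and it is prime to
p if all α_i < 1; the monomials with some α_i ≥ 1 are in I_cris. -/

namespace Fontaine

universe u

/-! ### Rings which are flat over the localization of `ℤ` at `p` -/

section Flat

/-- `R` has no `p`-torsion, and all integers prime to `p` are invertible in `R`. -/
structure IsFlatAt (p : ℕ) (R : Type u) [CommRing R] : Prop where
  eq_zero_of_mul : ∀ a : R, (p : R) * a = 0 → a = 0
  isUnit : ∀ m : ℕ, ¬ p ∣ m → IsUnit (m : R)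

theorem eq_zero_of_pow_mul {p : ℕ} {R : Type u} [CommRing R]
    (h : ∀ a : R, (p : R) * a = 0 → a = 0) (k : ℕ) {a : R} (ha : (p : R) ^ k * a = 0) : a = 0 := by
  induction k with
  | zero => simpa using ha
  | succ k ih => exact ih (h _ (by rw [← mul_assoc, ← pow_succ', ha]))

variable {p : ℕ} [Fact p.Prime] {R : Type u} [CommRing R]

/-- `n! = u * p ^ v` with `u` prime to `p`, where `v` is the `p`-adic valuation. -/
theorem exists_factorial_eq (p : ℕ) [Fact p.Prime] (n : ℕ) :
    n.factorial = (n.factorial / p ^ padicValNat p n.factorial) * p ^ padicValNat p n.factorial ∧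
      ¬ p ∣ n.factorial / p ^ padicValNat p n.factorial := by
  have hp : p.Prime := Fact.out
  refine ⟨(Nat.div_mul_cancel pow_padicValNat_dvd).symm, fun h => ?_⟩
  have := Nat.mul_dvd_of_dvd_div pow_padicValNat_dvd h
  rw [← pow_succ] at this
  exact pow_succ_padicValNat_not_dvd n.factorial_ne_zero this

namespace IsFlatAt

variable (h : IsFlatAt p R)
include h

omit [Fact p.Prime] in
theorem pow_mul_cancel (k : ℕ) {a b : R} (hab : (p : R) ^ k * a = (p : R) ^ k * b) : a = b :=
  sub_eq_zero.1 (eq_zero_of_pow_mul h.eq_zero_of_mul k (by rw [mul_sub, hab, sub_self]))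

omit [Fact p.Prime] in
theorem mul_cancel {a b : R} (hab : (p : R) * a = (p : R) * b) : a = b :=
  h.pow_mul_cancel 1 (by simpa using hab)

theorem natCast_mul_cancel {m : ℕ} (hm : m ≠ 0) {a b : R} (hab : (m : R) * a = m * b) : a = b := by
  have hp : p.Prime := Fact.out
  obtain ⟨k, u, hu, rfl⟩ := Nat.exists_eq_pow_mul_and_not_dvd hm p hp.ne_one
  push_cast at hab
  rw [mul_assoc, mul_assoc] at hab
  exact (h.isUnit u hu).mul_left_cancel (h.pow_mul_cancel k hab)

theorem factorial_mul_cancel (n : ℕ) {a b : R}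
    (hab : (n.factorial : R) * a = n.factorial * b) : a = b :=
  h.natCast_mul_cancel n.factorial_ne_zero hab

omit [Fact p.Prime] in
theorem pow_dvd_of_pow_add_dvd {k l : ℕ} {a : R} (hd : (p : R) ^ (k + l) ∣ (p : R) ^ k * a) :
    (p : R) ^ l ∣ a := by
  obtain ⟨c, hc⟩ := hd
  exact ⟨c, h.pow_mul_cancel k (by rw [hc, pow_add, mul_assoc])⟩

/-- The p-adic valuation of n! is less than n, and the prime-to-p part of n! is a unit. The spare
factor p is kept visible so that p^n/n! stays in every ideal containing p. -/
theorem exists_factorial_mul_eq {n : ℕ} (hn : n ≠ 0) :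
    ∃ c : R, (n.factorial : R) * (p * c) = (p : R) ^ n := by
  obtain ⟨h1, h2⟩ := exists_factorial_eq p n
  have h3 := padicValNat_factorial_lt_of_ne_zero p hn
  obtain ⟨c, hc⟩ := (h.isUnit _ h2).exists_right_inv
  refine ⟨c * p ^ (n - 1 - padicValNat p n.factorial), ?_⟩
  generalize padicValNat p n.factorial = v at *
  obtain ⟨d, rfl⟩ := Nat.exists_eq_add_of_lt h3
  rw [show v + d + 1 - 1 - v = d by omega]
  rw [h1]
  push_cast
  linear_combination (p : R) ^ v * p * p ^ d * hc

end IsFlatAt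

/-- The ideal of all `y` such that `y ^ m` is divisible by `m!` for all `m`, with a quotient in the
ideal `K` if `m ≠ 0`. -/
def factorialIdeal (K : Ideal R) : Ideal R where
  carrier := {y | ∀ m : ℕ, ∃ c : R, (m ≠ 0 → c ∈ K) ∧ (m.factorial : R) * c = y ^ m}
  add_mem' := by
    intro x y hx hy m
    choose a ha ha' using hx
    choose b hb hb' using hy
    refine ⟨∑ k ∈ Finset.range (m + 1), a k * b (m - k), fun hm => Ideal.sum_mem _ fun k hk => ?_,
      ?_⟩
    · rcases eq_or_ne k 0 with rfl | hk0
      · exact K.mul_mem_left _ (hb _ (by omega))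
      · exact K.mul_mem_right _ (ha _ hk0)
    · rw [add_pow, Finset.mul_sum]
      refine Finset.sum_congr rfl fun k hk => ?_
      have hk' : k ≤ m := Nat.lt_succ_iff.1 (Finset.mem_range.1 hk)
      rw [← ha', ← hb', ← Nat.choose_mul_factorial_mul_factorial hk']
      push_cast
      ring
  zero_mem' := by
    intro m
    rcases m with _ | m
    · exact ⟨1, by simp⟩
    · exact ⟨0, by simp⟩
  smul_mem' := by
    intro r x hx m
    obtain ⟨c, hc, hc'⟩ := hx m
    exact ⟨r ^ m * c, fun hm => K.mul_mem_left _ (hc hm), by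
      rw [smul_eq_mul, mul_pow, ← hc']; ring⟩

theorem mem_factorialIdeal {K : Ideal R} {y : R} : y ∈ factorialIdeal K ↔
    ∀ m : ℕ, ∃ c : R, (m ≠ 0 → c ∈ K) ∧ (m.factorial : R) * c = y ^ m :=
  Iff.rfl

theorem IsFlatAt.p_mem_factorialIdeal (h : IsFlatAt p R) {K : Ideal R} (hp : (p : R) ∈ K) :
    (p : R) ∈ factorialIdeal K := by
  intro m
  rcases eq_or_ne m 0 with rfl | hm
  · exact ⟨1, by simp⟩
  · obtain ⟨c, hc⟩ := h.exists_factorial_mul_eq hm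
    exact ⟨_, fun _ => K.mul_mem_right _ hp, hc⟩

/-- (x^n/n!)^m = x^(mn)/(n!)^m, and (mn)! = (n!)^m · m! · `uniformBell m n`, so division by m!
leaves an integer multiple of x^(mn)/(mn)!. -/
theorem IsFlatAt.mem_factorialIdeal_of_factorial_mul (h : IsFlatAt p R) {K : Ideal R} {x c : R}
    {n : ℕ} (hn : n ≠ 0) (hx : x ∈ factorialIdeal K) (hc : (n.factorial : R) * c = x ^ n) :
    c ∈ factorialIdeal K := by
  intro m
  obtain ⟨e, he, he'⟩ := hx (m * n)
  refine ⟨m.uniformBell n * e, fun hm => K.mul_mem_left _ (he (mul_ne_zero hm hn)),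
    h.natCast_mul_cancel (pow_ne_zero m n.factorial_ne_zero) ?_⟩
  push_cast
  rw [← mul_pow, hc, ← pow_mul, mul_comm n m, ← he', ← Nat.uniformBell_mul_eq m hn]
  push_cast
  ring

/-- The divided powers `x ^ n / n!` on an ideal of a ring flat over the localization of `ℤ`
at `p`. -/
def IsFlatAt.dividedPowers (h : IsFlatAt p R) (I : Ideal R) (γ : ℕ → R → R)
    (hnull : ∀ {n x}, x ∉ I → γ n x = 0)
    (spec : ∀ {n x}, x ∈ I → (n.factorial : R) * γ n x = x ^ n)
    (hmem : ∀ {n x}, n ≠ 0 → x ∈ I → γ n x ∈ I) : DividedPowers I where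
  dpow := γ
  dpow_null := hnull
  -- Each identity among the axioms is verified after multiplication by factorials, where it becomes
  -- an identity between powers.
  dpow_zero hx := h.factorial_mul_cancel 0 (by rw [spec hx]; simp)
  dpow_one hx := h.factorial_mul_cancel 1 (by rw [spec hx]; simp)
  dpow_mem := hmem
  dpow_add {n x y} hx hy := h.factorial_mul_cancel n (by
    rw [spec (I.add_mem hx hy), (Commute.all x y).add_pow', Finset.mul_sum]
    refine Finset.sum_congr rfl fun k hk => ?_
    rw [Finset.HasAntidiagonal.mem_antidiagonal] at hk
    have h1 := Nat.choose_mul_factorial_mul_factorial (show k.1 ≤ n by omega)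
    rw [show n - k.1 = k.2 by omega] at h1
    rw [← h1, ← spec hx, ← spec hy, nsmul_eq_mul]
    push_cast
    ring)
  dpow_mul {n a x} hx := h.factorial_mul_cancel n (by
    rw [spec (I.mul_mem_left a hx), mul_left_comm, spec hx, mul_pow])
  mul_dpow {m n x} hx := by
    refine h.factorial_mul_cancel m (h.factorial_mul_cancel n ?_)
    have h1 := congrArg (Nat.cast : ℕ → R) (Nat.add_choose_mul_factorial_mul_factorial n m)
    push_cast at h1
    calc _ = (m.factorial * γ m x) * (n.factorial * γ n x) := by ring
      _ = (m + n).factorial * γ (m + n) x := by rw [spec hx, spec hx, spec hx, pow_add]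
      _ = _ := by rw [add_comm m n, ← h1]; ring
  dpow_comp {m n x} hn hx := by
    refine h.factorial_mul_cancel m (h.natCast_mul_cancel
      (pow_ne_zero m n.factorial_ne_zero) ?_)
    have h1 := congrArg (Nat.cast : ℕ → R) (Nat.uniformBell_mul_eq m hn)
    push_cast at h1 ⊢
    rw [spec (hmem hn hx), ← mul_pow, spec hx, ← pow_mul, mul_comm n m, ← spec hx, ← h1]
    ring

end Flat

/-! ### `p`-adic completions -/

section PadicCompletion

variable (p : ℕ) (S : Type u) [CommRing S]

local notation "Ŝ" => AdicCompletion (Ideal.span {(p : S)}) S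

theorem span_p_pow_smul_top (k : ℕ) (x : Ŝ) :
    x ∈ (Ideal.span {(p : S)} ^ k • ⊤ : Submodule S Ŝ) ↔ (p : Ŝ) ^ k ∣ x := by
  rw [Ideal.span_singleton_pow, Submodule.ideal_span_singleton_smul]
  simp only [Submodule.mem_smul_pointwise_iff_exists, Submodule.mem_top, true_and,
    Algebra.smul_def, map_pow, map_natCast]
  exact ⟨fun ⟨b, hb⟩ => ⟨b, hb.symm⟩, fun ⟨b, hb⟩ => ⟨b, hb.symm⟩⟩

theorem adicCompletion_isAdicComplete : IsAdicComplete (Ideal.span {(p : S)}) Ŝ :=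
  AdicCompletion.isAdicComplete (Submodule.fg_span_singleton _)

instance adicCompletion_isAdicComplete' : IsAdicComplete (Ideal.span {(p : Ŝ)}) Ŝ := by
  have h := (IsAdicComplete.map_algebraMap_iff (S := Ŝ) (Ideal.span {(p : S)}) Ŝ).2
    (adicCompletion_isAdicComplete p S)
  rwa [Ideal.map_span, Set.image_singleton, map_natCast] at h

variable {S}

theorem eq_zero_of_pow_dvd {x : Ŝ} (h : ∀ k : ℕ, (p : Ŝ) ^ k ∣ x) : x = 0 := by
  refine (adicCompletion_isAdicComplete p S).haus' x fun k => ?_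
  rw [SModEq.zero, span_p_pow_smul_top]
  exact h k

theorem eq_of_pow_dvd_sub {x y : Ŝ} (h : ∀ k : ℕ, (p : Ŝ) ^ k ∣ x - y) : x = y :=
  sub_eq_zero.1 (eq_zero_of_pow_dvd p h)

theorem exists_limit (f : ℕ → Ŝ) (h : ∀ k : ℕ, (p : Ŝ) ^ k ∣ f (k + 1) - f k) :
    ∃ L : Ŝ, ∀ k : ℕ, (p : Ŝ) ^ k ∣ L - f k := by
  have h' : ∀ m d : ℕ, (p : Ŝ) ^ m ∣ f m - f (m + d) := by
    intro m d
    induction d with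
    | zero => simp
    | succ d ih =>
      have h1 := (pow_dvd_pow (p : Ŝ) (Nat.le_add_right m d)).trans (h (m + d))
      have := dvd_sub ih h1
      rwa [sub_sub, add_sub_cancel] at this
  obtain ⟨L, hL⟩ := (adicCompletion_isAdicComplete p S).prec' f (by
    intro m n hmn
    obtain ⟨d, rfl⟩ := Nat.exists_eq_add_of_le hmn
    rw [SModEq.sub_mem, span_p_pow_smul_top]
    exact h' m d)
  refine ⟨L, fun k => ?_⟩
  have := hL k
  rwa [SModEq.sub_mem, span_p_pow_smul_top, dvd_sub_comm] at this

/-- The kernel of the projection to S/p^k is not larger than p^k Ŝ because the ideal (p) is finitely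
generated. -/
theorem evalₐ_eq_zero_iff (k : ℕ) (x : Ŝ) :
    AdicCompletion.evalₐ (Ideal.span {(p : S)}) k x = 0 ↔ (p : Ŝ) ^ k ∣ x := by
  have h := AdicCompletion.pow_smul_top_eq_ker_eval (M := S) (n := k)
    (Submodule.fg_span_singleton (p : S))
  rw [← span_p_pow_smul_top, show (Ideal.span {(p : S)} ^ k • ⊤ : Submodule S Ŝ) = _ from h,
    LinearMap.mem_ker]
  rw [← AdicCompletion.factor_eval_eq_evalₐ _ _ (by simp)]
  refine map_eq_zero_iff _ ?_
  rw [injective_iff_map_eq_zero]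
  intro a ha
  obtain ⟨b, rfl⟩ := Ideal.Quotient.mk_surjective a
  replace ha : Ideal.Quotient.mk (Ideal.span {(p : S)} ^ k) b = 0 := ha
  rw [Ideal.Quotient.eq_zero_iff_mem] at ha
  rw [Ideal.Quotient.eq_zero_iff_mem]
  simpa using ha

theorem pow_dvd_algebraMap_iff (k : ℕ) (s : S) :
    (p : Ŝ) ^ k ∣ algebraMap S Ŝ s ↔ (p : S) ^ k ∣ s := by
  rw [← evalₐ_eq_zero_iff, AlgHom.commutes, Ideal.Quotient.algebraMap_eq,
    Ideal.Quotient.eq_zero_iff_mem, Ideal.span_singleton_pow, Ideal.mem_span_singleton]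

theorem exists_algebraMap_add (k : ℕ) (x : Ŝ) :
    ∃ (s : S) (y : Ŝ), x = algebraMap S Ŝ s + (p : Ŝ) ^ k * y := by
  obtain ⟨s, hs⟩ := Ideal.Quotient.mk_surjective
    (AdicCompletion.evalₐ (Ideal.span {(p : S)}) k x)
  have : (p : Ŝ) ^ k ∣ x - algebraMap S Ŝ s := by
    rw [← evalₐ_eq_zero_iff, map_sub, AlgHom.commutes, Ideal.Quotient.algebraMap_eq, hs, sub_self]
  obtain ⟨y, hy⟩ := this
  exact ⟨s, y, by rw [← hy]; ring⟩

/-- By Bézout, a multiple of m has the form 1 + p·b, and p lies in the Jacobson radical by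
completeness. -/
theorem isUnit_natCast_of_isAdicComplete [Fact p.Prime] (R : Type*) [CommRing R]
    [IsAdicComplete (Ideal.span {(p : R)}) R] (m : ℕ) (hm : ¬ p ∣ m) : IsUnit (m : R) := by
  have hp : p.Prime := Fact.out
  have hc : IsCoprime (m : ℤ) p := by
    rw [Nat.isCoprime_iff_coprime]
    exact ((hp.coprime_iff_not_dvd).2 hm).symm
  obtain ⟨a, b, hab⟩ := hc
  have hj := IsAdicComplete.le_jacobson_bot (Ideal.span {(p : R)})
    (Ideal.mem_span_singleton_self (p : R))
  rw [Ideal.mem_jacobson_bot] at hj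
  have h1 : ((a : R) * m) = p * (-b : R) + 1 := by
    have := congrArg (Int.cast : ℤ → R) hab
    push_cast at this
    linear_combination this
  have := hj (-b : R)
  rw [← h1] at this
  exact isUnit_of_mul_isUnit_right this

/-- If s approximates x modulo p^k, then p x = 0 forces p^(k+1) ∣ p s, first in Ŝ and then in S,
where p can be cancelled. -/
theorem adicCompletion_eq_zero_of_mul (h : ∀ a : S, (p : S) * a = 0 → a = 0) (x : Ŝ)
    (hx : (p : Ŝ) * x = 0) : x = 0 := by
  refine eq_zero_of_pow_dvd p fun k => ?_
  obtain ⟨s, y, rfl⟩ := exists_algebraMap_add p k x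
  refine dvd_add ?_ (dvd_mul_right _ _)
  rw [pow_dvd_algebraMap_iff]
  have h1 : (p : Ŝ) ^ (k + 1) ∣ algebraMap S Ŝ (p * s) := by
    refine ⟨-y, ?_⟩
    rw [map_mul, map_natCast]
    linear_combination hx
  rw [pow_dvd_algebraMap_iff] at h1
  obtain ⟨c, hc⟩ := h1
  refine ⟨c, sub_eq_zero.1 (h _ ?_)⟩
  rw [mul_sub, hc]
  ring

theorem adicCompletion_isFlatAt [Fact p.Prime] (h : ∀ a : S, (p : S) * a = 0 → a = 0) :
    IsFlatAt p Ŝ :=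
  ⟨adicCompletion_eq_zero_of_mul p h, isUnit_natCast_of_isAdicComplete p Ŝ⟩

theorem padicMap_algebraMap {T : Type u} [CommRing T] (φ : S →+* T) (s : S) :
    padicMap p φ (algebraMap S Ŝ s) = algebraMap T _ (φ s) := by
  refine AdicCompletion.ext_evalₐ (H := fun k => ?_)
  rw [padicMap, AdicCompletion.evalₐ_liftRingHom, AlgHom.commutes, RingHom.comp_apply]
  simp

end PadicCompletion

/-! ### The PD hull of `W(C^♭) → C` and `A_cris(C)` -/

section Hull

variable {p : ℕ} {R : Type u} [CommRing R] {I : Ideal R}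

theorem PDHull.factorial_mul_dp (n : ℕ) (x : I) :
    (n.factorial : PDHull p I) * PDHull.dp p I n x = algebraMap R _ (x : R) ^ n := by
  have h1 : PDHull.dp p I 1 x = algebraMap R _ (x : R) := by
    rw [PDHull.dp, PDHull.mk_eq_of_rel (PDHullRel.one x)]
    exact AlgHom.commutes _ _
  rw [← h1, PDHull.dp, PDHull.dp, ← map_pow, ← map_natCast (PDHull.mk p I), ← map_mul]
  congr 1
  rw [DividedPowerAlgebra.natFactorial_mul_dp_eq]

theorem PDHull.dp_one (x : I) : PDHull.dp p I 1 x = algebraMap R _ (x : R) := by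
  simpa using PDHull.factorial_mul_dp (p := p) 1 x

theorem PDHull.dp_zero (x : I) : PDHull.dp p I 0 x = 1 := by
  simpa using PDHull.factorial_mul_dp (p := p) 0 x

theorem PDHull.dp_smul (r : R) (n : ℕ) (x : I) :
    PDHull.dp p I n (r • x) = algebraMap R _ r ^ n * PDHull.dp p I n x := by
  rw [PDHull.dp, DividedPowerAlgebra.dp_smul, map_smul, Algebra.smul_def, map_pow]
  rfl

theorem PDHull.dp_mul (m n : ℕ) (x : I) :
    PDHull.dp p I m x * PDHull.dp p I n x =
      ((m + n).choose m : PDHull p I) * PDHull.dp p I (m + n) x := by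
  simp only [PDHull.dp]
  rw [← map_mul, DividedPowerAlgebra.dp_mul, map_nsmul, nsmul_eq_mul]

theorem PDHull.dp_add (n : ℕ) (x y : I) :
    PDHull.dp p I n (x + y) = ∑ k ∈ Finset.HasAntidiagonal.antidiagonal n,
      PDHull.dp p I k.1 x * PDHull.dp p I k.2 y := by
  simp only [PDHull.dp]
  rw [DividedPowerAlgebra.dp_add, map_sum]
  simp

theorem PDHull.induction_on {P : PDHull p I → Prop} (h : PDHull p I)
    (halg : ∀ r, P (algebraMap R _ r)) (hdp : ∀ n x, P (PDHull.dp p I n x))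
    (hadd : ∀ a b, P a → P b → P (a + b)) (hmul : ∀ a b, P a → P b → P (a * b)) : P h := by
  obtain ⟨h, rfl⟩ := Ideal.Quotient.mkₐ_surjective R (Ideal.ofRel (PDHullRel p I)) h
  change P (PDHull.mk p I h)
  induction h using DividedPowerAlgebra.induction_on' with
  | h_C a => exact halg a
  | h_add f g hf hg => rw [map_add]; exact hadd _ _ hf hg
  | h_dp f n m hf => rw [map_mul]; exact hmul _ _ hf (hdp n m)

end Hull

section Acris

variable {p : ℕ} [Fact p.Prime] {C : Type u} [CommRing C] [CharP C p]

theorem acris_algebraMap (w : WFlat p C) :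
    algebraMap (WFlat p C) (Acris p C) w = toAcris p C (algebraMap (WFlat p C) _ w) := rfl

theorem acrisToC_toAcris (h : AcrisHull p C) : acrisToC p C (toAcris p C h) = hullToC p C h := rfl

theorem hullToC_algebraMap (w : WFlat p C) :
    hullToC p C (algebraMap (WFlat p C) _ w) = theta p C w := by
  unfold hullToC PDHull.augmentation
  rw [PDHull.lift_algebraMap]

theorem acrisToC_algebraMap (w : WFlat p C) :
    acrisToC p C (algebraMap (WFlat p C) _ w) = theta p C w := by
  rw [acris_algebraMap, acrisToC_toAcris, hullToC_algebraMap]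

theorem hullToC_dp {n : ℕ} (hn : n ≠ 0) (b : kerTheta p C) :
    hullToC p C (PDHull.dp p _ n b) = 0 := by
  unfold hullToC PDHull.augmentation
  rw [PDHull.lift_dp, if_neg hn]

theorem factorial_mul_toAcris_dp (n : ℕ) (b : kerTheta p C) :
    (n.factorial : Acris p C) * toAcris p C (PDHull.dp p _ n b) =
      algebraMap (WFlat p C) (Acris p C) b ^ n := by
  rw [acris_algebraMap, ← map_pow, ← PDHull.factorial_mul_dp, map_mul, map_natCast]

theorem natCast_p_mem_Icris : (p : Acris p C) ∈ Icris p C := by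
  rw [RingHom.mem_ker, map_natCast, CharP.cast_eq_zero]

theorem toAcris_dp_mem_Icris {n : ℕ} (hn : n ≠ 0) (b : kerTheta p C) :
    toAcris p C (PDHull.dp p _ n b) ∈ Icris p C := by
  rw [RingHom.mem_ker, acrisToC_toAcris, hullToC_dp hn]

/-- The ideal `I_cris(C)` is generated by `p` and the divided powers of the elements of
`Ker (W(C^♭) → C)`. -/
theorem Icris_le {K : Ideal (Acris p C)} (hp : (p : Acris p C) ∈ K)
    (hdp : ∀ (n : ℕ) (b : kerTheta p C), n ≠ 0 → toAcris p C (PDHull.dp p _ n b) ∈ K) :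
    Icris p C ≤ K := by
  -- Modulo K ∩ I_cris the hull reduces to Witt vectors: this holds for its generators and passes to
  -- sums and products. An element of I_cris then reduces to a Witt vector in Ker θ, which is its
  -- own γ_1; completing adds only multiples of p.
  have key : ∀ h : AcrisHull p C, ∃ w : WFlat p C,
      toAcris p C h - algebraMap (WFlat p C) (Acris p C) w ∈ K ⊓ Icris p C := by
    intro h
    induction h using PDHull.induction_on with
    | halg w => exact ⟨w, by rw [acris_algebraMap, sub_self]; exact zero_mem _⟩
    | hdp n b =>
      rcases eq_or_ne n 0 with rfl | hn
      · exact ⟨1, by rw [PDHull.dp_zero, map_one, map_one, sub_self]; exact zero_mem _⟩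
      · exact ⟨0, by rw [map_zero, sub_zero]; exact ⟨hdp n b hn, toAcris_dp_mem_Icris hn b⟩⟩
    | hadd a b ha hb =>
      obtain ⟨v, hv⟩ := ha
      obtain ⟨w, hw⟩ := hb
      refine ⟨v + w, ?_⟩
      rw [map_add, map_add, add_sub_add_comm]
      exact add_mem hv hw
    | hmul a b ha hb =>
      obtain ⟨v, hv⟩ := ha
      obtain ⟨w, hw⟩ := hb
      refine ⟨v * w, ?_⟩
      rw [map_mul, map_mul]
      have := add_mem (Ideal.mul_mem_right (toAcris p C b) _ hv)
        (Ideal.mul_mem_left _ (algebraMap (WFlat p C) (Acris p C) v) hw)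
      convert this using 1
      ring
  intro u hu
  obtain ⟨h, y, rfl⟩ := exists_algebraMap_add p 1 u
  rw [pow_one] at hu ⊢
  obtain ⟨w, hw⟩ := key h
  have h1 : (p : Acris p C) * y ∈ K ⊓ Icris p C :=
    Ideal.mul_mem_right _ _ ⟨hp, natCast_p_mem_Icris⟩
  have h2 : algebraMap (WFlat p C) (Acris p C) w ∈ Icris p C := by
    have := sub_mem (sub_mem hu h1.2) hw.2
    convert this using 1
    rw [toAcris]
    ring
  rw [RingHom.mem_ker, acrisToC_algebraMap] at h2
  have h3 := hdp 1 ⟨w, h2⟩ one_ne_zero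
  rw [PDHull.dp_one, ← acris_algebraMap] at h3
  have := add_mem (add_mem hw.1 h3) h1.1
  convert this using 1
  rw [toAcris]
  ring

theorem acrisFrobenius_toAcris (h : AcrisHull p C) :
    acrisFrobenius p C (toAcris p C h) = toAcris p C (hullFrobenius p C h) :=
  padicMap_algebraMap p _ h

theorem hullFrobenius_algebraMap (w : WFlat p C) :
    hullFrobenius p C (algebraMap (WFlat p C) _ w) =
      algebraMap (WFlat p C) _ (WittVector.frobenius w) := by
  rw [hullFrobenius, PDHull.map, PDHull.lift_algebraMap, RingHom.comp_apply]

theorem acrisFrobenius_algebraMap (w : WFlat p C) :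
    acrisFrobenius p C (algebraMap (WFlat p C) _ w) =
      algebraMap (WFlat p C) _ (WittVector.frobenius w) := by
  rw [acris_algebraMap, acrisFrobenius_toAcris, hullFrobenius_algebraMap]
  rfl

theorem acrisFrobenius_iterate_algebraMap (n : ℕ) (w : WFlat p C) :
    (acrisFrobenius p C)^[n] (algebraMap (WFlat p C) _ w) =
      algebraMap (WFlat p C) _ (WittVector.frobenius^[n] w) := by
  induction n with
  | zero => rfl
  | succ n ih =>
    rw [Function.iterate_succ_apply', ih, acrisFrobenius_algebraMap, Function.iterate_succ_apply']

theorem p_dvd_iff_coeff_zero {R : Type*} [CommRing R] [CharP R p] [PerfectRing R p]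
    (w : WittVector p R) : (p : WittVector p R) ∣ w ↔ w.coeff 0 = 0 := by
  rw [← Ideal.mem_span_singleton, WittVector.mem_span_p_iff_coeff_zero_eq_zero]

theorem exists_p_mul_eq_frobenius_sub_pow (b : WFlat p C) :
    ∃ d : WFlat p C, (p : WFlat p C) * d = WittVector.frobenius b - b ^ p := by
  have : (p : WFlat p C) ∣ WittVector.frobenius b - b ^ p := by
    rw [p_dvd_iff_coeff_zero]
    change WittVector.constantCoeff (WittVector.frobenius b - b ^ p) = 0
    rw [map_sub, map_pow, sub_eq_zero]
    exact WittVector.coeff_frobenius_charP p b 0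
  obtain ⟨d, hd⟩ := this
  exact ⟨d, hd.symm⟩

variable (hA : IsFlatAt p (Acris p C))

include hA in
-- Only generators need testing: p qualifies by Legendre's bound on the valuation of n!, and γ_n(b)
-- because a divided power of a divided power is an integer multiple of a divided power.
theorem Icris_le_factorialIdeal : Icris p C ≤ factorialIdeal (Icris p C) := by
  refine Icris_le (hA.p_mem_factorialIdeal natCast_p_mem_Icris) fun n b hn => ?_
  exact hA.mem_factorialIdeal_of_factorial_mul hn
    (fun m => ⟨_, fun hm => toAcris_dp_mem_Icris hm b, factorial_mul_toAcris_dp m b⟩)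
    (factorial_mul_toAcris_dp n b)

/-- F(b) = p δ(b) + b^p and b^p = p! γ_p(b). -/
theorem p_dvd_acrisFrobenius_algebraMap {b : WFlat p C} (hb : b ∈ kerTheta p C) :
    (p : Acris p C) ∣ acrisFrobenius p C (algebraMap (WFlat p C) _ b) := by
  obtain ⟨d, hd⟩ := exists_p_mul_eq_frobenius_sub_pow b
  rw [acrisFrobenius_algebraMap, show WittVector.frobenius b = p * d + b ^ p by rw [hd]; ring,
    map_add, map_mul, map_natCast, map_pow, ← factorial_mul_toAcris_dp p ⟨b, hb⟩]
  refine dvd_add (dvd_mul_right _ _) (Dvd.dvd.mul_right ?_ _)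
  exact Nat.cast_dvd_cast (Nat.dvd_factorial (Fact.out : p.Prime).pos le_rfl)

include hA

/-- On generators: if F(b) = p y, then F(γ_n(b)) = (p^n/n!) y^n, and p ∣ p^n/n! for n ≠ 0. -/
theorem p_dvd_acrisFrobenius {c : Acris p C} (hc : c ∈ Icris p C) :
    (p : Acris p C) ∣ acrisFrobenius p C c := by
  have h : Icris p C ≤ (Ideal.span {(p : Acris p C)}).comap (acrisFrobenius p C) := by
    refine Icris_le ?_ fun n b hn => ?_
    · rw [Ideal.mem_comap, map_natCast]
      exact Ideal.mem_span_singleton_self _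
    · rw [Ideal.mem_comap, Ideal.mem_span_singleton]
      obtain ⟨y, hy⟩ := p_dvd_acrisFrobenius_algebraMap b.2
      obtain ⟨c, hc⟩ := hA.exists_factorial_mul_eq hn
      refine ⟨c * y ^ n, hA.factorial_mul_cancel n ?_⟩
      rw [← map_natCast (acrisFrobenius p C), ← map_mul, factorial_mul_toAcris_dp, map_pow, hy,
        mul_pow, ← hc, map_natCast]
      ring
  exact Ideal.mem_span_singleton.1 (h hc)

theorem exists_dividedPowers :
    ∃ γ : DividedPowers (Icris p C), IsCanonicalDividedPowers p C γ := by
  classical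
  have key : ∀ (n : ℕ) (x : Acris p C), ∃ c : Acris p C, (x ∉ Icris p C → c = 0) ∧
      (x ∈ Icris p C → (n.factorial : Acris p C) * c = x ^ n ∧ (n ≠ 0 → c ∈ Icris p C)) := by
    intro n x
    by_cases hx : x ∈ Icris p C
    · obtain ⟨c, hc, hc'⟩ := Icris_le_factorialIdeal hA hx n
      exact ⟨c, fun h => absurd hx h, fun _ => ⟨hc', hc⟩⟩
    -- `DividedPowers` demands the value 0 outside the ideal.
    · exact ⟨0, fun _ => rfl, fun h => absurd h hx⟩
  choose γ hγ0 hγ using key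
  refine ⟨hA.dividedPowers (Icris p C) γ (fun hx => hγ0 _ _ hx) (fun hx => (hγ _ _ hx).1)
    (fun hn hx => (hγ _ _ hx).2 hn), fun n b => hA.factorial_mul_cancel n ?_⟩
  rw [factorial_mul_toAcris_dp]
  refine (hγ _ _ ?_).1
  rw [RingHom.mem_ker, acrisToC_algebraMap]
  exact b.2

theorem existsUnique_dividedPowers :
    ∃! γ : DividedPowers (Icris p C), IsCanonicalDividedPowers p C γ := by
  obtain ⟨γ, hγ⟩ := exists_dividedPowers hA
  refine ⟨γ, hγ, fun γ' _ => ?_⟩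
  refine DividedPowers.ext _ _ fun {n x} hx => hA.factorial_mul_cancel n ?_
  rw [γ.factorial_mul_dpow_eq_pow hx, γ'.factorial_mul_dpow_eq_pow hx]

/-- The map `F' = F / p`. -/
theorem exists_frobenius_div_p : ∃ F' : Icris p C →ₛₗ[acrisFrobenius p C] Acris p C,
    ∀ c, (p : Acris p C) * F' c = acrisFrobenius p C c := by
  have key : ∀ c : Icris p C, ∃ y, (p : Acris p C) * y = acrisFrobenius p C c := fun c => by
    obtain ⟨y, hy⟩ := p_dvd_acrisFrobenius hA c.2
    exact ⟨y, hy.symm⟩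
  choose g hg using key
  refine ⟨{ toFun := g, map_add' := fun a b => hA.mul_cancel ?_,
            map_smul' := fun r a => hA.mul_cancel ?_ }, hg⟩
  · rw [hg, mul_add, hg, hg, Submodule.coe_add, map_add]
  · rw [hg, smul_eq_mul, mul_left_comm, hg, Submodule.coe_smul, smul_eq_mul, map_mul]

variable {γ : DividedPowers (Icris p C)}

omit hA in
-- By F-linearity p F'(c) = F'(p c), and the right side is prescribed. So F' can only be F/p.
theorem IsFPrime.p_mul {F' : Icris p C →ₛₗ[acrisFrobenius p C] Acris p C}
    (h : IsFPrime p C γ F') (c : Icris p C) :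
    (p : Acris p C) * F' c = acrisFrobenius p C c := by
  rw [← h.mul_p c ((p : Acris p C) • c) rfl, map_smulₛₗ, map_natCast, smul_eq_mul]

theorem isFPrime_of_p_mul {F' : Icris p C →ₛₗ[acrisFrobenius p C] Acris p C}
    (h : ∀ c, (p : Acris p C) * F' c = acrisFrobenius p C c) : IsFPrime p C γ F' where
  mul_p b c hc := hA.mul_cancel (by rw [h, hc, map_mul, map_natCast])
  dpow n hn b c hc := by
    obtain ⟨h1, -⟩ := exists_factorial_eq p n
    have h2 := padicValNat_factorial_lt_of_ne_zero p (n := n) (by omega)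
    have h3 : (n.factorial : Acris p C) * (p * F' c) = (p * F' b) ^ n := by
      rw [h, h, hc, ← map_pow, ← γ.factorial_mul_dpow_eq_pow b.2 (n := n), map_mul, map_natCast]
    generalize (n.factorial / p ^ padicValNat p n.factorial) = u at *
    generalize padicValNat p n.factorial = v at *
    obtain ⟨d, rfl⟩ := Nat.exists_eq_add_of_lt h2
    rw [show v + d + 1 - 1 - v = d by omega]
    -- Multiplying by p^(v+1), where v is the valuation of n!, turns the claim into n! · p F'(c) =
    -- (p F'(b))^n.
    refine hA.pow_mul_cancel (v + 1) ?_
    rw [h1] at h3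
    push_cast at h3
    linear_combination h3
  theta b d c hb hd hc := by
    have h1 := γ.factorial_mul_dpow_eq_pow c.2 (n := p)
    have h2 := Nat.mul_factorial_pred (Fact.out : p.Prime).ne_zero
    refine hA.mul_cancel ?_
    rw [h, mul_add, ← mul_assoc, ← Nat.cast_mul, h2, h1, hc, acrisFrobenius_algebraMap,
      ← map_natCast (algebraMap (WFlat p C) (Acris p C)), ← map_mul, hd, map_sub, map_pow]
    ring

theorem existsUnique_isFPrime : ∃! F' : Icris p C →ₛₗ[acrisFrobenius p C] Acris p C,
    IsFPrime p C γ F' := by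
  obtain ⟨F', hF'⟩ := exists_frobenius_div_p hA
  refine ⟨F', isFPrime_of_p_mul hA hF', fun G hG => ?_⟩
  refine LinearMap.ext fun c => ?_
  exact hA.mul_cancel (by rw [hG.p_mul, hF'])

end Acris

/-! ### The ideals `W(Ker ν_m)` of `W(C^♭)` -/

section WittKer

theorem exists_verschiebung_of_coeff_zero {p : ℕ} [Fact p.Prime] {R : Type*} [CommRing R]
    {w : WittVector p R} (h : w.coeff 0 = 0) : ∃ v, w = WittVector.verschiebung v := by
  refine ⟨w.shift 1, ?_⟩
  rw [WittVector.verschiebung_shift w 0 (by simpa using h)]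
  ext i
  rw [WittVector.shift_coeff, zero_add]

theorem exists_eq_teichmuller_add {p : ℕ} [Fact p.Prime] {R : Type*} [CommRing R]
    (w : WittVector p R) :
    ∃ v, w = WittVector.teichmuller p (w.coeff 0) + WittVector.verschiebung v := by
  have : (w - WittVector.teichmuller p (w.coeff 0)).coeff 0 = 0 := by
    change WittVector.constantCoeff (w - WittVector.teichmuller p (w.coeff 0)) = 0
    rw [map_sub, sub_eq_zero]
    exact (WittVector.teichmuller_coeff_zero p _).symm
  obtain ⟨v, hv⟩ := exists_verschiebung_of_coeff_zero this
  exact ⟨v, by rw [← hv]; ring⟩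

theorem p_mul_eq_verschiebung_frobenius {p : ℕ} [Fact p.Prime] {R : Type*} [CommRing R] [CharP R p]
    (w : WittVector p R) :
    (p : WittVector p R) * w = WittVector.verschiebung (WittVector.frobenius w) := by
  rw [WittVector.verschiebung_frobenius, mul_comm]

theorem frobenius_verschiebung_eq_p_mul {p : ℕ} [Fact p.Prime] {R : Type*} [CommRing R]
    (w : WittVector p R) :
    WittVector.frobenius (WittVector.verschiebung w) = (p : WittVector p R) * w := by
  rw [WittVector.frobenius_verschiebung, mul_comm]

theorem frobenius_teichmuller {p : ℕ} [Fact p.Prime] {R : Type*} [CommRing R] [CharP R p]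
    (r : R) :
    WittVector.frobenius (WittVector.teichmuller p r) = WittVector.teichmuller p r ^ p := by
  rw [WittVector.frobenius_eq_map_frobenius, WittVector.map_teichmuller, ← map_pow]
  rfl

theorem frobenius_iterate_teichmuller {p : ℕ} [Fact p.Prime] {R : Type*} [CommRing R] [CharP R p]
    (n : ℕ) (r : R) :
    WittVector.frobenius^[n] (WittVector.teichmuller p r) =
      WittVector.teichmuller p r ^ p ^ n := by
  induction n with
  | zero => simp
  | succ n ih =>
    rw [Function.iterate_succ_apply', ih, map_pow, frobenius_teichmuller, ← pow_mul, ← pow_succ']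

theorem frobenius_iterate_p_mul {p : ℕ} [Fact p.Prime] {R : Type*} [CommRing R]
    (n : ℕ) (w : WittVector p R) :
    WittVector.frobenius^[n] ((p : WittVector p R) * w) = p * WittVector.frobenius^[n] w := by
  induction n with
  | zero => rfl
  | succ n ih => rw [Function.iterate_succ_apply', ih, map_mul, map_natCast,
      Function.iterate_succ_apply']

theorem frobenius_iterate_verschiebung_iterate {p : ℕ} [Fact p.Prime] {R : Type*} [CommRing R]
    (n : ℕ) (w : WittVector p R) :
    WittVector.frobenius^[n] (WittVector.verschiebung^[n] w) = (p : WittVector p R) ^ n * w := by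
  induction n generalizing w with
  | zero => simp
  | succ n ih =>
    rw [Function.iterate_succ_apply', Function.iterate_succ_apply, ih, map_mul, map_pow,
      map_natCast, frobenius_verschiebung_eq_p_mul]
    ring

variable (p : ℕ) [Fact p.Prime] (C : Type u) [CommRing C] [CharP C p]

/-- The ideal `W(Ker ν_m)` of `W(C^♭)`. -/
def wittKer (m : ℕ) : Ideal (WFlat p C) :=
  RingHom.ker (WittVector.map (p := p) (Ideal.Quotient.mk (kerNu p C m)))

variable {p C}

theorem mem_wittKer {m : ℕ} {w : WFlat p C} :
    w ∈ wittKer p C m ↔ ∀ i, w.coeff i ∈ kerNu p C m := by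
  rw [wittKer, RingHom.mem_ker, WittVector.map_eq_zero_iff]
  simp only [Ideal.Quotient.eq_zero_iff_mem]

theorem map_mk_eq_iff {m : ℕ} {v w : WFlat p C} :
    WittVector.map (p := p) (Ideal.Quotient.mk (kerNu p C m)) v =
      WittVector.map (Ideal.Quotient.mk (kerNu p C m)) w ↔ v - w ∈ wittKer p C m := by
  rw [wittKer, RingHom.mem_ker, map_sub, sub_eq_zero]

theorem teichmuller_mem_wittKer {m : ℕ} {z : Perfection C p} (hz : z ∈ kerNu p C m) :
    WittVector.teichmuller p z ∈ wittKer p C m := by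
  rw [wittKer, RingHom.mem_ker, WittVector.map_teichmuller, Ideal.Quotient.eq_zero_iff_mem.2 hz,
    WittVector.teichmuller_zero]

theorem verschiebung_mem_wittKer {m : ℕ} {w : WFlat p C} :
    WittVector.verschiebung w ∈ wittKer p C m ↔ w ∈ wittKer p C m := by
  rw [mem_wittKer, mem_wittKer]
  refine ⟨fun h i => ?_, fun h i => ?_⟩
  · rw [← WittVector.verschiebung_coeff_succ]
    exact h _
  · rcases i with _ | i
    · rw [WittVector.verschiebung_coeff_zero]
      exact zero_mem _
    · rw [WittVector.verschiebung_coeff_succ]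
      exact h i

theorem exists_eq_teichmuller_add_of_mem_wittKer {m : ℕ} {w : WFlat p C}
    (hw : w ∈ wittKer p C m) : ∃ z ∈ kerNu p C m, ∃ v ∈ wittKer p C m,
      w = WittVector.teichmuller p z + WittVector.verschiebung v := by
  obtain ⟨v, hv⟩ := exists_eq_teichmuller_add w
  have hz := mem_wittKer.1 hw 0
  refine ⟨_, hz, v, ?_, hv⟩
  rw [← verschiebung_mem_wittKer, show WittVector.verschiebung v =
    w - WittVector.teichmuller p (w.coeff 0) by rw [eq_sub_iff_add_eq', ← hv]]
  exact sub_mem hw (teichmuller_mem_wittKer hz)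

/-- F raises Witt coefficients to the p-th power, and ν_(m+1)(c^p) = ν_m(c). -/
theorem frobenius_mem_wittKer {m : ℕ} {w : WFlat p C} :
    WittVector.frobenius w ∈ wittKer p C (m + 1) ↔ w ∈ wittKer p C m := by
  rw [mem_wittKer, mem_wittKer]
  refine forall_congr' fun i => ?_
  rw [RingHom.mem_ker, RingHom.mem_ker, WittVector.coeff_frobenius_charP,
    Perfection.coeff_pow_p]

/-- p = VF; here F raises the level by one and V preserves it. -/
theorem pow_p_mul_mem_wittKer {m r : ℕ} {w : WFlat p C} (hw : w ∈ wittKer p C m) :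
    (p : WFlat p C) ^ r * w ∈ wittKer p C (m + r) := by
  induction r with
  | zero => simpa using hw
  | succ r ih =>
    rw [pow_succ', mul_assoc, p_mul_eq_verschiebung_frobenius, verschiebung_mem_wittKer,
      ← add_assoc, frobenius_mem_wittKer]
    exact ih

theorem exists_frobenius_eq (w : WFlat p C) : ∃ v : WFlat p C, WittVector.frobenius v = w :=
  ⟨(WittVector.frobeniusEquiv p (Perfection C p)).symm w,
    (WittVector.frobeniusEquiv p (Perfection C p)).apply_symm_apply w⟩

theorem theta_apply (w : WFlat p C) : theta p C w = Perfection.coeff C p 0 (w.coeff 0) := rfl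

theorem theta_teichmuller (z : Perfection C p) :
    theta p C (WittVector.teichmuller p z) = Perfection.coeff C p 0 z := by
  rw [theta_apply, WittVector.teichmuller_coeff_zero]

theorem theta_verschiebung (w : WFlat p C) : theta p C (WittVector.verschiebung w) = 0 := by
  rw [theta_apply, WittVector.verschiebung_coeff_zero, map_zero]

theorem theta_eq_zero_of_mem_wittKer {w : WFlat p C} (hw : w ∈ wittKer p C 0) :
    theta p C w = 0 :=
  mem_wittKer.1 hw 0

/-- For `z ∈ Ker ν_0`, the element `[z] ^ k` of `A_cris(C)` is divisible by `k!`. -/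
theorem exists_factorial_mul_eq_teichmuller_pow {z : Perfection C p} (hz : z ∈ kerNu p C 0)
    {k : ℕ} (hk : k ≠ 0) : ∃ a ∈ Icris p C, (k.factorial : Acris p C) * a =
      algebraMap (WFlat p C) (Acris p C) (WittVector.teichmuller p z ^ k) := by
  have hz' : WittVector.teichmuller p z ∈ kerTheta p C := by
    rw [RingHom.mem_ker, theta_teichmuller]; exact hz
  exact ⟨_, toAcris_dp_mem_Icris hk ⟨_, hz'⟩, by rw [factorial_mul_toAcris_dp, map_pow]⟩

theorem p_pow_dvd_factorial (k : ℕ) : p ^ k ∣ (p ^ k).factorial :=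
  Nat.dvd_factorial (pow_pos (Fact.out : p.Prime).pos k) le_rfl

theorem exists_eq_pow_of_mem_kerNu {m : ℕ} {y : Perfection C p} (hy : y ∈ kerNu p C m) :
    ∃ z ∈ kerNu p C 0, y = z ^ p ^ m := by
  refine ⟨(frobeniusEquiv (Perfection C p) p).symm^[m] y, ?_, ?_⟩
  · rw [RingHom.mem_ker, Perfection.coeff_iterate_symm_frobeniusEquiv, zero_add]
    exact hy
  · rw [← iterate_frobenius]
    exact (Function.RightInverse.iterate
      (frobeniusEquiv (Perfection C p) p).apply_symm_apply m y).symm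

/-- This estimate makes f well defined. Write w = [y] + V v. Then y = z^(p^m) with z ∈ Ker ν_0, so
F^N[y] = [z]^(p^(N+m)) is divisible by (p^(N+m))!, hence by p^(N+m). The term V v is handled by
induction. -/
theorem pow_dvd_frobenius_iterate_of_mem_wittKer {m : ℕ} (N : ℕ) {w : WFlat p C}
    (hw : w ∈ wittKer p C m) : (p : Acris p C) ^ (N + m) ∣
      algebraMap (WFlat p C) (Acris p C) (WittVector.frobenius^[N] w) := by
  -- Induction on N + m, since either summand may drop: F^N V v = p F^(N-1) v lowers N, whereas for
  -- N = 0 one has V v = p F^(-1) v, with F^(-1) v one level lower.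
  obtain ⟨s, hs⟩ : ∃ s, N + m = s := ⟨_, rfl⟩
  induction s generalizing N m w with
  | zero => simp [hs]
  | succ s ih =>
    obtain ⟨y, hy, v, hv, rfl⟩ := exists_eq_teichmuller_add_of_mem_wittKer hw
    rw [iterate_map_add, map_add]
    refine dvd_add ?_ ?_
    · obtain ⟨z, hz, rfl⟩ := exists_eq_pow_of_mem_kerNu hy
      rw [frobenius_iterate_teichmuller, map_pow (WittVector.teichmuller p), ← pow_mul, ← pow_add]
      obtain ⟨a, -, ha⟩ := exists_factorial_mul_eq_teichmuller_pow hz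
        (pow_ne_zero (m + N) (Fact.out : p.Prime).ne_zero)
      rw [← ha, add_comm N m]
      refine Dvd.dvd.mul_right ?_ _
      exact_mod_cast Nat.cast_dvd_cast (p_pow_dvd_factorial (m + N))
    · rcases N with _ | N
      · obtain ⟨m, rfl⟩ : ∃ m', m = m' + 1 := ⟨s, by omega⟩
        obtain ⟨v', rfl⟩ := exists_frobenius_eq v
        rw [Function.iterate_zero_apply, ← p_mul_eq_verschiebung_frobenius, map_mul, map_natCast,
          ← add_assoc, pow_succ']
        exact mul_dvd_mul_left _ (ih 0 (frobenius_mem_wittKer.1 hv) (by omega))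
      · rw [Function.iterate_succ_apply, frobenius_verschiebung_eq_p_mul, frobenius_iterate_p_mul, map_mul, map_natCast, show N + 1 + m = N + m + 1 by ring, pow_succ']
        exact mul_dvd_mul_left _ (ih N hv (by omega))

/-- At level 0 the quotient F^N(w)/p^N moreover stays in I_cris, so that F' may be applied again. -/
theorem exists_pow_mul_eq_of_mem_wittKer (N : ℕ) {w : WFlat p C} (hw : w ∈ wittKer p C 0) :
    ∃ a ∈ Icris p C, (p : Acris p C) ^ N * a =
      algebraMap (WFlat p C) (Acris p C) (WittVector.frobenius^[N] w) := by
  induction N generalizing w with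
  | zero =>
    refine ⟨_, ?_, by rw [pow_zero, one_mul]⟩
    rw [RingHom.mem_ker, acrisToC_algebraMap]
    exact theta_eq_zero_of_mem_wittKer hw
  | succ N ih =>
    obtain ⟨z, hz, v, hv, rfl⟩ := exists_eq_teichmuller_add_of_mem_wittKer hw
    obtain ⟨a, ha, ha'⟩ := exists_factorial_mul_eq_teichmuller_pow hz
      (pow_ne_zero (N + 1) (Fact.out : p.Prime).ne_zero)
    obtain ⟨b, hb, hb'⟩ := ih hv
    obtain ⟨c, hc⟩ := p_pow_dvd_factorial (p := p) (N + 1)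
    refine ⟨c * a + b, add_mem (Ideal.mul_mem_left _ _ ha) hb, ?_⟩
    rw [iterate_map_add, map_add, frobenius_iterate_teichmuller, ← ha', hc,
      Function.iterate_succ_apply, frobenius_verschiebung_eq_p_mul, frobenius_iterate_p_mul,
      map_mul, map_natCast, ← hb']
    push_cast
    ring

/-- For `w ∈ W(Ker ν_0) + V ^ n W(C^♭)` and `j < n`, the element `F ^ j (w) / p ^ j` is defined and
belongs to `I_cris(C)`. -/
theorem exists_pow_mul_eq_of_sub_mem_wittKer {n j : ℕ} (hj : j < n) {w v : WFlat p C}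
    (hw : w - WittVector.verschiebung^[n] v ∈ wittKer p C 0) :
    ∃ a ∈ Icris p C, (p : Acris p C) ^ j * a =
      algebraMap (WFlat p C) (Acris p C) (WittVector.frobenius^[j] w) := by
  obtain ⟨a, ha, ha'⟩ := exists_pow_mul_eq_of_mem_wittKer j hw
  -- With n = j + d + 1, F^j V^n v = p^j V^(d+1) v. The strict inequality leaves at least one V, so
  -- θ kills the quotient.
  obtain ⟨d, rfl⟩ := Nat.exists_eq_add_of_lt hj
  refine ⟨a + algebraMap _ _ (WittVector.verschiebung^[d + 1] v), add_mem ha ?_, ?_⟩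
  · rw [RingHom.mem_ker, acrisToC_algebraMap, Function.iterate_succ_apply', theta_verschiebung]
  · rw [mul_add, ha', ← map_natCast (algebraMap (WFlat p C) (Acris p C)), ← map_pow, ← map_mul,
      ← frobenius_iterate_verschiebung_iterate, ← map_add, ← iterate_map_add,
      ← Function.iterate_add_apply, ← add_assoc]
    simp

end WittKer

/-! ### Elements of `W(R)[V⁻¹]` and of `M(C)` -/

namespace WittVInv

variable {p : ℕ} [Fact p.Prime] {R : Type u} [CommRing R]

theorem of_add_verschiebung_iterate (n d : ℕ) (x : WittVector p R) :
    of p (n + d) (WittVector.verschiebung^[d] x) = of p n x := by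
  have h := AddCommGroup.DirectLimit.of_f (G := fun _ : ℕ => WittVector p R)
    (f := verschiebungPow p R) (hij := Nat.le_add_right n d) (x := x)
  rw [verschiebungPow_apply, Nat.add_sub_cancel_left] at h
  exact h

theorem of_succ_verschiebung (n : ℕ) (x : WittVector p R) :
    of p (n + 1) (WittVector.verschiebung x) = of p n x :=
  of_add_verschiebung_iterate n 1 x

theorem of_injective (n : ℕ) : Function.Injective (of p n : WittVector p R →+ WittVInv p R) := by
  rw [injective_iff_map_eq_zero]
  intro x hx
  obtain ⟨j, hj, h⟩ := AddCommGroup.DirectLimit.of.zero_exact (f := verschiebungPow p R) n x hx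
  rw [verschiebungPow_apply] at h
  have hinj := (WittVector.verschiebung_injective p R).iterate (j - n)
  exact hinj (h.trans (iterate_map_zero _ _).symm)

theorem V_of (n : ℕ) (x : WittVector p R) :
    V p R (of p n x) = of p n (WittVector.verschiebung x) :=
  mapAux_of p _ _ _ _

theorem V_of_succ (n : ℕ) (x : WittVector p R) : V p R (of p (n + 1) x) = of p n x := by
  rw [V_of, of_succ_verschiebung]

theorem F_of [CharP R p] (n : ℕ) (x : WittVector p R) :
    F p R (of p n x) = of p n (WittVector.frobenius x) :=
  mapAux_of p _ _ _ _

theorem map_of {S : Type u} [CommRing S] (φ : R →+* S) (n : ℕ) (x : WittVector p R) :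
    map p φ (of p n x) = of p n (WittVector.map φ x) :=
  mapAux_of p _ _ _ _

theorem V_injective : Function.Injective (V p R) := by
  rw [injective_iff_map_eq_zero]
  intro z hz
  obtain ⟨n, x, rfl⟩ := exists_of z
  rw [← of_succ_verschiebung, V_of_succ] at hz
  rw [← of_succ_verschiebung, of_injective n (hz.trans (map_zero _).symm), map_zero]

end WittVInv

section ModuleM

variable {p : ℕ} [Fact p.Prime] {C : Type u} [CommRing C] [CharP C p]

/-- The `m`-th component of `x` is the image of `V ^ (-N) w`. -/
def M.Rep (x : M p C) (m N : ℕ) (w : WFlat p C) : Prop :=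
  x.1 m = WittVInv.of p N (WittVector.map (Ideal.Quotient.mk (kerNu p C m)) w)

namespace M

theorem exists_rep (x : M p C) (m : ℕ) : ∃ N w, M.Rep x m N w := by
  obtain ⟨N, y, hy⟩ := WittVInv.exists_of (x.1 m)
  obtain ⟨w, rfl⟩ := WittVector.map_surjective _ Ideal.Quotient.mk_surjective y
  exact ⟨N, w, hy⟩

theorem exists_rep_zero (x : M p C) : ∃ w, M.Rep x 0 0 w := by
  obtain ⟨y, hy⟩ := x.2.2
  obtain ⟨w, rfl⟩ := WittVector.map_surjective _ Ideal.Quotient.mk_surjective y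
  exact ⟨w, hy⟩

theorem Rep.shift {x : M p C} {m N : ℕ} {w : WFlat p C} (h : M.Rep x m N w) (d : ℕ) :
    M.Rep x m (N + d) (WittVector.verschiebung^[d] w) := by
  have : WittVector.map (Ideal.Quotient.mk (kerNu p C m)) (WittVector.verschiebung^[d] w) =
      WittVector.verschiebung^[d] (WittVector.map (Ideal.Quotient.mk (kerNu p C m)) w) :=
    Function.Semiconj.iterate_right (f := WittVector.map (Ideal.Quotient.mk (kerNu p C m)))
      (fun w => WittVector.map_verschiebung _ w) d w
  rw [Rep, this, WittVInv.of_add_verschiebung_iterate]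
  exact h

theorem map_factor (m : ℕ) (w : WFlat p C) :
    WittVector.map (Ideal.Quotient.factor (kerNu_le p C m))
      (WittVector.map (Ideal.Quotient.mk (kerNu p C (m + 1))) w) =
    WittVector.map (Ideal.Quotient.mk (kerNu p C m)) w := rfl

theorem Rep.lower {x : M p C} {m N : ℕ} {w : WFlat p C} (h : M.Rep x (m + 1) N w) :
    M.Rep x m N w := by
  rw [Rep, ← x.2.1 m, h, transition, WittVInv.map_of, map_factor]

theorem rep_iff_of_rep {x : M p C} {m N : ℕ} {w v : WFlat p C} (h : M.Rep x m N w) :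
    M.Rep x m N v ↔ v - w ∈ wittKer p C m := by
  rw [Rep, h, (WittVInv.of_injective N).eq_iff, eq_comm, map_mk_eq_iff]

theorem Rep.add {x y : M p C} {m N : ℕ} {v w : WFlat p C} (hx : M.Rep x m N v) (hy : M.Rep y m N w) :
    M.Rep (x + y) m N (v + w) := by
  rw [Rep, map_add, map_add, ← hx, ← hy]
  rfl

theorem Rep.smul {x : M p C} {m N : ℕ} {w : WFlat p C} (h : M.Rep x m N w) (u : WFlat p C) :
    M.Rep (u • x) m N ((WittVector.frobeniusEquiv p (Perfection C p)).symm^[N] u * w) := by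
  change u • x.1 m = _
  rw [h, WittVInv.smul_of, map_mul (WittVector.map _)]
  rfl

theorem Rep.F {x : M p C} {m N : ℕ} {w : WFlat p C} (h : M.Rep x m N w) :
    M.Rep (M.F x) m N (WittVector.frobenius w) := by
  change WittVInv.F p _ (x.1 m) = _
  rw [h, WittVInv.F_of, map_frobenius]

theorem Rep.V {x : M p C} {m N : ℕ} {w : WFlat p C} (h : M.Rep x m N w) :
    M.Rep (M.V x) m N (WittVector.verschiebung w) := by
  change WittVInv.V p _ (x.1 m) = _
  rw [h, WittVInv.V_of, WittVector.map_verschiebung]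

theorem Rep.V_iterate {x : M p C} {m N : ℕ} {w : WFlat p C} (h : M.Rep x m N w) (n : ℕ) :
    M.Rep (M.V^[n] x) m N (WittVector.verschiebung^[n] w) := by
  induction n with
  | zero => exact h
  | succ n ih =>
    rw [Function.iterate_succ_apply', Function.iterate_succ_apply']
    exact ih.V

theorem rep_of_rep_V {x : M p C} {m N : ℕ} {w : WFlat p C} (h : M.Rep (M.V x) m N w) :
    M.Rep x m (N + 1) w := by
  refine WittVInv.V_injective (p := p) ?_
  rw [WittVInv.V_of_succ]
  exact h

theorem rep_of_rep_V_iterate {x : M p C} {m N n : ℕ} {w : WFlat p C}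
    (h : M.Rep (M.V^[n] x) m N w) : M.Rep x m (N + n) w := by
  induction n generalizing N with
  | zero => exact h
  | succ n ih =>
    rw [Function.iterate_succ_apply'] at h
    rw [← add_assoc, add_right_comm]
    exact ih (rep_of_rep_V h)

theorem rep_toM (w : WFlat p C) (m : ℕ) : M.Rep (toM p C w) m 0 w := rfl

/-- A compatible system of elements `V ^ (-N_m) w_m` defines an element of `M(C)`. -/
theorem exists_of_compatible (N : ℕ → ℕ) (w : ℕ → WFlat p C) (hN : N 0 = 0)
    (h : ∀ m, ∃ d, N (m + 1) = N m + d ∧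
      w (m + 1) - WittVector.verschiebung^[d] (w m) ∈ wittKer p C m) :
    ∃ x : M p C, ∀ m, M.Rep x m (N m) (w m) := by
  refine ⟨⟨fun m => WittVInv.of p (N m)
    (WittVector.map (Ideal.Quotient.mk (kerNu p C m)) (w m)), fun m => ?_, _, by simp only [hN]; rfl⟩,
    fun m => rfl⟩
  obtain ⟨d, hd, hw⟩ := h m
  rw [transition, WittVInv.map_of, map_factor, map_mk_eq_iff.2 hw, hd]
  have : WittVector.map (Ideal.Quotient.mk (kerNu p C m)) (WittVector.verschiebung^[d] (w m)) =
      WittVector.verschiebung^[d] (WittVector.map (Ideal.Quotient.mk (kerNu p C m)) (w m)) :=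
    Function.Semiconj.iterate_right (f := WittVector.map (Ideal.Quotient.mk (kerNu p C m)))
      (fun w => WittVector.map_verschiebung _ w) d (w m)
  rw [this, WittVInv.of_add_verschiebung_iterate]

end M

/-! ### The map `M(C) → A_cris(C)` -/

/-- `a` is congruent to `p ^ (-N) F ^ N (w)` modulo `p ^ m`. -/
def Approx (a : Acris p C) (m N : ℕ) (w : WFlat p C) : Prop :=
  (p : Acris p C) ^ (N + m) ∣ (p : Acris p C) ^ N * a -
    algebraMap (WFlat p C) (Acris p C) (WittVector.frobenius^[N] w)

theorem approx_congr {a : Acris p C} {m N : ℕ} {v w : WFlat p C} (h : v - w ∈ wittKer p C m) :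
    Approx a m N v ↔ Approx a m N w := by
  have h1 := pow_dvd_frobenius_iterate_of_mem_wittKer N h
  rw [iterate_map_sub, map_sub] at h1
  rw [Approx, Approx]
  refine (dvd_iff_dvd_of_dvd_sub ?_)
  convert (dvd_neg.2 h1) using 1
  ring

variable (hA : IsFlatAt p (Acris p C))
include hA

theorem approx_shift {a : Acris p C} {m N : ℕ} (d : ℕ) {w : WFlat p C} :
    Approx a m (N + d) (WittVector.verschiebung^[d] w) ↔ Approx a m N w := by
  rw [Approx, Approx, Function.iterate_add_apply, frobenius_iterate_verschiebung_iterate]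
  have h1 : ∀ v : WFlat p C, WittVector.frobenius^[N] ((p : WFlat p C) ^ d * v) =
      p ^ d * WittVector.frobenius^[N] v := by
    intro v
    induction d with
    | zero => simp
    | succ d ih => rw [pow_succ', mul_assoc, frobenius_iterate_p_mul, ih, mul_assoc]
  rw [h1, map_mul, map_pow, map_natCast, add_comm N d, add_assoc, pow_add _ d N, mul_assoc,
    ← mul_sub]
  refine ⟨hA.pow_dvd_of_pow_add_dvd, fun h => ?_⟩
  rw [pow_add]
  exact mul_dvd_mul_left _ h

/-- Two representatives become comparable over the common denominator V^(N+N'). There they differ by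
an element of W(Ker ν_m), to which the divisibility estimate applies. -/
theorem approx_of_rep {x : M p C} {a : Acris p C} {m N N' : ℕ} {w w' : WFlat p C}
    (h : M.Rep x m N w) (h' : M.Rep x m N' w') (ha : Approx a m N w) : Approx a m N' w' := by
  rw [← approx_shift hA N]
  rw [← approx_shift hA N', add_comm] at ha
  have h1 := h.shift N'
  have h2 := h'.shift N
  rw [add_comm] at h1
  exact (approx_congr ((M.rep_iff_of_rep h1).1 h2)).2 ha

theorem pow_dvd_sub_of_approx {a b : Acris p C} {m N : ℕ} {w : WFlat p C} (ha : Approx a m N w)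
    (hb : Approx b m N w) : (p : Acris p C) ^ m ∣ a - b := by
  have := dvd_sub ha hb
  rw [sub_sub_sub_cancel_right, ← mul_sub] at this
  exact hA.pow_dvd_of_pow_add_dvd this

theorem eq_of_approx {x : M p C} {a b : Acris p C}
    (ha : ∀ m N w, M.Rep x m N w → Approx a m N w)
    (hb : ∀ m N w, M.Rep x m N w → Approx b m N w) : a = b := by
  refine eq_of_pow_dvd_sub p fun m => ?_
  obtain ⟨N, w, h⟩ := M.exists_rep x m
  exact pow_dvd_sub_of_approx hA (ha m N w h) (hb m N w h)

/-- Each level m gives a value p^(-N) F^N(w), well defined modulo p^m. The values are compatible, so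
they have a limit. -/
theorem exists_approx (x : M p C) :
    ∃ a : Acris p C, ∀ m N w, M.Rep x m N w → Approx a m N w := by
  have h1 : ∀ m, ∃ a : Acris p C, ∀ N w, M.Rep x m N w → Approx a m N w := by
    intro m
    obtain ⟨N, w, h⟩ := M.exists_rep x m
    obtain ⟨w₀, h₀⟩ := M.exists_rep_zero x
    have h' : M.Rep x 0 N w := by
      clear h₀
      induction m with
      | zero => exact h
      | succ m ih => exact ih h.lower
    -- For m = N = 0 the condition is vacuous. Transported to w it says p^N ∣ F^N(w); this is where
    -- the condition x_0 ∈ W(C) enters, through w₀.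
    have h2 : Approx (algebraMap (WFlat p C) (Acris p C) w₀) 0 0 w₀ := by simp [Approx]
    have h3 := approx_of_rep hA h₀ h' h2
    rw [Approx, add_zero] at h3
    obtain ⟨a, ha⟩ := (dvd_sub_right (dvd_mul_right _ _)).1 h3
    refine ⟨a, fun N' w' h'' => approx_of_rep hA h h'' ?_⟩
    rw [Approx, ha, sub_self]
    exact dvd_zero _
  choose a ha using h1
  obtain ⟨L, hL⟩ := exists_limit p a (fun m => by
    obtain ⟨N, w, h⟩ := M.exists_rep x (m + 1)
    have h2 := ha m N w h.lower
    have h3 := ha (m + 1) N w h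
    exact pow_dvd_sub_of_approx hA ((pow_dvd_pow _ (by omega)).trans h3) h2)
  refine ⟨L, fun m N w h => ?_⟩
  have h1 := ha m N w h
  rw [Approx, pow_add] at h1
  have := dvd_add (mul_dvd_mul_left ((p : Acris p C) ^ N) (hL m)) h1
  rw [Approx, pow_add]
  convert this using 1
  ring

/-- The canonical map `M(C) → A_cris(C)`. -/
theorem exists_linearMap_approx : ∃ f : M p C →ₗ[WFlat p C] Acris p C,
    ∀ x m N w, M.Rep x m N w → Approx (f x) m N w := by
  choose g hg using exists_approx (p := p) (C := C) hA
  refine ⟨{ toFun := g, map_add' := fun x y => ?_, map_smul' := fun u x => ?_ }, hg⟩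
  · refine eq_of_approx hA (hg _) fun m N w h => ?_
    obtain ⟨N₁, v₁, h₁⟩ := M.exists_rep x m
    obtain ⟨N₂, v₂, h₂⟩ := M.exists_rep y m
    have h₁' := h₁.shift N₂
    have h₂' := h₂.shift N₁
    rw [add_comm] at h₂'
    refine approx_of_rep hA (h₁'.add h₂') h ?_
    have := dvd_add (hg _ _ _ _ h₁') (hg _ _ _ _ h₂')
    rw [Approx, iterate_map_add, map_add]
    convert this using 1
    ring
  · refine eq_of_approx hA (hg _) fun m N w h => ?_
    obtain ⟨N', v, h'⟩ := M.exists_rep x m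
    refine approx_of_rep hA (h'.smul u) h ?_
    -- u acts on V^(-N') v through F^(-N') u, and F^(N') restores u.
    have h1 : WittVector.frobenius^[N']
        ((WittVector.frobeniusEquiv p (Perfection C p)).symm^[N'] u) = u :=
      Function.RightInverse.iterate
        (WittVector.frobeniusEquiv p (Perfection C p)).apply_symm_apply N' u
    rw [Approx, iterate_map_mul, h1, map_mul, RingHom.id_apply, Algebra.smul_def, mul_left_comm,
      ← mul_sub]
    exact (hg _ _ _ _ h').mul_left _

end ModuleM

/-! ### Roots of Frobenius on `M(C)`; existence and uniqueness of `f` -/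

section ModuleM

namespace WittVInv

variable {p : ℕ} [Fact p.Prime] {R : Type u} [CommRing R]

theorem V_iterate_of (n : ℕ) (x : WittVector p R) : (V p R)^[n] (of p n x) = of p 0 x := by
  induction n with
  | zero => rfl
  | succ n ih => rw [Function.iterate_succ_apply, V_of_succ, ih]

theorem exists_V_eq (z : WittVInv p R) : ∃ y, V p R y = z := by
  obtain ⟨n, x, rfl⟩ := exists_of z
  exact ⟨of p (n + 1) x, V_of_succ n x⟩

theorem map_V {S : Type u} [CommRing S] (φ : R →+* S) (z : WittVInv p R) :
    map p φ (V p R z) = V p S (map p φ z) := by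
  obtain ⟨n, x, rfl⟩ := exists_of z
  rw [V_of, map_of, map_of, V_of, WittVector.map_verschiebung]

theorem F_V [CharP R p] (z : WittVInv p R) : F p R (V p R z) = p • z := by
  obtain ⟨n, x, rfl⟩ := exists_of z
  rw [V_of, F_of, frobenius_verschiebung_eq_p_mul, ← map_nsmul, nsmul_eq_mul]

theorem map_map {S T : Type u} [CommRing S] [CommRing T] (φ : R →+* S) (ψ : S →+* T)
    (z : WittVInv p R) : map p ψ (map p φ z) = map p (ψ.comp φ) z := by
  obtain ⟨n, x, rfl⟩ := exists_of z
  rw [map_of, map_of, map_of, WittVector.map, WittVector.map]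
  rfl

theorem map_injective {S : Type u} [CommRing S] {φ : R →+* S} (hφ : Function.Injective φ) :
    Function.Injective (map p φ) := by
  rw [injective_iff_map_eq_zero]
  intro z hz
  obtain ⟨n, x, rfl⟩ := exists_of z
  rw [map_of] at hz
  rw [WittVector.map_injective φ hφ ((of_injective n (hz.trans (map_zero _).symm)).trans
    (map_zero _).symm), map_zero]

theorem F_eq_map [CharP R p] (z : WittVInv p R) : F p R z = map p (frobenius R p) z := by
  obtain ⟨n, x, rfl⟩ := exists_of z
  rw [F_of, map_of, WittVector.frobenius_eq_map_frobenius]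

end WittVInv

variable {p : ℕ} [Fact p.Prime] {C : Type u} [CommRing C] [CharP C p]

variable (p C) in
/-- The homomorphism `C^♭ / Ker ν_(m + 1) → C^♭ / Ker ν_m` induced by the inverse of the
Frobenius. -/
def rootQuot (m : ℕ) : FlatQuot p C (m + 1) →+* FlatQuot p C m :=
  Ideal.quotientMap (kerNu p C m) (frobeniusEquiv (Perfection C p) p).symm.toRingHom (by
    intro c hc
    rw [Ideal.mem_comap, RingHom.mem_ker]
    exact (Perfection.coeff_symm_frobeniusEquiv c m).trans hc)

theorem rootQuot_mk (m : ℕ) (c : Perfection C p) :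
    rootQuot p C m (Ideal.Quotient.mk _ c) =
      Ideal.Quotient.mk _ ((frobeniusEquiv (Perfection C p) p).symm c) := rfl

/-- Ker ν_(m+1) is the full preimage of Ker ν_m under the inverse of Frobenius. Thus F^(-1) trades
level m + 1 for level m without loss. -/
theorem rootQuot_injective (m : ℕ) : Function.Injective (rootQuot p C m) := by
  rw [injective_iff_map_eq_zero]
  intro c hc
  obtain ⟨c, rfl⟩ := Ideal.Quotient.mk_surjective c
  rw [rootQuot_mk, Ideal.Quotient.eq_zero_iff_mem, RingHom.mem_ker] at hc
  rw [Ideal.Quotient.eq_zero_iff_mem, RingHom.mem_ker]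
  exact (Perfection.coeff_symm_frobeniusEquiv c m).symm.trans hc

theorem frobenius_comp_rootQuot (m : ℕ) :
    (frobenius (FlatQuot p C m) p).comp (rootQuot p C m) =
      Ideal.Quotient.factor (kerNu_le p C m) := by
  refine RingHom.ext fun c => ?_
  obtain ⟨c, rfl⟩ := Ideal.Quotient.mk_surjective c
  rw [RingHom.comp_apply, rootQuot_mk, frobenius_def, ← map_pow, Ideal.Quotient.factor_mk]
  congr 1
  exact (frobeniusEquiv (Perfection C p) p).apply_symm_apply c

namespace M

/-- The components of `F⁻¹ x`. -/
def rootF (x : M p C) (m : ℕ) : WittVInv p (FlatQuot p C m) :=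
  WittVInv.map p (rootQuot p C m) (x.1 (m + 1))

theorem transition_rootF (x : M p C) (m : ℕ) :
    transition p C m (rootF x (m + 1)) = rootF x m := by
  rw [rootF, rootF, ← x.2.1 (m + 1), transition, WittVInv.map_map, transition, WittVInv.map_map]
  congr 2
  exact RingHom.ext fun c => by
    obtain ⟨c, rfl⟩ := Ideal.Quotient.mk_surjective c
    rfl

theorem F_rootF (x : M p C) (m : ℕ) : WittVInv.F p _ (rootF x m) = x.1 m := by
  rw [rootF, WittVInv.F_eq_map, WittVInv.map_map, frobenius_comp_rootQuot]
  exact x.2.1 m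

theorem eq_zero_of_rootF_eq_zero {x : M p C} {m : ℕ} (h : rootF x m = 0) : x.1 (m + 1) = 0 :=
  WittVInv.map_injective (rootQuot_injective m) (h.trans (map_zero _).symm)

/-- For `N` big enough, `V ^ N (F⁻¹ x)` belongs to `M(C)`. -/
theorem exists_V_iterate_rootF (x : M p C) : ∃ (N : ℕ) (z : M p C),
    ∀ m, z.1 m = (WittVInv.V p _)^[N] (rootF x m) := by
  obtain ⟨N, y, hy⟩ := WittVInv.exists_of (rootF x 0)
  refine ⟨N, ⟨fun m => (WittVInv.V p _)^[N] (rootF x m), fun m => ?_, y, ?_⟩, fun m => rfl⟩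
  · beta_reduce
    rw [← transition_rootF x m]
    exact Function.Semiconj.iterate_right (f := transition p C m)
      (fun z => WittVInv.map_V _ z) N _
  · rw [← WittVInv.V_iterate_of N y, ← hy]

theorem smul_p_apply (x : M p C) (m : ℕ) :
    ((p : WFlat p C) • x).1 m = WittVInv.F p _ (WittVInv.V p _ (x.1 m)) := by
  rw [Nat.cast_smul_eq_nsmul, WittVInv.F_V]
  rfl

theorem F_V (x : M p C) : M.F (M.V x) = (p : WFlat p C) • x :=
  Subtype.ext (funext fun m => (smul_p_apply x m).symm)

/-- p = FV, so z has to be V^(-1) F^(-1) x. Since F^(-1) lowers the level by one, z_m = 0; hence z_0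
= 0, and z satisfies the integrality condition at level 0. -/
theorem exists_smul_p_of_eq_zero {x : M p C} {m : ℕ} (h : x.1 (m + 1) = 0) :
    ∃ z : M p C, z.1 m = 0 ∧ x = (p : WFlat p C) • z := by
  choose z hz using fun m => WittVInv.exists_V_eq (rootF x m)
  have h1 : ∀ m, transition p C m (z (m + 1)) = z m := fun m => by
    refine WittVInv.V_injective ?_
    rw [transition, ← WittVInv.map_V, hz, hz, ← transition]
    exact transition_rootF x m
  have h2 : z m = 0 := by
    refine WittVInv.V_injective ?_
    rw [hz, rootF, h, map_zero, map_zero]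
  have h3 : z 0 = 0 := by
    clear h
    induction m with
    | zero => exact h2
    | succ m ih => exact ih (by rw [← h1, h2, map_zero])
  refine ⟨⟨z, h1, 0, by rw [h3, map_zero]⟩, h2, Subtype.ext (funext fun m => ?_)⟩
  rw [smul_p_apply, hz, F_rootF]

theorem exists_smul_pow_of_eq_zero {x : M p C} {m : ℕ} (h : x.1 m = 0) :
    ∃ z : M p C, x = ((p : WFlat p C) ^ m) • z := by
  induction m generalizing x with
  | zero => exact ⟨x, by rw [pow_zero, one_smul]⟩
  | succ m ih =>
    obtain ⟨y, hy, rfl⟩ := exists_smul_p_of_eq_zero h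
    obtain ⟨z, rfl⟩ := ih hy
    exact ⟨z, by rw [smul_smul, pow_succ']⟩

theorem V_iterate_apply (n : ℕ) (x : M p C) (m : ℕ) :
    (M.V^[n] x).1 m = (WittVInv.V p _)^[n] (x.1 m) := by
  induction n with
  | zero => rfl
  | succ n ih =>
    rw [Function.iterate_succ_apply', Function.iterate_succ_apply', ← ih]
    rfl

theorem Rep.zero_of_rep {x : M p C} {m N : ℕ} {w : WFlat p C} (h : M.Rep x m N w) :
    M.Rep x 0 N w := by
  induction m with
  | zero => exact h
  | succ m ih => exact ih h.lower

/-- If `x_0` is the image of `V ^ (-N) w` then `V ^ (-N) w` belongs to `M(C)`. -/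
theorem exists_V_iterate_eq_toM {x : M p C} {N : ℕ} {w : WFlat p C} (h : M.Rep x 0 N w) :
    ∃ y : M p C, M.V^[N] y = toM p C w ∧ ∀ m, M.Rep y m N w := by
  refine ⟨⟨fun m => WittVInv.of p N (WittVector.map (Ideal.Quotient.mk (kerNu p C m)) w),
    fun m => ?_, ?_⟩, Subtype.ext (funext fun m => ?_), fun m => rfl⟩
  · rw [transition, WittVInv.map_of, map_factor]
  · obtain ⟨y, hy⟩ := x.2.2
    exact ⟨y, h.symm.trans hy⟩
  · rw [V_iterate_apply, WittVInv.V_iterate_of]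
    rfl

end M

theorem IteratesTo.unique {F' : Icris p C → Acris p C} {n : ℕ} {c a b : Acris p C}
    (ha : IteratesTo F' n c a) (hb : IteratesTo F' n c b) : a = b := by
  induction n generalizing c with
  | zero => exact ha.symm.trans hb
  | succ n ih =>
    obtain ⟨h, ha⟩ := ha
    obtain ⟨h', hb⟩ := hb
    exact ih ha hb

theorem acrisFrobenius_iterate_p_mul (n k : ℕ) (c : Acris p C) :
    (acrisFrobenius p C)^[n] ((p : Acris p C) ^ k * c) = p ^ k * (acrisFrobenius p C)^[n] c := by
  induction n with
  | zero => rfl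
  | succ n ih =>
    rw [Function.iterate_succ_apply', ih, map_mul, map_pow, map_natCast,
      Function.iterate_succ_apply']

variable (hA : IsFlatAt p (Acris p C))
include hA

/-- The n-th iterate of F' = F/p can only be F^n/p^n. It is defined at c once F^j(c)/p^j lies in
I_cris for all j < n. -/
theorem iteratesTo_of_pow_mul {F' : Icris p C → Acris p C}
    (hF : ∀ c, (p : Acris p C) * F' c = acrisFrobenius p C c) {n : ℕ} {c a : Acris p C}
    (h : ∀ j < n, ∃ b ∈ Icris p C, (p : Acris p C) ^ j * b = (acrisFrobenius p C)^[j] c)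
    (ha : (p : Acris p C) ^ n * a = (acrisFrobenius p C)^[n] c) : IteratesTo F' n c a := by
  induction n generalizing c with
  | zero =>
    rw [pow_zero, one_mul] at ha
    exact ha.symm
  | succ n ih =>
    obtain ⟨b, hb, hb'⟩ := h 0 (Nat.succ_pos n)
    have hc : c ∈ Icris p C := by
      rw [pow_zero, one_mul, Function.iterate_zero_apply] at hb'
      exact hb' ▸ hb
    have key : ∀ j, (acrisFrobenius p C)^[j + 1] c =
        p * (acrisFrobenius p C)^[j] (F' ⟨c, hc⟩) := fun j => by
      rw [Function.iterate_succ_apply, ← hF ⟨c, hc⟩]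
      simpa using acrisFrobenius_iterate_p_mul j 1 (F' ⟨c, hc⟩)
    refine ⟨hc, ih (fun j hj => ?_) (hA.mul_cancel ?_)⟩
    · obtain ⟨b, hb, hb'⟩ := h (j + 1) (by omega)
      refine ⟨b, hb, hA.mul_cancel ?_⟩
      rw [← key, ← hb']
      ring
    · rw [← key, ← ha]
      ring

/-- If V^n x = w, then x is V^(-n) w in every component, so f(x) = p^(-n) F^n(w) exactly. -/
theorem isCanonicalMap_of_approx {F' : Icris p C → Acris p C}
    (hF : ∀ c, (p : Acris p C) * F' c = acrisFrobenius p C c)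
    {f : M p C →ₗ[WFlat p C] Acris p C}
    (hf : ∀ x m N w, M.Rep x m N w → Approx (f x) m N w) : IsCanonicalMap F' f where
  map_F x := by
    refine eq_of_approx hA (hf _) fun m N w h => ?_
    obtain ⟨N', v, h'⟩ := M.exists_rep x m
    refine approx_of_rep hA h'.F h ?_
    have := map_dvd (acrisFrobenius p C) (hf _ _ _ _ h')
    rwa [map_pow, map_sub, map_mul, map_pow, map_natCast, acrisFrobenius_algebraMap,
      ← Function.iterate_succ_apply' WittVector.frobenius, Function.iterate_succ_apply] at this
  map_M₀ x n w hx := by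
    obtain ⟨w₀, h₀⟩ := M.exists_rep_zero x
    have h1 : ∀ m, M.Rep x m n w := fun m => by
      have := M.rep_of_rep_V_iterate (hx ▸ M.rep_toM w m)
      rwa [zero_add] at this
    -- Since x_0 is the image of w₀, w ≡ V^n w₀ modulo W(Ker ν_0). This keeps the intermediate
    -- values F^j(w)/p^j, j < n, in I_cris.
    have h2 := h₀.V_iterate n
    rw [hx, M.rep_iff_of_rep (M.rep_toM w 0), ← neg_mem_iff, neg_sub] at h2
    refine iteratesTo_of_pow_mul hA hF (fun j hj => ?_) ?_
    · rw [acrisFrobenius_iterate_algebraMap]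
      exact exists_pow_mul_eq_of_sub_mem_wittKer hj h2
    · rw [acrisFrobenius_iterate_algebraMap]
      exact eq_of_pow_dvd_sub p fun m => (pow_dvd_pow _ (by omega)).trans (hf _ m _ _ (h1 m))

omit hA in
-- For every m, x differs by an element of p^m M(C) from some y with V^N y ∈ W(C^♭), and f(y) is
-- prescribed there. As A_cris(C) is p-adically separated, f is determined.
theorem IsCanonicalMap.unique {F' : Icris p C → Acris p C} {f g : M p C →ₗ[WFlat p C] Acris p C}
    (hf : IsCanonicalMap F' f) (hg : IsCanonicalMap F' g) : f = g := by
  refine LinearMap.ext fun x => eq_of_pow_dvd_sub p fun m => ?_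
  obtain ⟨N, w, h⟩ := M.exists_rep x m
  obtain ⟨y, hy, hy'⟩ := M.exists_V_iterate_eq_toM h.zero_of_rep
  have h1 : (x - y).1 m = 0 := by
    change x.1 m - y.1 m = 0
    rw [h, hy' m, sub_self]
  obtain ⟨z, hz⟩ := M.exists_smul_pow_of_eq_zero h1
  have h2 : f y = g y := (hf.map_M₀ y N w hy).unique (hg.map_M₀ y N w hy)
  rw [sub_eq_iff_eq_add] at hz
  rw [hz, map_add, map_add, h2, add_sub_add_right_eq_sub, map_smul, map_smul, ← smul_sub,
    Algebra.smul_def, map_pow, map_natCast]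
  exact dvd_mul_right _ _

theorem existsUnique_isCanonicalMap {F' : Icris p C → Acris p C}
    (hF : ∀ c, (p : Acris p C) * F' c = acrisFrobenius p C c) :
    ∃! f : M p C →ₗ[WFlat p C] Acris p C, IsCanonicalMap F' f := by
  obtain ⟨f, hf⟩ := exists_linearMap_approx (p := p) (C := C) hA
  exact ⟨f, isCanonicalMap_of_approx hA hF hf,
    fun g hg => hg.unique (isCanonicalMap_of_approx hA hF hf)⟩

theorem IsCanonicalMap.approx {F' : Icris p C → Acris p C}
    (hF : ∀ c, (p : Acris p C) * F' c = acrisFrobenius p C c)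
    {f : M p C →ₗ[WFlat p C] Acris p C} (h : IsCanonicalMap F' f) :
    ∀ x m N w, M.Rep x m N w → Approx (f x) m N w := by
  obtain ⟨g, hg⟩ := exists_linearMap_approx (p := p) (C := C) hA
  rw [h.unique (isCanonicalMap_of_approx hA hF hg)]
  exact hg

end ModuleM

/-! ### The image of `M(C)` in `A_cris(C)` -/

section Image

variable {p : ℕ} [Fact p.Prime] {C : Type u} [CommRing C] [CharP C p]

theorem p_pow_dvd_verschiebung_iterate (n : ℕ) (w : WFlat p C) :
    (p : WFlat p C) ^ n ∣ WittVector.verschiebung^[n] w := by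
  induction n generalizing w with
  | zero => simp
  | succ n ih =>
    obtain ⟨v, rfl⟩ := exists_frobenius_eq w
    rw [Function.iterate_succ_apply, ← p_mul_eq_verschiebung_frobenius]
    have h : WittVector.verschiebung^[n] ((p : WFlat p C) * v) =
        p * WittVector.verschiebung^[n] v := by
      rw [← nsmul_eq_mul, ← nsmul_eq_mul, iterate_map_nsmul]
    rw [h, pow_succ']
    exact mul_dvd_mul_left _ (ih v)

theorem M.Rep.V_iterate_of {x : M p C} {m N : ℕ} {w : WFlat p C} (h : M.Rep x m N w) :
    M.Rep (M.V^[N] x) m 0 w := by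
  rw [M.Rep, M.V_iterate_apply, h, WittVInv.V_iterate_of]

theorem M.exists_V_eq {x : M p C} {v : WFlat p C}
    (h : M.Rep x 0 0 (WittVector.verschiebung v)) : ∃ y, M.V y = x := by
  choose y hy using fun m => WittVInv.exists_V_eq (x.1 m)
  refine ⟨⟨y, fun m => WittVInv.V_injective ?_, WittVector.map (Ideal.Quotient.mk _) v,
    WittVInv.V_injective ?_⟩, Subtype.ext (funext hy)⟩
  · rw [transition, ← WittVInv.map_V, hy, hy]
    exact x.2.1 m
  · rw [hy, h, WittVInv.V_of, WittVector.map_verschiebung]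

variable {F' : Icris p C → Acris p C} {f : M p C →ₗ[WFlat p C] Acris p C}

theorem IsCanonicalMap.frobenius_V (hf : IsCanonicalMap F' f) (x : M p C) :
    acrisFrobenius p C (f (M.V x)) = p * f x := by
  rw [← hf.map_F, M.F_V, map_smul, Algebra.smul_def, map_natCast]

theorem IsCanonicalMap.frobenius_iterate_V_iterate (hf : IsCanonicalMap F' f) (n : ℕ) (x : M p C) :
    (acrisFrobenius p C)^[n] (f (M.V^[n] x)) = (p : Acris p C) ^ n * f x := by
  induction n with
  | zero => simp
  | succ n ih =>
    have := acrisFrobenius_iterate_p_mul (p := p) (C := C) n 1 (f (M.V^[n] x))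
    rw [pow_one] at this
    rw [Function.iterate_succ_apply, Function.iterate_succ_apply', hf.frobenius_V, this, ih]
    ring

variable (hA : IsFlatAt p (Acris p C))
  (hF : ∀ c, (p : Acris p C) * F' c = acrisFrobenius p C c)

section
include hA hF

/-- v_n = f(V^n x) works, as F^n V^n = p^n. If x_k = V^(-N) w, then for n = N + k + d the k-th
component of V^n x is V^(k+d) w, which is divisible by p^k; so p^k ∣ v_n. -/
theorem IsCanonicalMap.mem_doublePrime (hf : IsCanonicalMap F' f) (x : M p C) :
    f x ∈ AcrisDoublePrime p C := by
  refine ⟨fun n => f (M.V^[n] x), fun k => ?_, fun n =>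
    (hf.frobenius_iterate_V_iterate n x).symm⟩
  obtain ⟨N, w, h⟩ := M.exists_rep x k
  filter_upwards [Filter.eventually_ge_atTop (N + k)] with n hn
  obtain ⟨d, rfl⟩ := Nat.exists_eq_add_of_le hn
  have h1 := hf.approx hA hF _ _ _ _ (h.V_iterate (k + d)).V_iterate_of
  rw [Approx, zero_add, pow_zero, one_mul, Function.iterate_zero_apply,
    ← Function.iterate_add_apply, ← add_assoc] at h1
  rw [Ideal.span_singleton_pow, Ideal.mem_span_singleton]
  refine (dvd_sub_left ?_).1 h1
  have := map_dvd (algebraMap (WFlat p C) (Acris p C))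
    ((pow_dvd_pow _ (Nat.le_add_right k d)).trans (p_pow_dvd_verschiebung_iterate (k + d) w))
  rwa [map_pow, map_natCast] at this

/-- `Approx` at level 0 with N = 0 says nothing, so level 1 is used: f(x) ≡ p^(-N) F^N(v) modulo p.
Since v - V^N w ∈ W(Ker ν_0), p^(-N) F^N(v) ≡ w modulo I_cris. -/
theorem IsCanonicalMap.acrisToC_apply (hf : IsCanonicalMap F' f) {x : M p C} {w : WFlat p C}
    (hw : M.Rep x 0 0 w) : acrisToC p C (f x) = theta p C w := by
  obtain ⟨N, v, hv⟩ := M.exists_rep x 1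
  have h1 := hw.shift N
  rw [zero_add, M.rep_iff_of_rep hv.zero_of_rep, ← neg_mem_iff, neg_sub] at h1
  obtain ⟨a, ha, ha'⟩ := exists_pow_mul_eq_of_mem_wittKer N h1
  have h2 := hf.approx hA hF _ _ _ _ hv
  rw [iterate_map_sub, frobenius_iterate_verschiebung_iterate, map_sub, map_mul, map_pow,
    map_natCast, eq_sub_iff_add_eq] at ha'
  rw [Approx, ← ha', ← mul_add, ← mul_sub] at h2
  obtain ⟨y, hy⟩ := hA.pow_dvd_of_pow_add_dvd h2
  have h3 := congrArg (acrisToC p C) hy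
  rw [pow_one, map_mul, map_natCast, CharP.cast_eq_zero C p, zero_mul, map_sub, map_add,
    RingHom.mem_ker.1 ha, zero_add, sub_eq_zero, acrisToC_algebraMap] at h3
  exact h3

/-- Reducing f(x) = 0 to C shows that the first Teichmüller digit of w dies in C, so x_0 is in the
image of V and x = V y. Then p f(y) = F(f(V y)) = 0. -/
theorem IsCanonicalMap.exists_V_eq_of_eq_zero (hf : IsCanonicalMap F' f) {x : M p C}
    (hx : f x = 0) : ∃ y, M.V y = x ∧ f y = 0 := by
  obtain ⟨w, hw⟩ := M.exists_rep_zero x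
  have h1 := hf.acrisToC_apply hA hF hw
  rw [hx, map_zero, theta_apply] at h1
  obtain ⟨v, hv⟩ := exists_eq_teichmuller_add w
  have h2 : M.Rep x 0 0 (WittVector.verschiebung v) := by
    rw [M.rep_iff_of_rep hw, ← neg_mem_iff, neg_sub]
    nth_rewrite 1 [hv]
    rw [add_sub_cancel_right]
    exact teichmuller_mem_wittKer h1.symm
  obtain ⟨y, rfl⟩ := M.exists_V_eq h2
  refine ⟨y, rfl, hA.mul_cancel ?_⟩
  rw [← hf.frobenius_V, hx, map_zero, mul_zero]

/-- x is divisible by all powers of V inside the kernel of f, and V^(i+1) kills the i-th Witt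
coefficient of x_0. -/
theorem IsCanonicalMap.apply_zero_of_eq_zero (hf : IsCanonicalMap F' f) {x : M p C}
    (hx : f x = 0) : x.1 0 = 0 := by
  have h1 : ∀ k : ℕ, ∃ y, M.V^[k] y = x ∧ f y = 0 := by
    intro k
    induction k with
    | zero => exact ⟨x, rfl, hx⟩
    | succ k ih =>
      obtain ⟨y, hy, hy'⟩ := ih
      obtain ⟨z, rfl, hz⟩ := hf.exists_V_eq_of_eq_zero hA hF hy'
      exact ⟨z, hy, hz⟩
  obtain ⟨w, hw⟩ := M.exists_rep_zero x
  have h2 : w ∈ wittKer p C 0 := by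
    rw [mem_wittKer]
    intro i
    obtain ⟨y, rfl, -⟩ := h1 (i + 1)
    obtain ⟨v, hv⟩ := M.exists_rep_zero y
    have h3 := (M.rep_iff_of_rep (hv.V_iterate (i + 1))).1 hw
    have h4 := congrArg (fun z => z.coeff i) (map_mk_eq_iff.2 h3)
    simp only [WittVector.map_coeff] at h4
    rw [WittVector.iterate_verschiebung_coeff_eq_zero _ (Nat.lt_succ_self i), map_zero,
      Ideal.Quotient.eq_zero_iff_mem] at h4
    exact h4
  rw [hw, (RingHom.mem_ker).1 h2, map_zero]

/-- Induction on the level. F^(-1) x has components but may violate integrality at level 0; z = V^N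
F^(-1) x is in M(C) for some N. Since F z = V^N x and F^N(f(V^N x)) = p^N f(x) = 0, injectivity of F
gives f(z) = 0. Then z_m = 0 means x_(m+1) = 0. -/
theorem IsCanonicalMap.injective (hFI : Function.Injective (acrisFrobenius p C))
    (hf : IsCanonicalMap F' f) : Function.Injective f := by
  rw [injective_iff_map_eq_zero]
  have key : ∀ (m : ℕ) (x : M p C), f x = 0 → x.1 m = 0 := by
    intro m
    induction m with
    | zero => exact fun x hx => hf.apply_zero_of_eq_zero hA hF hx
    | succ m ih =>
      intro x hx
      obtain ⟨N, z, hz⟩ := M.exists_V_iterate_rootF x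
      have h1 : M.F z = M.V^[N] x := by
        refine Subtype.ext (funext fun i => ?_)
        change WittVInv.F p _ (z.1 i) = _
        rw [hz, M.V_iterate_apply, ← M.F_rootF x i]
        have hc : Function.Commute (WittVInv.F p (FlatQuot p C i)) (WittVInv.V p _) := fun y => by
          obtain ⟨n, y, rfl⟩ := WittVInv.exists_of y
          rw [WittVInv.V_of, WittVInv.F_of, WittVInv.F_of, WittVInv.V_of,
            WittVector.verschiebung_frobenius_comm y]
        exact hc.iterate_right N _
      have h2 : f z = 0 := by
        refine hFI ?_
        rw [map_zero, ← hf.map_F, h1]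
        refine hFI.iterate N ?_
        rw [hf.frobenius_iterate_V_iterate, hx, mul_zero, iterate_map_zero]
      have h3 := ih z h2
      rw [hz] at h3
      exact M.eq_zero_of_rootF_eq_zero
        (WittVInv.V_injective.iterate N (h3.trans (iterate_map_zero _ _).symm))
  exact fun x hx => Subtype.ext (funext fun m => key m x hx)

end

variable (p C) in
/-- The elements of `A_cris(C)` to which `F'` can be applied infinitely many times. -/
def AcrisInfty : AddSubgroup (Acris p C) where
  carrier := {a | ∀ j : ℕ, ∃ b ∈ Icris p C, (p : Acris p C) ^ j * b = (acrisFrobenius p C)^[j] a}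
  zero_mem' j := ⟨0, zero_mem _, by rw [mul_zero, iterate_map_zero]⟩
  add_mem' {x y} hx hy j := by
    obtain ⟨b, hb, hb'⟩ := hx j
    obtain ⟨c, hc, hc'⟩ := hy j
    exact ⟨b + c, add_mem hb hc, by rw [mul_add, hb', hc', iterate_map_add]⟩
  neg_mem' {x} hx j := by
    obtain ⟨b, hb, hb'⟩ := hx j
    exact ⟨-b, neg_mem hb, by rw [mul_neg, hb', iterate_map_neg]⟩

theorem algebraMap_mem_AcrisInfty_of_mem {w : WFlat p C} (hw : w ∈ wittKer p C 0) :
    algebraMap (WFlat p C) (Acris p C) w ∈ AcrisInfty p C := fun j => by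
  rw [acrisFrobenius_iterate_algebraMap]
  exact exists_pow_mul_eq_of_mem_wittKer j hw

theorem algebraMap_verschiebung_mem_Icris (v : WFlat p C) :
    algebraMap (WFlat p C) (Acris p C) (WittVector.verschiebung v) ∈ Icris p C := by
  rw [RingHom.mem_ker, acrisToC_algebraMap, theta_verschiebung]

include hA

/-- Write w = [c] + V v. Membership in I_cris puts c in Ker ν_0; subtracting [c] and applying F'
leaves v, because F'V = id. So all Witt coefficients are treated in turn. -/
theorem mem_wittKer_of_algebraMap_mem {w : WFlat p C}
    (hw : algebraMap (WFlat p C) (Acris p C) w ∈ AcrisInfty p C) : w ∈ wittKer p C 0 := by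
  rw [mem_wittKer]
  intro i
  induction i generalizing w with
  | zero =>
    obtain ⟨b, hb, hb'⟩ := hw 0
    rw [pow_zero, one_mul, Function.iterate_zero_apply] at hb'
    rw [hb', RingHom.mem_ker, acrisToC_algebraMap] at hb
    exact hb
  | succ i ih =>
    obtain ⟨b, hb, hb'⟩ := hw 0
    rw [pow_zero, one_mul, Function.iterate_zero_apply] at hb'
    rw [hb', RingHom.mem_ker, acrisToC_algebraMap, theta_apply] at hb
    obtain ⟨v, hv⟩ := exists_eq_teichmuller_add w
    have ht := teichmuller_mem_wittKer (p := p) (C := C) (m := 0) hb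
    have h1 : algebraMap (WFlat p C) (Acris p C) (WittVector.verschiebung v) ∈
        AcrisInfty p C := by
      have := sub_mem hw (algebraMap_mem_AcrisInfty_of_mem ht)
      rwa [← map_sub, sub_eq_of_eq_add' hv] at this
    have h2 := ih (w := v) fun j => by
      obtain ⟨b, hb, hb'⟩ := h1 (j + 1)
      refine ⟨b, hb, hA.mul_cancel ?_⟩
      rw [← mul_assoc, ← pow_succ', hb', acrisFrobenius_iterate_algebraMap,
        acrisFrobenius_iterate_algebraMap, Function.iterate_succ_apply,
        frobenius_verschiebung_eq_p_mul, frobenius_iterate_p_mul, map_mul, map_natCast]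
    have h3 : WittVector.map (Ideal.Quotient.mk (kerNu p C 0)) w =
        WittVector.map (Ideal.Quotient.mk (kerNu p C 0)) (WittVector.verschiebung v) := by
      rw [map_mk_eq_iff, sub_eq_of_eq_add hv]
      exact ht
    have h4 := congrArg (fun z => z.coeff (i + 1)) h3
    simp only [WittVector.map_coeff] at h4
    rw [WittVector.verschiebung_coeff_succ, Ideal.Quotient.eq_zero_iff_mem.2 h2,
      Ideal.Quotient.eq_zero_iff_mem] at h4
    exact h4

omit hA in
-- F' sends y - V w to z - w. That y is in the domain of F' at all is what `hI` provides.
theorem sub_verschiebung_mem_AcrisInfty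
    (hI : ∀ a : Acris p C, (p : Acris p C) ∣ acrisFrobenius p C a → a ∈ Icris p C)
    {y z : Acris p C} {w : WFlat p C} (h : acrisFrobenius p C y = p * z)
    (hz : z - algebraMap (WFlat p C) (Acris p C) w ∈ AcrisInfty p C) :
    y - algebraMap (WFlat p C) (Acris p C) (WittVector.verschiebung w) ∈ AcrisInfty p C := by
  intro j
  rcases j with _ | j
  · refine ⟨_, sub_mem (hI y ⟨z, h⟩) (algebraMap_verschiebung_mem_Icris w), ?_⟩
    rw [pow_zero, one_mul, Function.iterate_zero_apply]
  · obtain ⟨b, hb, hb'⟩ := hz j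
    refine ⟨b, hb, ?_⟩
    have := acrisFrobenius_iterate_p_mul (p := p) (C := C) j 1
      (z - algebraMap (WFlat p C) (Acris p C) w)
    rw [pow_one] at this
    rw [Function.iterate_succ_apply, map_sub, h, acrisFrobenius_algebraMap,
      frobenius_verschiebung_eq_p_mul, map_mul, map_natCast, ← mul_sub, this, ← hb']
    ring

omit hA in
theorem sub_verschiebung_iterate_mem_AcrisInfty
    (hI : ∀ a : Acris p C, (p : Acris p C) ∣ acrisFrobenius p C a → a ∈ Icris p C)
    {y : ℕ → Acris p C} {w : WFlat p C} (h : ∀ n, acrisFrobenius p C (y (n + 1)) = p * y n)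
    (hw : y 0 - algebraMap (WFlat p C) (Acris p C) w ∈ AcrisInfty p C) (n : ℕ) :
    y n - algebraMap (WFlat p C) (Acris p C) (WittVector.verschiebung^[n] w) ∈
      AcrisInfty p C := by
  induction n with
  | zero => exact hw
  | succ n ih =>
    rw [Function.iterate_succ_apply']
    exact sub_verschiebung_mem_AcrisInfty hI (h n) ih

omit hA in
theorem mem_doublePrime_algebraMap (w : WFlat p C) :
    algebraMap (WFlat p C) (Acris p C) w ∈ AcrisDoublePrime p C := by
  refine ⟨fun n => algebraMap _ _ (WittVector.verschiebung^[n] w), fun k => ?_, fun n => ?_⟩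
  · filter_upwards [Filter.eventually_ge_atTop k] with n hn
    rw [Ideal.span_singleton_pow, Ideal.mem_span_singleton]
    have := map_dvd (algebraMap (WFlat p C) (Acris p C))
      ((pow_dvd_pow _ hn).trans (p_pow_dvd_verschiebung_iterate n w))
    rwa [map_pow, map_natCast] at this
  · rw [acrisFrobenius_iterate_algebraMap, frobenius_iterate_verschiebung_iterate, map_mul,
      map_pow, map_natCast]

omit hA in
theorem sub_mem_doublePrime {u v : Acris p C} (hu : u ∈ AcrisDoublePrime p C)
    (hv : v ∈ AcrisDoublePrime p C) : u - v ∈ AcrisDoublePrime p C := by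
  obtain ⟨a, ha, ha'⟩ := hu
  obtain ⟨b, hb, hb'⟩ := hv
  refine ⟨fun n => a n - b n, fun k => ?_, fun n => by rw [mul_sub, ha', hb', iterate_map_sub]⟩
  filter_upwards [ha k, hb k] with n h1 h2
  exact sub_mem h1 h2

/-- Stability of A'' under F': p^(n+1) u' = p^n F(u) = F^(n+1)(v_n), so the sequence is shifted by
one, with u' itself as entry 0. -/
theorem mem_doublePrime_of_p_mul {u u' : Acris p C} (hu : u ∈ AcrisDoublePrime p C)
    (h : (p : Acris p C) * u' = acrisFrobenius p C u) : u' ∈ AcrisDoublePrime p C := by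
  obtain ⟨v, hv, hv'⟩ := hu
  refine ⟨fun n => if n = 0 then u' else v (n - 1), fun k => ?_, fun n => ?_⟩
  · obtain ⟨N, hN⟩ := Filter.eventually_atTop.1 (hv k)
    filter_upwards [Filter.eventually_ge_atTop (N + 1)] with n hn
    rw [if_neg (by omega)]
    exact hN _ (by omega)
  · rcases n with _ | n
    · simp
    · refine hA.mul_cancel ?_
      change _ = (p : Acris p C) * (acrisFrobenius p C)^[n + 1] (v n)
      rw [Function.iterate_succ_apply', ← hv',
        map_mul, map_pow, map_natCast, ← h]
      ring

omit hA in
theorem mk_eq_teichmuller_add_verschiebung (c : ℕ → Perfection C p) :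
    WittVector.mk p c = WittVector.teichmuller p (c 0) +
      WittVector.verschiebung (WittVector.mk p fun i => c (i + 1)) := by
  ext i
  rw [WittVector.coeff_add_of_disjoint]
  · rcases i with _ | i
    · simp
    · simp [WittVector.teichmuller_coeff_pos, WittVector.verschiebung_coeff_succ]
  · intro i
    rcases i with _ | i
    · exact Or.inr (WittVector.verschiebung_coeff_zero _)
    · exact Or.inl (WittVector.teichmuller_coeff_pos p _ _ (Nat.succ_pos i))

/-- Digit expansion: choose c with a - [c] ∈ I_cris, replace a by F'(a - [c]), which is again in
A'', and repeat. The Witt vector with the resulting digits as coefficients is w, since F' V = id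
makes applying F' shift the digits. -/
theorem exists_sub_mem_AcrisInfty (hs : Function.Surjective (Perfection.coeff C p 0))
    {a : Acris p C} (ha : a ∈ AcrisDoublePrime p C) :
    ∃ w : WFlat p C, a - algebraMap (WFlat p C) (Acris p C) w ∈ AcrisInfty p C := by
  have step : ∀ a : AcrisDoublePrime p C, ∃ (c : Perfection C p) (b : AcrisDoublePrime p C),
      (a : Acris p C) - algebraMap _ _ (WittVector.teichmuller p c) ∈ Icris p C ∧
      (p : Acris p C) * b = acrisFrobenius p C
        ((a : Acris p C) - algebraMap _ _ (WittVector.teichmuller p c)) := by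
    intro a
    obtain ⟨c, hc⟩ := hs (acrisToC p C a)
    have h1 : (a : Acris p C) - algebraMap _ _ (WittVector.teichmuller p c) ∈ Icris p C := by
      rw [RingHom.mem_ker, map_sub, acrisToC_algebraMap, theta_teichmuller, hc, sub_self]
    obtain ⟨b, hb⟩ := p_dvd_acrisFrobenius hA h1
    exact ⟨c, ⟨b, mem_doublePrime_of_p_mul hA
      (sub_mem_doublePrime a.2 (mem_doublePrime_algebraMap _)) hb.symm⟩, h1, hb.symm⟩
  choose c b h1 h2 using step
  let s : ℕ → AcrisDoublePrime p C := fun n => b^[n] ⟨a, ha⟩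
  have hs' : ∀ n, s (n + 1) = b (s n) := fun n => Function.iterate_succ_apply' _ _ _
  let w : ℕ → WFlat p C := fun n => WittVector.mk p fun i => c (s (i + n))
  have hw : ∀ n, w n = WittVector.teichmuller p (c (s n)) + WittVector.verschiebung (w (n + 1)) :=
    fun n => by
      have := mk_eq_teichmuller_add_verschiebung (p := p) (C := C) fun i => c (s (i + n))
      simp only [zero_add, add_assoc, add_comm 1 n] at this
      exact this
  have h3 : ∀ n, (acrisFrobenius p C)^[n] (a - algebraMap _ _ (w 0)) =
      (p : Acris p C) ^ n * (s n - algebraMap _ _ (w n)) := by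
    intro n
    induction n with
    | zero => rw [pow_zero, one_mul]; rfl
    | succ n ih =>
      have h5 := h2 (s n)
      rw [← hs'] at h5
      rw [Function.iterate_succ_apply', ih, hw n, map_add, ← sub_sub, map_mul, map_sub, ← h5,
        acrisFrobenius_algebraMap, frobenius_verschiebung_eq_p_mul, map_mul (algebraMap _ _),
        map_natCast, map_pow, map_natCast]
      ring
  refine ⟨w 0, fun n => ⟨_, ?_, (h3 n).symm⟩⟩
  rw [hw n, map_add, ← sub_sub]
  exact sub_mem (h1 _) (algebraMap_verschiebung_mem_Icris _)

include hF

/-- The tail of v divided by p^r is again a sequence witnessing membership in A''. Its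
approximations by Witt vectors for varying r fit together to an element of M(C). -/
theorem IsCanonicalMap.doublePrime_subset_range
    (hFI : Function.Injective (acrisFrobenius p C))
    (hI : ∀ a : Acris p C, (p : Acris p C) ∣ acrisFrobenius p C a → a ∈ Icris p C)
    (hs : Function.Surjective (Perfection.coeff C p 0)) (hf : IsCanonicalMap F' f)
    {u : Acris p C} (hu : u ∈ AcrisDoublePrime p C) : ∃ x, f x = u := by
  obtain ⟨v, hv, hv'⟩ := hu
  have hv1 : ∀ n, acrisFrobenius p C (v (n + 1)) = p * v n := fun n => by
    have := acrisFrobenius_iterate_p_mul (p := p) (C := C) n 1 (v n)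
    rw [pow_one] at this
    refine hFI.iterate n ?_
    rw [← Function.iterate_succ_apply, ← hv', this, ← hv', pow_succ', mul_assoc]
  choose ψ hψ using fun k => Filter.eventually_atTop.1 (hv k)
  -- Partial sums give N 0 = 0, as level 0 of M(C) requires, and N (r + 1) ≥ ψ (r + 1), so p^r ∣ v_n
  -- for all n ≥ N r. Then y r d is v_(N r + d)/p^r.
  let N : ℕ → ℕ := fun r => ∑ i ∈ Finset.range r, ψ (i + 1)
  have hN : ∀ r, N (r + 1) = N r + ψ (r + 1) := fun r => Finset.sum_range_succ _ _
  have hy : ∀ r d, ∃ y : Acris p C, (p : Acris p C) ^ r * y = v (N r + d) := by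
    intro r d
    have : v (N r + d) ∈ Ideal.span {(p : Acris p C)} ^ r := by
      rcases r with _ | r
      · simp
      · exact hψ _ _ (by rw [hN]; omega)
    rw [Ideal.span_singleton_pow, Ideal.mem_span_singleton] at this
    obtain ⟨y, hy⟩ := this
    exact ⟨y, hy.symm⟩
  choose y hy using hy
  have hy1 : ∀ r d, acrisFrobenius p C (y r (d + 1)) = p * y r d := fun r d => by
    refine hA.pow_mul_cancel r ?_
    rw [← map_natCast (acrisFrobenius p C), ← map_pow, ← map_mul, hy, ← add_assoc, hv1, map_pow,
      map_natCast, mul_left_comm, hy]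
  have hy2 : ∀ r, y r 0 ∈ AcrisDoublePrime p C := by
    intro r
    refine ⟨y r, fun k => ?_, fun n => ?_⟩
    · filter_upwards [Filter.eventually_ge_atTop (ψ (r + k))] with n hn
      have := hψ (r + k) (N r + n) (by omega)
      rw [Ideal.span_singleton_pow, Ideal.mem_span_singleton] at this ⊢
      rw [← hy] at this
      exact hA.pow_dvd_of_pow_add_dvd this
    · induction n with
      | zero => simp
      | succ n ih =>
        have := acrisFrobenius_iterate_p_mul (p := p) (C := C) n 1 (y r n)
        rw [pow_one] at this
        rw [Function.iterate_succ_apply, hy1, this, ← ih]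
        ring
  choose w hw using fun r => exists_sub_mem_AcrisInfty hA hs (hy2 r)
  -- Both p y_(r+1,0) and y_(r,ψ(r+1)) equal v_(N (r+1))/p^r. Their Witt vector approximations
  -- differ by an element of W(C^♭) on which F' iterates forever.
  have hcompat : ∀ r, (p : WFlat p C) * w (r + 1) -
      WittVector.verschiebung^[ψ (r + 1)] (w r) ∈ wittKer p C 0 := by
    intro r
    refine mem_wittKer_of_algebraMap_mem hA ?_
    have h1 := sub_verschiebung_iterate_mem_AcrisInfty hI (hy1 r) (hw r) (ψ (r + 1))
    have h2 : (p : Acris p C) * y (r + 1) 0 = y r (ψ (r + 1)) := by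
      refine hA.pow_mul_cancel r ?_
      rw [hy, ← hN, ← add_zero (N (r + 1)), ← hy]
      ring
    have h3 := sub_mem h1 (nsmul_mem (hw (r + 1)) p)
    rw [nsmul_eq_mul, mul_sub, h2] at h3
    convert h3 using 1
    rw [map_sub, map_mul, map_natCast]
    ring
  -- Multiplication by p^r lifts the congruence `hcompat` from W(Ker ν_0) to W(Ker ν_r), the
  -- compatibility needed at level r.
  obtain ⟨x, hx⟩ := M.exists_of_compatible N (fun r => (p : WFlat p C) ^ r * w r) rfl (fun r => by
    refine ⟨_, hN r, ?_⟩
    have h1 := pow_p_mul_mem_wittKer (r := r) (hcompat r)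
    have h2 : WittVector.verschiebung^[ψ (r + 1)] ((p : WFlat p C) ^ r * w r) =
        (p : WFlat p C) ^ r * WittVector.verschiebung^[ψ (r + 1)] (w r) := by
      rw [← Nat.cast_pow, ← nsmul_eq_mul, ← nsmul_eq_mul, iterate_map_nsmul]
    rw [zero_add, mul_sub, ← h2] at h1
    rwa [pow_succ, mul_assoc])
  refine ⟨x, eq_of_pow_dvd_sub p fun r => ?_⟩
  have h1 := hf.approx hA hF _ _ _ _ (hx r)
  obtain ⟨b, -, hb⟩ := hw r (N r)
  have h2 : (p : Acris p C) ^ N r * u = (acrisFrobenius p C)^[N r] (v (N r)) := hv' _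
  rw [← add_zero (N r), ← hy, acrisFrobenius_iterate_p_mul, add_zero] at h2
  rw [iterate_map_sub, acrisFrobenius_iterate_algebraMap, eq_sub_iff_add_eq] at hb
  have h3 : (p : Acris p C) ^ (N r + r) ∣ (p : Acris p C) ^ N r * u -
      algebraMap _ _ (WittVector.frobenius^[N r] ((p : WFlat p C) ^ r * w r)) := by
    refine ⟨b, ?_⟩
    have h4 : WittVector.frobenius^[N r] ((p : WFlat p C) ^ r * w r) =
        (p : WFlat p C) ^ r * WittVector.frobenius^[N r] (w r) := by
      rw [← Nat.cast_pow, ← nsmul_eq_mul, ← nsmul_eq_mul, iterate_map_nsmul]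
    rw [h2, ← hb, h4, map_mul, map_pow, map_natCast]
    ring
  exact pow_dvd_sub_of_approx hA h1 h3

end Image

/-! ### Exponents -/

section Exponents

variable {p : ℕ} [Fact p.Prime]

namespace Exponent

/-- The integral part of an element of `ℤ_+[1/p]`. -/
def floor (a : Exponent p) : ℕ := ⌊(a : ℚ)⌋₊

theorem natCast_mem (k : ℕ) : (k : ℚ) ∈ Exponent p := ⟨k, 0, by simp⟩

/-- A nonnegative integer, as an element of `ℤ_+[1/p]`. -/
def ofNat (k : ℕ) : Exponent p := ⟨k, natCast_mem k⟩

/-- The fractional part of an element of `ℤ_+[1/p]`. -/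
def frac (a : Exponent p) : Exponent p := ⟨a - floor a, by
  obtain ⟨_, m, k, rfl⟩ := a
  have hp : (p : ℚ) ^ k ≠ 0 := pow_ne_zero _ (by exact_mod_cast (Fact.out : p.Prime).ne_zero)
  have h : floor (⟨(m : ℚ) / p ^ k, m, k, rfl⟩ : Exponent p) = m / p ^ k := by
    have := Nat.floor_div_eq_div (K := ℚ) m (p ^ k)
    rw [Nat.cast_pow] at this
    exact this
  refine ⟨m % p ^ k, k, ?_⟩
  rw [h, eq_div_iff hp, sub_mul, div_mul_cancel₀ _ hp, sub_eq_iff_eq_add]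
  exact_mod_cast (Nat.mod_add_div' m (p ^ k)).symm⟩

theorem frac_add_floor (a : Exponent p) : frac a + ofNat (floor a) = a :=
  Subtype.ext (sub_add_cancel _ _)

theorem floor_add_ofNat (a : Exponent p) (k : ℕ) : floor (a + ofNat k) = floor a + k :=
  Nat.floor_add_natCast (Exponent.nonneg p a) k

theorem frac_add_ofNat (a : Exponent p) (k : ℕ) : frac (a + ofNat k) = frac a := by
  refine Subtype.ext ?_
  change ((a : ℚ) + k) - floor (a + ofNat k) = a - floor a
  rw [floor_add_ofNat]
  push_cast
  ring

theorem floor_ofNat (k : ℕ) : floor (ofNat k : Exponent p) = k := Nat.floor_natCast k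

theorem frac_ofNat (k : ℕ) : frac (ofNat k : Exponent p) = 0 :=
  Subtype.ext (by change (k : ℚ) - floor (ofNat k) = 0; rw [floor_ofNat, sub_self])

theorem ofNat_add (k l : ℕ) : (ofNat (k + l) : Exponent p) = ofNat k + ofNat l :=
  Subtype.ext (Nat.cast_add k l)

theorem ofNat_zero : (ofNat 0 : Exponent p) = 0 := Subtype.ext Nat.cast_zero

theorem ofNat_eq_nsmul (k : ℕ) : (ofNat k : Exponent p) = k • ofNat 1 :=
  Subtype.ext (by change (k : ℚ) = _; rw [AddSubmonoidClass.coe_nsmul]; simp [ofNat])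

theorem floor_add_le (a b : Exponent p) : floor a + floor b ≤ floor (a + b) :=
  Nat.le_floor (by
    push_cast
    exact add_le_add (Nat.floor_le (Exponent.nonneg p a)) (Nat.floor_le (Exponent.nonneg p b)))

theorem floor_nsmul_lt {a : Exponent p} (h : floor a = 0) : floor (p • a) < p := by
  have h1 : (a : ℚ) < 1 := Nat.floor_eq_zero.1 h
  have h2 : (0 : ℚ) < p := by exact_mod_cast (Fact.out : p.Prime).pos
  rw [floor, Nat.floor_lt (Exponent.nonneg p _), AddSubmonoidClass.coe_nsmul, nsmul_eq_mul]
  calc (p : ℚ) * a < p * 1 := mul_lt_mul_of_pos_left h1 h2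
    _ = p := mul_one _

/-- Division by `p` on `ℤ_+[1/p]`. -/
def divP : Exponent p →+ Exponent p where
  toFun a := ⟨a / p, by
    obtain ⟨_, m, k, rfl⟩ := a
    exact ⟨m, k + 1, by rw [div_div, pow_succ]⟩⟩
  map_zero' := Subtype.ext (zero_div _)
  map_add' a b := Subtype.ext (add_div _ _ _)

theorem nsmul_divP (a : Exponent p) : p • divP a = a := by
  have : (p : ℚ) ≠ 0 := by exact_mod_cast (Fact.out : p.Prime).ne_zero
  refine Subtype.ext ?_
  rw [AddSubmonoidClass.coe_nsmul, nsmul_eq_mul]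
  exact mul_div_cancel₀ _ this

end Exponent

variable {n : ℕ}

/-- The product of the factorials of the integral parts of the exponents. -/
def weight (α : Fin n → Exponent p) : ℕ := ∏ i, (Exponent.floor (α i)).factorial

theorem weight_ne_zero (α : Fin n → Exponent p) : weight α ≠ 0 :=
  Finset.prod_ne_zero_iff.2 fun _ _ => Nat.factorial_ne_zero _

theorem weight_mul_weight_dvd (α β : Fin n → Exponent p) :
    weight α * weight β ∣ weight (α + β) := by
  rw [weight, weight, ← Finset.prod_mul_distrib]
  exact Finset.prod_dvd_prod_of_dvd _ _ fun i _ =>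
    (Nat.factorial_mul_factorial_dvd_factorial_add _ _).trans
      (Nat.factorial_dvd_factorial (Exponent.floor_add_le _ _))

theorem weight_single (i : Fin n) (a : Exponent p) :
    weight (Pi.single i a) = (Exponent.floor a).factorial := by
  rw [weight, Finset.prod_eq_single i, Pi.single_eq_same]
  · intro j _ hj
    rw [Pi.single_eq_of_ne hj, ← Exponent.ofNat_zero, Exponent.floor_ofNat, Nat.factorial_zero]
  · exact fun h => absurd (Finset.mem_univ i) h

theorem weight_zero : weight (0 : Fin n → Exponent p) = 1 := by
  refine Finset.prod_eq_one fun i _ => ?_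
  rw [Pi.zero_apply, ← Exponent.ofNat_zero, Exponent.floor_ofNat, Nat.factorial_zero]

theorem nsmul_injective_exponent :
    Function.Injective fun α : Fin n → Exponent p => p • α := by
  intro α β h
  have h0 : (p : ℚ) ≠ 0 := by exact_mod_cast (Fact.out : p.Prime).ne_zero
  funext i
  have h1 := congrArg (fun γ : Fin n → Exponent p => ((γ i : Exponent p) : ℚ)) h
  simp only [Pi.smul_apply, AddSubmonoidClass.coe_nsmul, nsmul_eq_mul] at h1
  exact Subtype.ext (mul_left_cancel₀ h0 h1)

theorem exists_divP (α : Fin n → Exponent p) : ∃ β, p • β = α :=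
  ⟨fun i => Exponent.divP (α i), funext fun i => Exponent.nsmul_divP (α i)⟩

end Exponents

/-! ### The perfect ring `B[x_1 ^ (p ^ (-∞)), …, x_n ^ (p ^ (-∞))]` -/

section PerfectPolynomial

variable (p : ℕ) [Fact p.Prime] (B : Type u) [CommRing B] [CharP B p] (n : ℕ)

instance : CharP (PerfectPolynomial p B n) p :=
  charP_of_injective_algebraMap (FaithfulSMul.algebraMap_injective B (PerfectPolynomial p B n)) p

variable [PerfectRing B p]

/-- The inverse of the Frobenius endomorphism. -/
def PerfectPolynomial.root : PerfectPolynomial p B n →+* PerfectPolynomial p B n :=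
  AddMonoidAlgebra.liftNCRingHom (AddMonoidAlgebra.singleZeroRingHom.comp
    (frobeniusEquiv B p).symm.toRingHom)
    ((AddMonoidAlgebra.of B (Fin n → Exponent p)).comp
      (AddMonoidHom.toMultiplicative (Exponent.divP.compLeft (Fin n))))
    fun _ _ => Commute.all _ _

theorem PerfectPolynomial.root_single (α : Fin n → Exponent p) (b : B) :
    root p B n (AddMonoidAlgebra.single (p • α) (b ^ p)) = AddMonoidAlgebra.single α b := by
  rw [root, AddMonoidAlgebra.liftNCRingHom_single]
  have h1 : (frobeniusEquiv B p).symm (b ^ p) = b := (frobeniusEquiv B p).symm_apply_apply b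
  have h2 : (Exponent.divP.compLeft (Fin n)) (p • α) = α :=
    nsmul_injective_exponent (funext fun i => Exponent.nsmul_divP _)
  simp [h1, h2, AddMonoidAlgebra.single_mul_single]

instance : PerfectRing (PerfectPolynomial p B n) p where
  bijective_frobenius := by
    refine Function.bijective_iff_has_inverse.2 ⟨PerfectPolynomial.root p B n, ?_, ?_⟩
    · refine DFunLike.congr_fun (f := (PerfectPolynomial.root p B n).comp (frobenius _ p))
        (g := RingHom.id _) (AddMonoidAlgebra.ringHom_ext (fun b => ?_) fun α => ?_)
      · rw [RingHom.comp_apply, frobenius_def, AddMonoidAlgebra.single_pow,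
          PerfectPolynomial.root_single]
        rfl
      · rw [RingHom.comp_apply, frobenius_def, AddMonoidAlgebra.single_pow,
          PerfectPolynomial.root_single]
        rfl
    · refine DFunLike.congr_fun (f := (frobenius _ p).comp (PerfectPolynomial.root p B n))
        (g := RingHom.id _) (AddMonoidAlgebra.ringHom_ext (fun b => ?_) fun α => ?_)
      · obtain ⟨b, rfl⟩ := (bijective_frobenius B p).2 b
        have := PerfectPolynomial.root_single p B n 0 b
        rw [smul_zero] at this
        rw [RingHom.comp_apply, frobenius_def, frobenius_def, this, AddMonoidAlgebra.single_pow,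
          smul_zero]
        rfl
      · obtain ⟨β, rfl⟩ := exists_divP α
        have := PerfectPolynomial.root_single p B n β 1
        rw [one_pow] at this
        rw [RingHom.comp_apply, frobenius_def, this, AddMonoidAlgebra.single_pow, one_pow]
        rfl

end PerfectPolynomial

/-! ### Divided power polynomials over `W(B)` -/

section PDPoly

theorem coeff_natCast_mul {K Γ : Type*} [CommRing K] [AddMonoid Γ] (m : ℕ)
    (g : AddMonoidAlgebra K Γ) (α : Γ) :
    ((m : AddMonoidAlgebra K Γ) * g).coeff α = m * g.coeff α := by
  rw [← nsmul_eq_mul, AddMonoidAlgebra.coeff_smul_apply, nsmul_eq_mul]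

theorem natCast_mul_single {K Γ : Type*} [CommRing K] [AddMonoid Γ] (m : ℕ) (α : Γ) (c : K) :
    (m : AddMonoidAlgebra K Γ) * AddMonoidAlgebra.single α c =
      AddMonoidAlgebra.single α (m * c) := by
  rw [← nsmul_eq_mul, AddMonoidAlgebra.smul_single, nsmul_eq_mul]

variable (p : ℕ) [Fact p.Prime] (B : Type u) [CommRing B] [CharP B p] [PerfectRing B p] (n : ℕ)

/-- p = VF with V injective and, B being perfect, F bijective. -/
theorem wittVector_isFlatAt : IsFlatAt p (WittVector p B) where
  eq_zero_of_mul a ha := by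
    rw [p_mul_eq_verschiebung_frobenius] at ha
    have := WittVector.verschiebung_injective p B (ha.trans (map_zero _).symm)
    exact (WittVector.frobenius_bijective p B).1 (this.trans (map_zero _).symm)
  isUnit := isUnit_natCast_of_isAdicComplete p (WittVector p B)

/-- The total ring of fractions of `W(B)`. -/
abbrev WittFrac : Type u := FractionRing (WittVector p B)

theorem isUnit_natCast_wittFrac {m : ℕ} (hm : m ≠ 0) : IsUnit (m : WittFrac p B) := by
  have h : (m : WittVector p B) ∈ nonZeroDivisors (WittVector p B) :=
    mem_nonZeroDivisors_iff_right.2 fun a ha => (wittVector_isFlatAt p B).natCast_mul_cancel hm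
      (by rw [mul_comm, ha, mul_zero])
  have := IsLocalization.map_units (WittFrac p B) ⟨_, h⟩
  rwa [map_natCast] at this

omit [CharP B p] [PerfectRing B p] in
theorem wittFrac_injective : Function.Injective (algebraMap (WittVector p B) (WittFrac p B)) :=
  IsFractionRing.injective _ _

/-- The subring of all `∑ c_α x ^ α` such that `c_α` times the product of the factorials of the
integral parts of the entries of `α` is in `W(B)`. -/
def pdSubring : Subring (AddMonoidAlgebra (WittFrac p B) (Fin n → Exponent p)) where
  carrier := {g | ∀ α, (weight α : WittFrac p B) * g.coeff α ∈
    (algebraMap (WittVector p B) (WittFrac p B)).range}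
  mul_mem' {f g} hf hg α := by
    classical
    rw [AddMonoidAlgebra.coeff_mul, Finsupp.sum, Finset.mul_sum]
    refine sum_mem fun β _ => ?_
    rw [Finsupp.sum, Finset.mul_sum]
    refine sum_mem fun γ _ => ?_
    split_ifs with h
    · subst h
      obtain ⟨m, hm⟩ := weight_mul_weight_dvd β γ
      have : ((weight (β + γ) : ℕ) : WittFrac p B) * (f.coeff β * g.coeff γ) =
          m * ((weight β * f.coeff β) * (weight γ * g.coeff γ)) := by
        rw [hm]
        push_cast
        ring
      rw [this]
      exact mul_mem (natCast_mem _ m) (mul_mem (hf β) (hg γ))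
    · rw [mul_zero]
      exact zero_mem _
  one_mem' α := by
    classical
    rw [AddMonoidAlgebra.one_def, AddMonoidAlgebra.coeff_single, Finsupp.single_apply]
    split_ifs
    · rw [mul_one]
      exact natCast_mem _ _
    · rw [mul_zero]
      exact zero_mem _
  add_mem' {f g} hf hg α := by
    rw [AddMonoidAlgebra.coeff_add, Finsupp.add_apply, mul_add]
    exact add_mem (hf α) (hg α)
  zero_mem' α := by
    rw [AddMonoidAlgebra.coeff_zero, Finsupp.zero_apply, mul_zero]
    exact zero_mem _
  neg_mem' {f} hf α := by
    rw [AddMonoidAlgebra.coeff_neg, Finsupp.neg_apply, mul_neg]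
    exact neg_mem (hf α)

/-- The ring of divided power polynomials over `W(B)`. -/
abbrev PDPoly : Type u := pdSubring p B n

namespace PDPoly

variable {n}

omit [CharP B p] [PerfectRing B p] in
theorem single_mem {α : Fin n → Exponent p} {c : WittFrac p B}
    (h : (weight α : WittFrac p B) * c ∈ (algebraMap (WittVector p B) (WittFrac p B)).range) :
    AddMonoidAlgebra.single α c ∈ pdSubring p B n := by
  classical
  intro β
  rw [AddMonoidAlgebra.coeff_single, Finsupp.single_apply]
  split_ifs with hβ
  · rwa [← hβ]
  · rw [mul_zero]
    exact zero_mem _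

/-- The divided power monomial which corresponds to `α`. -/
def dpMonomial (α : Fin n → Exponent p) : PDPoly p B n :=
  ⟨AddMonoidAlgebra.single α (Ring.inverse (weight α : WittFrac p B)), single_mem p B (by
    rw [Ring.mul_inverse_cancel _ (isUnit_natCast_wittFrac p B (weight_ne_zero α))]
    exact one_mem _)⟩

variable (n) in
/-- The homomorphism `α ↦ x ^ α`. -/
def monomial : Multiplicative (Fin n → Exponent p) →* PDPoly p B n where
  toFun α := ⟨AddMonoidAlgebra.single α.toAdd 1, single_mem p B (by
    rw [mul_one]
    exact natCast_mem _ _)⟩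
  map_one' := rfl
  map_mul' α β := Subtype.ext (by simp [AddMonoidAlgebra.single_mul_single])

variable (n) in
/-- The homomorphism from `W(B)` to the ring of divided power polynomials. -/
def const : WittVector p B →+* PDPoly p B n :=
  (AddMonoidAlgebra.singleZeroRingHom.comp (algebraMap (WittVector p B) (WittFrac p B))).codRestrict
    (pdSubring p B n) fun c => single_mem p B (by
      rw [weight_zero, Nat.cast_one, one_mul]
      exact ⟨c, rfl⟩)

theorem weight_mul_dpMonomial (α : Fin n → Exponent p) :
    (weight α : PDPoly p B n) * dpMonomial p B α = monomial p B n (.ofAdd α) := by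
  refine Subtype.ext ?_
  change ((weight α : ℕ) : AddMonoidAlgebra (WittFrac p B) (Fin n → Exponent p)) *
    AddMonoidAlgebra.single α _ = AddMonoidAlgebra.single α 1
  rw [natCast_mul_single,
    Ring.mul_inverse_cancel _ (isUnit_natCast_wittFrac p B (weight_ne_zero α))]

theorem eq_zero_of_p_mul (a : PDPoly p B n) (ha : (p : PDPoly p B n) * a = 0) : a = 0 := by
  refine Subtype.ext (AddMonoidAlgebra.ext (Finsupp.ext fun α => ?_))
  have h := congrArg (fun g : PDPoly p B n => g.1.coeff α) ha
  change ((p : AddMonoidAlgebra (WittFrac p B) (Fin n → Exponent p)) * a.1).coeff α = 0 at h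
  rw [coeff_natCast_mul] at h
  exact (isUnit_natCast_wittFrac p B (Fact.out : p.Prime).ne_zero).mul_right_eq_zero.1 h

theorem coeff_sum (l : (Fin n → Exponent p) →₀ WittVector p B) (α : Fin n → Exponent p) :
    (weight α : WittFrac p B) * (l.sum fun β c => const p B n c * dpMonomial p B β).1.coeff α =
      algebraMap _ _ (l α) := by
  classical
  have h1 : ∀ (c : WittVector p B) (β : Fin n → Exponent p),
      (const p B n c * dpMonomial p B β).1.coeff α =
        if β = α then algebraMap _ _ c * Ring.inverse (weight α : WittFrac p B) else 0 := by
    intro c β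
    change (AddMonoidAlgebra.single 0 (algebraMap _ _ c) * AddMonoidAlgebra.single β _ :
      AddMonoidAlgebra (WittFrac p B) (Fin n → Exponent p)).coeff α = _
    rw [AddMonoidAlgebra.single_mul_single, zero_add, AddMonoidAlgebra.coeff_single,
      Finsupp.single_apply]
    split_ifs with h
    · rw [h]
    · rfl
  have h2 : (l.sum fun β c => const p B n c * dpMonomial p B β).1.coeff α =
      l.sum fun β c => (const p B n c * dpMonomial p B β).1.coeff α := by
    let φ : PDPoly p B n →+ WittFrac p B :=
      { toFun := fun g => g.1.coeff α, map_zero' := rfl, map_add' := fun _ _ => rfl }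
    exact map_finsuppSum φ _ _
  rw [h2]
  simp only [h1]
  rw [Finsupp.sum, Finset.sum_ite_eq']
  split_ifs with h
  · rw [mul_left_comm, Ring.mul_inverse_cancel _
      (isUnit_natCast_wittFrac p B (weight_ne_zero α)), mul_one]
  · rw [Finsupp.notMem_support_iff.1 h, map_zero, mul_zero]

/-- The weight times the coefficient at α recovers l α, and for every member of `pdSubring` this
product is in W(B). So divisibility descends to coefficients. -/
theorem pow_dvd_of_pow_dvd_sum (k : ℕ) (l : (Fin n → Exponent p) →₀ WittVector p B)
    (h : (p : PDPoly p B n) ^ k ∣ l.sum fun β c => const p B n c * dpMonomial p B β)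
    (α : Fin n → Exponent p) : (p : WittVector p B) ^ k ∣ l α := by
  obtain ⟨g, hg⟩ := h
  obtain ⟨c, hc⟩ := g.2 α
  refine ⟨c, wittFrac_injective p B ?_⟩
  rw [map_mul, hc, ← coeff_sum, hg, map_pow, map_natCast, mul_left_comm]
  congr 1
  change (((p : AddMonoidAlgebra (WittFrac p B) (Fin n → Exponent p)) ^ k) * g.1).coeff α = _
  rw [← Nat.cast_pow, coeff_natCast_mul, Nat.cast_pow]

end PDPoly

end PDPoly

/-! ### The homomorphism from the PD hull to the completed ring of divided power polynomials -/

section WittReduce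

variable {p : ℕ} [Fact p.Prime] {R : Type*} [CommRing R] [CharP R p] [PerfectRing R p]

/-- R = W(R)/p because R is perfect. -/
theorem exists_comp_constantCoeff_eq {T : Type*} [CommRing T] (g : WittVector p R →+* T)
    (hp : (p : T) = 0) : ∃ f : R →+* T, ∀ w, f (w.coeff 0) = g w := by
  have hker : RingHom.ker (WittVector.constantCoeff : WittVector p R →+* R) ≤ RingHom.ker g := by
    intro w hw
    obtain ⟨v, rfl⟩ := (p_dvd_iff_coeff_zero w).2 hw
    rw [RingHom.mem_ker, map_mul, map_natCast, hp, zero_mul]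
  have hinv : Function.RightInverse (WittVector.teichmuller p)
      (WittVector.constantCoeff : WittVector p R →+* R) :=
    WittVector.teichmuller_coeff_zero p
  exact ⟨RingHom.liftOfRightInverse _ _ hinv ⟨g, hker⟩, fun w =>
    RingHom.liftOfRightInverse_comp_apply _ _ hinv ⟨g, hker⟩ w⟩

theorem ringHom_eq_of_apply_teichmuller_eq {S : Type*} [CommRing S]
    (f g : WittVector p R →+* AdicCompletion (Ideal.span {(p : S)}) S)
    (h : ∀ x, f (WittVector.teichmuller p x) = g (WittVector.teichmuller p x)) : f = g := by
  refine RingHom.ext fun w => eq_of_pow_dvd_sub p fun k => ?_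
  rw [← Ideal.mem_span_singleton, ← Ideal.Quotient.eq]
  refine DFunLike.congr_fun (WittVector.eq_of_apply_teichmuller_eq
    ((Ideal.Quotient.mk (Ideal.span {(p : AdicCompletion (Ideal.span {(p : S)}) S) ^ k})).comp f)
    ((Ideal.Quotient.mk _).comp g) ⟨k, ?_⟩ fun x => ?_) w
  · rw [← map_natCast (Ideal.Quotient.mk _), ← map_pow, Ideal.Quotient.eq_zero_iff_mem]
    exact Ideal.mem_span_singleton_self _
  · rw [RingHom.comp_apply, RingHom.comp_apply, h]

end WittReduce

/-- The untilt of the p^m-th root of t is congruent to y m modulo p, and raising to the power p^m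
improves this to a congruence modulo p^(m+1). -/
theorem untilt_eq {O : Type*} [CommRing O] {p : ℕ} [Fact (Nat.Prime p)] [Fact ¬IsUnit (p : O)]
    [IsAdicComplete (Ideal.span {(p : O)}) O] (t : PreTilt O p) (y : ℕ → O)
    (hy : ∀ m, y (m + 1) ^ p = y m)
    (h : ∀ m, PreTilt.coeff m t = Ideal.Quotient.mk (Ideal.span {(p : O)}) (y m)) :
    PreTilt.untilt t = y 0 := by
  have hy' : ∀ m, y m ^ p ^ m = y 0 := by
    intro m
    induction m with
    | zero => rw [pow_zero, pow_one]
    | succ m ih => rw [pow_succ', pow_mul, hy, ih]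
  have key : ∀ m, (p : O) ^ (m + 1) ∣ PreTilt.untilt t - y 0 := by
    intro m
    rw [← hy' m, ← PreTilt.untilt_iterate_frobeniusEquiv_symm_pow t m]
    refine dvd_sub_pow_of_dvd_sub ?_ m
    rw [← Ideal.mem_span_singleton, ← Ideal.Quotient.eq, PreTilt.mk_untilt_eq_coeff_zero,
      PreTilt.coeff_iterate_frobeniusEquiv_symm, zero_add, h]
  refine sub_eq_zero.1 (IsHausdorff.haus (I := Ideal.span {(p : O)}) inferInstance _ fun m => ?_)
  rw [SModEq.zero, smul_eq_mul, Ideal.mul_top, Ideal.span_singleton_pow,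
    Ideal.mem_span_singleton]
  exact (pow_dvd_pow _ (Nat.le_succ m)).trans (key m)

section Model

variable (p : ℕ) [Fact p.Prime] (B : Type u) [CommRing B] [CharP B p] [PerfectRing B p] (n : ℕ)

/-- The `p`-adic completion of the ring of divided power polynomials over `W(B)`. -/
abbrev PDSeries : Type u := AdicCompletion (Ideal.span {(p : PDPoly p B n)}) (PDPoly p B n)

theorem pdSeries_isFlatAt : IsFlatAt p (PDSeries p B n) :=
  adicCompletion_isFlatAt p (PDPoly.eq_zero_of_p_mul p B)

instance : Fact (¬ IsUnit (p : PDSeries p B n)) := ⟨fun h => by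
  have h1 : (p : PDSeries p B n) ^ 1 ∣ algebraMap (PDPoly p B n) (PDSeries p B n)
      ((Finsupp.single (0 : Fin n → Exponent p) (1 : WittVector p B)).sum
        fun β c => PDPoly.const p B n c * PDPoly.dpMonomial p B β) := by
    rw [pow_one]
    exact h.dvd
  rw [pow_dvd_algebraMap_iff] at h1
  have h2 := PDPoly.pow_dvd_of_pow_dvd_sum p B 1 _ h1 0
  rw [pow_one, Finsupp.single_eq_same, p_dvd_iff_coeff_zero, WittVector.one_coeff_zero] at h2
  have : Nontrivial B := CharP.nontrivial_of_char_ne_one (v := p) (Fact.out : p.Prime).ne_one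
  exact one_ne_zero h2⟩

variable {n} in
/-- The element `x ^ α` of the completed ring of divided power polynomials. -/
def PDSeries.monomial : Multiplicative (Fin n → Exponent p) →* PDSeries p B n :=
  (algebraMap (PDPoly p B n) (PDSeries p B n)).toMonoidHom.comp (PDPoly.monomial p B n)

/-- The homomorphism from `W(B)` to the completed ring of divided power polynomials. -/
def PDSeries.const : WittVector p B →+* PDSeries p B n :=
  (algebraMap (PDPoly p B n) (PDSeries p B n)).comp (PDPoly.const p B n)

theorem exists_reduction : ∃ ρ : PerfectPolynomial p B n →+* ModP (PDSeries p B n) p,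
    ∀ α b, ρ (AddMonoidAlgebra.single α b) = Ideal.Quotient.mk _
      (PDSeries.const p B n (WittVector.teichmuller p b) * PDSeries.monomial p B (.ofAdd α)) := by
  have hp : (p : ModP (PDSeries p B n) p) = 0 := CharP.cast_eq_zero _ p
  obtain ⟨f, hf⟩ := exists_comp_constantCoeff_eq
    ((Ideal.Quotient.mk (Ideal.span {(p : PDSeries p B n)})).comp (PDSeries.const p B n)) hp
  refine ⟨AddMonoidAlgebra.liftNCRingHom f ((Ideal.Quotient.mk _).toMonoidHom.comp
    (PDSeries.monomial p B)) fun _ _ => Commute.all _ _, fun α b => ?_⟩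
  have h := hf (WittVector.teichmuller p b)
  rw [WittVector.teichmuller_coeff_zero] at h
  rw [AddMonoidAlgebra.liftNCRingHom_single, h, map_mul]
  rfl

variable {B n} in
/-- The homomorphism `B[x_1 ^ (p ^ (-∞)), …, x_n ^ (p ^ (-∞))] → C^♭`. -/
def toFlat : PerfectPolynomial p B n →+* Perfection (KeyRing p B n) p :=
  Perfection.lift p _ _ (Ideal.Quotient.mk _)

variable {p B n}

theorem coeff_toFlat (m : ℕ) (q : PerfectPolynomial p B n) :
    Perfection.coeff _ p m (toFlat p q) =
      Ideal.Quotient.mk _ ((frobeniusEquiv (PerfectPolynomial p B n) p).symm^[m] q) := rfl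

omit [CharP B p] [PerfectRing B p] in
theorem PerfectPolynomial.x_eq (i : Fin n) : PerfectPolynomial.x p B n i =
    AddMonoidAlgebra.single (Pi.single i (Exponent.ofNat 1)) 1 := by
  rw [PerfectPolynomial.x]
  congr 2

theorem PDSeries.monomial_single_pow (i : Fin n) (m : ℕ) :
    PDSeries.monomial p B (.ofAdd (Pi.single i (Exponent.ofNat 1))) ^ m =
      (m.factorial : PDSeries p B n) * algebraMap (PDPoly p B n) _
        (PDPoly.dpMonomial p B (Pi.single i (Exponent.ofNat m))) := by
  have h : (m • Pi.single i (Exponent.ofNat 1) : Fin n → Exponent p) =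
      Pi.single i (Exponent.ofNat m) := by
    rw [← Pi.single_smul, ← Exponent.ofNat_eq_nsmul]
  have h2 := PDPoly.weight_mul_dpMonomial p B (n := n) (Pi.single i (Exponent.ofNat m))
  rw [weight_single, Exponent.floor_ofNat] at h2
  rw [← map_pow, ← ofAdd_nsmul, h, ← map_natCast (algebraMap (PDPoly p B n) (PDSeries p B n)),
    ← map_mul, h2]
  rfl

/-- The map ρ does not kill x_i, but its composite with Frobenius does, since x_i^p = p! γ_p(x_i)
vanishes modulo p. So Frobenius ∘ ρ descends to C, and composing it with ν_1 instead of ν_0 undoes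
the Frobenius. -/
theorem exists_flatReduction : ∃ χ : Perfection (KeyRing p B n) p →+* ModP (PDSeries p B n) p,
    (∀ α b m, χ ((frobeniusEquiv (Perfection (KeyRing p B n) p) p).symm^[m]
      (toFlat p (AddMonoidAlgebra.single α b))) = Ideal.Quotient.mk _
        (PDSeries.const p B n (WittVector.teichmuller p ((frobeniusEquiv B p).symm^[m] b)) *
          PDSeries.monomial p B (.ofAdd ((Exponent.divP.compLeft (Fin n))^[m] α)))) ∧
    ∀ z ∈ kerNu p (KeyRing p B n) 0, χ z ∈ Ideal.map (Ideal.Quotient.mk _)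
      (factorialIdeal (⊤ : Ideal (PDSeries p B n))) := by
  obtain ⟨ρ, hρ⟩ := exists_reduction p B n
  have hx : ∀ i, ρ (PerfectPolynomial.x p B n i) = Ideal.Quotient.mk _
      (PDSeries.monomial p B (.ofAdd (Pi.single i (Exponent.ofNat 1)))) := fun i => by
    rw [PerfectPolynomial.x_eq, hρ, map_one (WittVector.teichmuller p), map_one, one_mul]
  let χ₀ : KeyRing p B n →+* ModP (PDSeries p B n) p :=
    Ideal.Quotient.lift _ ((frobenius _ p).comp ρ) (by
      intro a ha
      rw [← RingHom.mem_ker]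
      refine (Ideal.span_le (I := RingHom.ker _)).2 ?_ ha
      rintro _ ⟨i, rfl⟩
      rw [SetLike.mem_coe, RingHom.mem_ker, RingHom.comp_apply, frobenius_def, hx, ← map_pow,
        PDSeries.monomial_single_pow, Ideal.Quotient.eq_zero_iff_mem, Ideal.mem_span_singleton]
      refine dvd_mul_of_dvd_left ?_ _
      exact_mod_cast (Nat.cast_dvd_cast (α := PDSeries p B n)
        (Nat.dvd_factorial (Fact.out : p.Prime).pos le_rfl)))
  have hχ₀ : ∀ q, χ₀ (Ideal.Quotient.mk _ q) = ρ q ^ p := fun q => rfl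
  refine ⟨χ₀.comp (Perfection.coeff _ p 1), fun α b m => ?_, fun z hz => ?_⟩
  · rw [RingHom.comp_apply, Perfection.coeff_iterate_symm_frobeniusEquiv, add_comm, coeff_toFlat,
      hχ₀, ← map_pow, Function.iterate_succ_apply', frobeniusEquiv_symm_pow_p, ← hρ]
    congr 1
    induction m with
    | zero => rfl
    | succ m ih =>
      rw [Function.iterate_succ_apply', Function.iterate_succ_apply', Function.iterate_succ_apply',
        ih, RingEquiv.symm_apply_eq, frobeniusEquiv_apply, frobenius_def,
        AddMonoidAlgebra.single_pow, frobeniusEquiv_symm_pow_p]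
      congr 1
      exact (funext fun i => Exponent.nsmul_divP _).symm
  · obtain ⟨q, hq⟩ := Ideal.Quotient.mk_surjective (Perfection.coeff _ p 1 z)
    have h1 : q ^ p ∈ Ideal.span (Set.range (PerfectPolynomial.x p B n)) := by
      rw [← Ideal.Quotient.eq_zero_iff_mem, map_pow, hq, Perfection.coeff_pow_p']
      exact hz
    rw [RingHom.comp_apply, ← hq, hχ₀, ← map_pow, ← Ideal.mem_comap]
    refine (Ideal.span_le).2 ?_ h1
    rintro _ ⟨i, rfl⟩
    rw [SetLike.mem_coe, Ideal.mem_comap, hx]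
    refine Ideal.mem_map_of_mem _ (mem_factorialIdeal.2 fun m => ⟨_, fun _ => trivial,
      (PDSeries.monomial_single_pow i m).symm⟩)

/-- χ lifts to a map from the perfect ring C^♭ to the tilt, and Fontaine's θ completes it to a map
from W(C^♭). Since p itself has divided powers in the target, the condition on Ker θ may be checked
modulo p. -/
theorem exists_flatHom : ∃ Φ : WFlat p (KeyRing p B n) →+* PDSeries p B n,
    (∀ α b, Φ (WittVector.teichmuller p (toFlat p (AddMonoidAlgebra.single α b))) =
      PDSeries.const p B n (WittVector.teichmuller p b) * PDSeries.monomial p B (.ofAdd α)) ∧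
    ∀ w ∈ kerTheta p (KeyRing p B n), Φ w ∈ factorialIdeal ⊤ := by
  obtain ⟨χ, hχ, hχ'⟩ := exists_flatReduction (p := p) (B := B) (n := n)
  let χ' : Perfection (KeyRing p B n) p →+* PreTilt (PDSeries p B n) p :=
    Perfection.lift p _ (ModP (PDSeries p B n) p) χ
  have hcoeff : ∀ m t, PreTilt.coeff m (χ' t) =
    χ ((frobeniusEquiv (Perfection (KeyRing p B n) p) p).symm^[m] t) := fun m t => rfl
  refine ⟨(WittVector.fontaineTheta (PDSeries p B n) p).comp (WittVector.map χ'),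
    fun α b => ?_, fun w hw => ?_⟩
  · rw [RingHom.comp_apply, WittVector.map_teichmuller, WittVector.fontaineTheta_teichmuller]
    refine untilt_eq _ (fun m => PDSeries.const p B n
      (WittVector.teichmuller p ((frobeniusEquiv B p).symm^[m] b)) *
          PDSeries.monomial p B (.ofAdd ((Exponent.divP.compLeft (Fin n))^[m] α)))
      (fun m => ?_) fun m => by rw [hcoeff, hχ]
    rw [mul_pow, ← map_pow, ← map_pow, ← map_pow, Function.iterate_succ_apply',
      frobeniusEquiv_symm_pow_p, Function.iterate_succ_apply', ← ofAdd_nsmul]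
    congr 3
    exact congrArg Multiplicative.ofAdd (funext fun i => Exponent.nsmul_divP _)
  · have h1 := WittVector.mk_fontaineTheta (WittVector.map χ' w)
    rw [WittVector.map_coeff, hcoeff] at h1
    have h2 := hχ' (w.coeff 0) hw
    rw [Function.iterate_zero_apply] at h1
    rw [← h1, Ideal.mem_quotient_iff_mem] at h2
    · exact h2
    · rw [Ideal.span_singleton_le_iff_mem]
      exact (pdSeries_isFlatAt p B n).p_mem_factorialIdeal trivial

end Model

/-- In a flat target the image of γ_m(x) is forced to be g(x)^m/m!; all relations hold after
cancelling factorials. -/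
theorem PDHull.exists_lift {p : ℕ} [Fact p.Prime] {R S : Type u} [CommRing R] [CommRing S]
    {I : Ideal R} (h : IsFlatAt p S) (g : R →+* S) (hg : ∀ x ∈ I, g x ∈ factorialIdeal ⊤) :
    ∃ φ : PDHull p I →+* S, ∀ r, φ (algebraMap R _ r) = g r := by
  have hg' : ∀ (m : ℕ) (x : I), ∃ c : S, (m.factorial : S) * c = g x ^ m := fun m x => by
    obtain ⟨c, -, hc⟩ := mem_factorialIdeal.1 (hg x x.2) m
    exact ⟨c, hc⟩
  choose d hd using hg'
  refine ⟨PDHull.lift g d ?_ ?_ ?_ ?_ ?_ ?_, fun r => PDHull.lift_algebraMap ..⟩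
  · exact fun x => h.factorial_mul_cancel 0 (by rw [hd]; simp)
  · exact fun r m x => h.factorial_mul_cancel m (by
      rw [hd, mul_left_comm, hd, Submodule.coe_smul, smul_eq_mul, map_mul, mul_pow])
  · intro m k x
    refine h.factorial_mul_cancel m (h.factorial_mul_cancel k ?_)
    have h1 := congrArg (Nat.cast : ℕ → S) (Nat.add_choose_mul_factorial_mul_factorial m k)
    push_cast at h1
    calc _ = (m.factorial * d m x) * (k.factorial * d k x) := by ring
      _ = (m + k).factorial * d (m + k) x := by rw [hd, hd, hd, pow_add]
      _ = _ := by rw [← h1, ← Nat.choose_symm_add]; ring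
  · intro m x y
    refine h.factorial_mul_cancel m ?_
    rw [hd, Submodule.coe_add, map_add, (Commute.all _ _).add_pow', Finset.mul_sum]
    refine Finset.sum_congr rfl fun k hk => ?_
    rw [Finset.HasAntidiagonal.mem_antidiagonal] at hk
    have h1 := Nat.choose_mul_factorial_mul_factorial (show k.1 ≤ m by omega)
    rw [show m - k.1 = k.2 by omega] at h1
    rw [← h1, ← hd, ← hd, nsmul_eq_mul]
    push_cast
    ring
  · exact fun x => h.factorial_mul_cancel 1 (by rw [hd]; simp)
  · intro x hx m
    refine h.pow_mul_cancel (padicValNat p m.factorial) ?_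
    rw [← mul_assoc, ← Nat.cast_pow, ← Nat.cast_mul, Nat.mul_div_cancel' pow_padicValNat_dvd, hd,
      hx, map_natCast, Nat.cast_pow, ← pow_add]
    congr 1
    rcases eq_or_ne m 0 with rfl | hm
    · simp
    · have := padicValNat_factorial_lt_of_ne_zero (p := p) hm
      omega

/-! ### Divided power monomials in the PD hull and their independence -/

section Hull

variable {p : ℕ} [Fact p.Prime] {B : Type u} [CommRing B] [CharP B p] [PerfectRing B p] {n : ℕ}

variable (p B n) in
/-- The Teichmüller representative of the element of `C^♭` which corresponds to `x ^ α`. -/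
def flatMonomial : Multiplicative (Fin n → Exponent p) →* WFlat p (KeyRing p B n) :=
  (WittVector.teichmuller p).comp
    ((toFlat p : PerfectPolynomial p B n →+* _).toMonoidHom.comp (AddMonoidAlgebra.of B _))

variable (p B n) in
/-- The homomorphism `W(B) → W(C^♭)`. -/
def flatConst : WittVector p B →+* WFlat p (KeyRing p B n) :=
  WittVector.map ((toFlat p).comp AddMonoidAlgebra.singleZeroRingHom)

theorem flatMonomial_apply (α : Fin n → Exponent p) : flatMonomial p B n (.ofAdd α) =
    WittVector.teichmuller p (toFlat p (AddMonoidAlgebra.single α 1)) := rfl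

theorem flatConst_teichmuller (b : B) : flatConst p B n (WittVector.teichmuller p b) =
    WittVector.teichmuller p (toFlat p (AddMonoidAlgebra.single 0 b)) := by
  rw [flatConst, WittVector.map_teichmuller]
  rfl

theorem flatConst_mul_flatMonomial (α : Fin n → Exponent p) (b : B) :
    flatConst p B n (WittVector.teichmuller p b) * flatMonomial p B n (.ofAdd α) =
      WittVector.teichmuller p (toFlat p (AddMonoidAlgebra.single α b)) := by
  rw [flatConst_teichmuller, flatMonomial_apply, ← map_mul, ← map_mul,
    AddMonoidAlgebra.single_mul_single, zero_add, mul_one]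

theorem flatMonomial_mem_kerTheta (i : Fin n) :
    flatMonomial p B n (.ofAdd (Pi.single i (Exponent.ofNat 1))) ∈
      kerTheta p (KeyRing p B n) := by
  rw [RingHom.mem_ker, flatMonomial_apply, theta_teichmuller, coeff_toFlat,
    Function.iterate_zero_apply, ← PerfectPolynomial.x_eq, Ideal.Quotient.eq_zero_iff_mem]
  exact Ideal.subset_span ⟨i, rfl⟩

variable (p B) in
/-- The Teichmüller representative of the element which corresponds to `x_i`. -/
def xKer (i : Fin n) : kerTheta p (KeyRing p B n) := ⟨_, flatMonomial_mem_kerTheta i⟩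

variable (p B) in
/-- The divided power of `x_i` with exponent in `ℤ_+[1/p]`. -/
def hullFactor (i : Fin n) (a : Exponent p) : AcrisHull p (KeyRing p B n) :=
  algebraMap _ _ (flatMonomial p B n (.ofAdd (Pi.single i (Exponent.frac a)))) *
    PDHull.dp p _ (Exponent.floor a) (xKer p B i)

variable (p B) in
/-- The divided power monomial of the PD hull which corresponds to `α`. -/
def hullMonomial (α : Fin n → Exponent p) : AcrisHull p (KeyRing p B n) :=
  ∏ i, hullFactor p B i (α i)

theorem flatMonomial_single_add (i : Fin n) (a b : Exponent p) :
    flatMonomial p B n (.ofAdd (Pi.single i (a + b))) =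
      flatMonomial p B n (.ofAdd (Pi.single i a)) *
        flatMonomial p B n (.ofAdd (Pi.single i b)) := by
  rw [← map_mul, ← ofAdd_add, ← Pi.single_add]

theorem flatMonomial_single_ofNat (i : Fin n) (k : ℕ) :
    flatMonomial p B n (.ofAdd (Pi.single i (Exponent.ofNat k))) = (xKer p B i : WFlat p _) ^ k := by
  rw [xKer, ← map_pow, ← ofAdd_nsmul, ← Pi.single_smul, ← Exponent.ofNat_eq_nsmul]

theorem floor_factorial_mul_hullFactor (i : Fin n) (a : Exponent p) :
    ((Exponent.floor a).factorial : AcrisHull p (KeyRing p B n)) * hullFactor p B i a =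
      algebraMap _ _ (flatMonomial p B n (.ofAdd (Pi.single i a))) := by
  rw [hullFactor, mul_left_comm, PDHull.factorial_mul_dp, ← map_pow, ← flatMonomial_single_ofNat,
    ← map_mul, ← flatMonomial_single_add, Exponent.frac_add_floor]

theorem weight_mul_hullMonomial (α : Fin n → Exponent p) :
    (weight α : AcrisHull p (KeyRing p B n)) * hullMonomial p B α =
      algebraMap _ _ (flatMonomial p B n (.ofAdd α)) := by
  rw [weight, hullMonomial, Nat.cast_prod, ← Finset.prod_mul_distrib]
  simp only [floor_factorial_mul_hullFactor]
  rw [← map_prod, ← map_prod, ← ofAdd_sum, Finset.univ_sum_single]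

theorem exists_flatMonomial_mul_dp (i : Fin n) (c : Exponent p) (k : ℕ) :
    ∃ m : ℕ, algebraMap _ (AcrisHull p (KeyRing p B n))
      (flatMonomial p B n (.ofAdd (Pi.single i c))) * PDHull.dp p _ k (xKer p B i) =
        m * hullFactor p B i (c + Exponent.ofNat k) := by
  refine ⟨(Exponent.floor c).factorial * (Exponent.floor c + k).choose (Exponent.floor c), ?_⟩
  rw [hullFactor, Exponent.floor_add_ofNat, Exponent.frac_add_ofNat,
    ← floor_factorial_mul_hullFactor, hullFactor]
  have := PDHull.dp_mul (p := p) (Exponent.floor c) k (xKer p B i)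
  push_cast
  linear_combination ((Exponent.floor c).factorial : AcrisHull p (KeyRing p B n)) *
    algebraMap _ _ (flatMonomial p B n (.ofAdd (Pi.single i (Exponent.frac c)))) * this

theorem exists_hullFactor_mul (i : Fin n) (a b : Exponent p) :
    ∃ m : ℕ, hullFactor p B i a * hullFactor p B i b = m * hullFactor p B i (a + b) := by
  -- The sum of two fractional parts can reach 1; the carry is absorbed into the divided power.
  obtain ⟨m, hm⟩ := exists_flatMonomial_mul_dp (B := B) i (Exponent.frac a + Exponent.frac b)
    (Exponent.floor a + Exponent.floor b)
  have h : Exponent.frac a + Exponent.frac b + Exponent.ofNat (Exponent.floor a + Exponent.floor b) =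
      a + b := by
    rw [Exponent.ofNat_add, add_add_add_comm, Exponent.frac_add_floor, Exponent.frac_add_floor]
  rw [h, flatMonomial_single_add, map_mul] at hm
  refine ⟨(Exponent.floor a + Exponent.floor b).choose (Exponent.floor a) * m, ?_⟩
  have h2 := PDHull.dp_mul (p := p) (Exponent.floor a) (Exponent.floor b) (xKer p B i)
  push_cast
  rw [mul_assoc, ← hm, hullFactor, hullFactor]
  linear_combination algebraMap _ _ (flatMonomial p B n (.ofAdd (Pi.single i (Exponent.frac a)))) *
    algebraMap _ _ (flatMonomial p B n (.ofAdd (Pi.single i (Exponent.frac b)))) * h2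

theorem exists_hullMonomial_mul (α β : Fin n → Exponent p) :
    ∃ m : ℕ, hullMonomial p B α * hullMonomial p B β = m * hullMonomial p B (α + β) := by
  choose m hm using fun i => exists_hullFactor_mul (B := B) i (α i) (β i)
  refine ⟨∏ i, m i, ?_⟩
  rw [hullMonomial, hullMonomial, hullMonomial, ← Finset.prod_mul_distrib, Nat.cast_prod,
    ← Finset.prod_mul_distrib]
  exact Finset.prod_congr rfl fun i _ => hm i

theorem hullFactor_ofNat (i : Fin n) (k : ℕ) :
    hullFactor p B i (Exponent.ofNat k) = PDHull.dp p _ k (xKer p B i) := by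
  rw [hullFactor, Exponent.frac_ofNat, Exponent.floor_ofNat, Pi.single_zero, ofAdd_zero, map_one,
    map_one, one_mul]

theorem hullFactor_zero (i : Fin n) : hullFactor p B i 0 = 1 := by
  rw [← Exponent.ofNat_zero, hullFactor_ofNat, PDHull.dp_zero]

theorem hullMonomial_zero : hullMonomial p B (0 : Fin n → Exponent p) = 1 :=
  Finset.prod_eq_one fun i _ => hullFactor_zero i

theorem hullMonomial_single_ofNat (i : Fin n) (k : ℕ) :
    hullMonomial p B (Pi.single i (Exponent.ofNat k)) = PDHull.dp p _ k (xKer p B i) := by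
  rw [hullMonomial, Finset.prod_eq_single i, Pi.single_eq_same, hullFactor_ofNat]
  · intro j _ hj
    rw [Pi.single_eq_of_ne hj, hullFactor_zero]
  · exact fun h => absurd (Finset.mem_univ i) h

variable (p B n) in
/-- The linear combinations of the elements `hullMonomial p B α` with coefficients from `W(B)`. -/
def hullSum : ((Fin n → Exponent p) →₀ WittVector p B) →+ AcrisHull p (KeyRing p B n) :=
  Finsupp.liftAddHom fun α => (AddMonoidHom.mulRight (hullMonomial p B α)).comp
    ((algebraMap _ (AcrisHull p (KeyRing p B n))).comp (flatConst p B n)).toAddMonoidHom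

theorem hullSum_single (α : Fin n → Exponent p) (c : WittVector p B) :
    hullSum p B n (Finsupp.single α c) =
      algebraMap _ _ (flatConst p B n c) * hullMonomial p B α := by
  rw [hullSum, Finsupp.liftAddHom_apply_single]
  rfl

theorem hullSum_apply (l : (Fin n → Exponent p) →₀ WittVector p B) :
    hullSum p B n l = l.sum fun α c => algebraMap _ _ (flatConst p B n c) * hullMonomial p B α :=
  rfl

/-- The comparison map to `PDSeries` matches the two kinds of divided power monomials, since both
become x^α after multiplication by the weight. Coefficients can be read off there. -/
theorem pow_dvd_of_pow_dvd_hullSum (k : ℕ) (l : (Fin n → Exponent p) →₀ WittVector p B)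
    (h : (p : AcrisHull p (KeyRing p B n)) ^ k ∣ hullSum p B n l) (α : Fin n → Exponent p) :
    (p : WittVector p B) ^ k ∣ l α := by
  obtain ⟨Φ, h1, h2⟩ := exists_flatHom (p := p) (B := B) (n := n)
  have hflat := pdSeries_isFlatAt p B n
  obtain ⟨φ, hφ⟩ := PDHull.exists_lift hflat Φ h2
  have h3 : ∀ c, Φ (flatConst p B n c) = PDSeries.const p B n c := by
    refine DFunLike.congr_fun (f := Φ.comp (flatConst p B n))
      (ringHom_eq_of_apply_teichmuller_eq _ _ fun b => ?_)
    rw [RingHom.comp_apply, flatConst_teichmuller, h1, ofAdd_zero, map_one, mul_one]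
  have h4 : ∀ β, φ (hullMonomial p B β) = algebraMap (PDPoly p B n) _
      (PDPoly.dpMonomial p B β) := by
    intro β
    refine hflat.natCast_mul_cancel (weight_ne_zero β) ?_
    have e1 := congrArg (algebraMap (PDPoly p B n) (PDSeries p B n))
      (PDPoly.weight_mul_dpMonomial p B β)
    have e2 := congrArg φ (weight_mul_hullMonomial (B := B) β)
    rw [map_mul, map_natCast] at e1
    rw [map_mul, map_natCast, hφ, flatMonomial_apply, h1, map_one (WittVector.teichmuller p),
      map_one, one_mul] at e2
    exact e2.trans e1.symm
  refine PDPoly.pow_dvd_of_pow_dvd_sum p B k l ?_ α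
  rw [← pow_dvd_algebraMap_iff]
  have h5 := map_dvd φ h
  rw [map_pow, map_natCast, hullSum_apply, map_finsuppSum] at h5
  rw [map_finsuppSum]
  simp only [map_mul, hφ, h3, h4] at h5
  simp only [map_mul]
  exact h5

end Hull

/-- γ_n(y^(p-1) y) = y^((p-1)n) γ_n(y) = ((pn)!/n!) γ_(pn)(y), and p divides (pn)!/n! for n ≠ 0. -/
theorem PDHull.p_dvd_dp_pow {p : ℕ} [hp : Fact p.Prime] {R : Type u} [CommRing R] {I : Ideal R}
    (y : I) {n : ℕ} (hn : n ≠ 0) (x : I) (hx : (x : R) = (y : R) ^ p) :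
    (p : PDHull p I) ∣ PDHull.dp p I n x := by
  have hp0 : p ≠ 0 := hp.out.ne_zero
  have h1 : x = (y : R) ^ (p - 1) • y := Subtype.ext (by
    rw [hx, Submodule.coe_smul, smul_eq_mul, ← pow_succ, Nat.sub_add_cancel hp.out.one_le])
  have h2 : (p - 1) * n + n = p * n := by
    rw [← Nat.succ_mul, Nat.succ_eq_add_one, Nat.sub_add_cancel hp.out.one_le]
  have h3 : p ∣ ((p - 1) * n).factorial * ((p - 1) * n + n).choose ((p - 1) * n) := by
    obtain ⟨c, hc⟩ := Nat.factorial_dvd_factorial (show n ≤ p * n - 1 from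
      Nat.le_sub_one_of_lt (lt_mul_of_one_lt_left (Nat.pos_of_ne_zero hn) hp.out.one_lt))
    have h4 := Nat.add_choose_mul_factorial_mul_factorial ((p - 1) * n) n
    rw [← Nat.choose_symm_add, h2, ← Nat.mul_factorial_pred (mul_ne_zero hp0 hn), hc] at h4
    refine ⟨n * c, Nat.eq_of_mul_eq_mul_right (Nat.factorial_pos n) ?_⟩
    rw [h2]
    linarith
  rw [h1, PDHull.dp_smul, ← map_pow, ← pow_mul, map_pow, ← PDHull.factorial_mul_dp (p := p),
    mul_assoc, PDHull.dp_mul, ← mul_assoc, ← Nat.cast_mul]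
  exact dvd_mul_of_dvd_left (Nat.cast_dvd_cast h3) _

/-! ### Generation of the PD hull by divided power monomials -/

section Generation

variable {p : ℕ} [Fact p.Prime] {B : Type u} [CommRing B] [CharP B p] [PerfectRing B p] {n : ℕ}

variable (p B n) in
/-- The set of all multiples of divided power monomials by integers and Teichmüller
representatives of elements of `B`. -/
def hullTerms : Submonoid (AcrisHull p (KeyRing p B n)) where
  carrier := {h | ∃ (m : ℕ) (b : B) (α : Fin n → Exponent p), h =
    m * algebraMap _ _ (flatConst p B n (WittVector.teichmuller p b)) * hullMonomial p B α}
  one_mem' := ⟨1, 1, 0, by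
    rw [map_one (WittVector.teichmuller p), map_one, map_one, hullMonomial_zero, Nat.cast_one,
      mul_one, mul_one]⟩
  mul_mem' := by
    rintro _ _ ⟨m, b, α, rfl⟩ ⟨m', b', β, rfl⟩
    obtain ⟨k, hk⟩ := exists_hullMonomial_mul (B := B) α β
    refine ⟨m * m' * k, b * b', α + β, ?_⟩
    rw [map_mul (WittVector.teichmuller p), map_mul, map_mul]
    push_cast
    linear_combination m * m' *
      algebraMap _ _ (flatConst p B n (WittVector.teichmuller p b)) *
      algebraMap _ _ (flatConst p B n (WittVector.teichmuller p b')) * hk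

variable (p B n) in
/-- The subring of all elements which are congruent modulo `p` to sums of elements of
`hullTerms p B n`. -/
def hullSubring : Subring (AcrisHull p (KeyRing p B n)) :=
  ((Subring.closure (hullTerms p B n : Set (AcrisHull p (KeyRing p B n)))).map
    (Ideal.Quotient.mk (Ideal.span {(p : AcrisHull p (KeyRing p B n))}))).comap
      (Ideal.Quotient.mk (Ideal.span {(p : AcrisHull p (KeyRing p B n))}))

theorem mem_hullSubring_of_dvd {h : AcrisHull p (KeyRing p B n)}
    (hh : (p : AcrisHull p (KeyRing p B n)) ∣ h) : h ∈ hullSubring p B n := by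
  rw [hullSubring, Subring.mem_comap, Ideal.Quotient.eq_zero_iff_mem.2
    (Ideal.mem_span_singleton.2 hh)]
  exact zero_mem _

theorem hullTerms_subset : (hullTerms p B n : Set (AcrisHull p (KeyRing p B n))) ⊆
    hullSubring p B n :=
  fun _ h => ⟨_, Subring.subset_closure h, rfl⟩

theorem exists_hullSum_add_of_mem {h : AcrisHull p (KeyRing p B n)} (hh : h ∈ hullSubring p B n) :
    ∃ l h', h = hullSum p B n l + p * h' := by
  obtain ⟨a, ha, hah⟩ := hh
  rw [eq_comm, Ideal.Quotient.eq, Ideal.mem_span_singleton] at hah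
  obtain ⟨h', hh'⟩ := hah
  have h1 : a ∈ (hullSum p B n).range := by
    -- `hullTerms` is closed under multiplication, so the subring it generates is its additive span.
    replace ha := Subring.mem_closure_iff.1 ha
    rw [Submonoid.closure_eq] at ha
    refine (AddSubgroup.closure_le _).2 ?_ ha
    rintro _ ⟨m, b, α, rfl⟩
    refine ⟨Finsupp.single α (m * WittVector.teichmuller p b), ?_⟩
    rw [hullSum_single, map_mul, map_mul, map_natCast, map_natCast]
  obtain ⟨l, rfl⟩ := h1
  exact ⟨l, h', by rw [← hh']; ring⟩

/-- Lift ν_1(t) to a polynomial q₀. Then t - q₀^p lies in Ker ν_1, whose elements are p-th powers of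
elements of Ker ν_0. -/
theorem exists_toFlat_add_pow (t : Perfection (KeyRing p B n) p) :
    ∃ q, ∃ z ∈ kerNu p (KeyRing p B n) 0, t = toFlat p q + z ^ p := by
  obtain ⟨q₀, hq₀⟩ := Ideal.Quotient.mk_surjective (Perfection.coeff _ p 1 t)
  have h1 : t - toFlat p (q₀ ^ p) ∈ kerNu p (KeyRing p B n) 1 := by
    rw [RingHom.mem_ker, map_sub, coeff_toFlat, Function.iterate_one, frobeniusEquiv_symm_pow,
      hq₀, sub_self]
  obtain ⟨z, hz, hz'⟩ := exists_eq_pow_of_mem_kerNu h1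
  rw [pow_one] at hz'
  exact ⟨q₀ ^ p, z, hz, sub_eq_iff_eq_add'.1 hz'⟩

theorem algebraMap_toFlat_mem_hullSubring
    {f : Perfection (KeyRing p B n) p →+*
      AcrisHull p (KeyRing p B n) ⧸ Ideal.span {(p : AcrisHull p (KeyRing p B n))}}
    (hf : ∀ w : WFlat p (KeyRing p B n), f (w.coeff 0) = Ideal.Quotient.mk _ (algebraMap _ _ w))
    (q : PerfectPolynomial p B n) :
    f (toFlat p q) ∈ (Subring.closure (hullTerms p B n : Set (AcrisHull p (KeyRing p B n)))).map
      (Ideal.Quotient.mk (Ideal.span {(p : AcrisHull p (KeyRing p B n))})) := by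
  induction q using AddMonoidAlgebra.induction_linear with
  | zero => rw [map_zero, map_zero]; exact zero_mem _
  | add q q' h h' => rw [map_add, map_add]; exact add_mem h h'
  | single α b =>
    have h1 := hf (WittVector.teichmuller p (toFlat p (AddMonoidAlgebra.single α b)))
    rw [WittVector.teichmuller_coeff_zero] at h1
    rw [h1, ← flatConst_mul_flatMonomial, map_mul, ← weight_mul_hullMonomial]
    refine Subring.mem_map.2 ⟨_, Subring.subset_closure ⟨weight α, b, α, rfl⟩, ?_⟩
    rw [mul_assoc, mul_left_comm]

/-- Modulo p only the zeroth coefficient, of the form q + z^p, matters. The part from q is a sum of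
monomials, and [z]^p = p! γ_p([z]) vanishes modulo p. -/
theorem algebraMap_mem_hullSubring (w : WFlat p (KeyRing p B n)) :
    algebraMap _ _ w ∈ hullSubring p B n := by
  obtain ⟨f, hf⟩ := exists_comp_constantCoeff_eq ((Ideal.Quotient.mk
    (Ideal.span {(p : AcrisHull p (KeyRing p B n))})).comp
      (algebraMap (WFlat p (KeyRing p B n)) (AcrisHull p (KeyRing p B n)))) (by
    rw [← map_natCast (Ideal.Quotient.mk _), Ideal.Quotient.eq_zero_iff_mem]
    exact Ideal.mem_span_singleton_self _)
  rw [hullSubring, Subring.mem_comap]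
  have h1 := hf w
  rw [RingHom.comp_apply] at h1
  rw [← h1]
  obtain ⟨q, z, hz, hqz⟩ := exists_toFlat_add_pow (w.coeff 0)
  rw [hqz, map_add]
  refine add_mem (algebraMap_toFlat_mem_hullSubring hf q) ?_
  have h2 := hf (WittVector.teichmuller p z ^ p)
  have hk : WittVector.teichmuller p z ∈ kerTheta p (KeyRing p B n) := by
    rw [RingHom.mem_ker, theta_teichmuller]
    exact hz
  have h3 := PDHull.factorial_mul_dp (p := p) p (⟨_, hk⟩ : kerTheta p (KeyRing p B n))
  rw [← map_pow] at h3
  rw [RingHom.comp_apply, ← h3, Ideal.Quotient.eq_zero_iff_mem.2,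
    ← map_pow (WittVector.teichmuller p), WittVector.teichmuller_coeff_zero] at h2
  · rw [h2]
    exact zero_mem _
  · rw [Ideal.mem_span_singleton]
    exact dvd_mul_of_dvd_left (Nat.cast_dvd_cast
      (Nat.dvd_factorial (Fact.out : p.Prime).pos le_rfl)) _

variable (p B n) in
/-- The ideal of all elements of `Ker (W(C^♭) → C)` whose divided powers are in
`hullSubring p B n`. -/
def hullSubringIdeal : Ideal (WFlat p (KeyRing p B n)) where
  carrier := {b | ∃ hb : b ∈ kerTheta p (KeyRing p B n),
    ∀ m, PDHull.dp p _ m ⟨b, hb⟩ ∈ hullSubring p B n}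
  zero_mem' := ⟨zero_mem _, fun m => by
    have : (⟨0, zero_mem _⟩ : kerTheta p (KeyRing p B n)) =
      (0 : WFlat p (KeyRing p B n)) • (0 : kerTheta p (KeyRing p B n)) := (zero_smul _ _).symm
    rcases eq_or_ne m 0 with rfl | hm
    · rw [PDHull.dp_zero]
      exact one_mem _
    · rw [this, PDHull.dp_smul, map_zero, zero_pow hm, zero_mul]
      exact zero_mem _⟩
  add_mem' := by
    rintro a b ⟨ha, ha'⟩ ⟨hb, hb'⟩
    refine ⟨add_mem ha hb, fun m => ?_⟩
    have h := PDHull.dp_add (p := p) m (⟨a, ha⟩ : kerTheta p (KeyRing p B n)) ⟨b, hb⟩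
    exact h ▸ sum_mem fun k _ => mul_mem (ha' _) (hb' _)
  smul_mem' := by
    rintro w b ⟨hb, hb'⟩
    refine ⟨Ideal.mul_mem_left _ _ hb, fun m => ?_⟩
    have h := PDHull.dp_smul (p := p) w m (⟨b, hb⟩ : kerTheta p (KeyRing p B n))
    exact h ▸ mul_mem (pow_mem (algebraMap_mem_hullSubring w) m) (hb' m)

theorem natCast_mem_hullSubringIdeal :
    (p : WFlat p (KeyRing p B n)) ∈ hullSubringIdeal p B n := by
  have hk : (p : WFlat p (KeyRing p B n)) ∈ kerTheta p (KeyRing p B n) := by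
    rw [RingHom.mem_ker, map_natCast, CharP.cast_eq_zero]
  refine ⟨hk, fun m => ?_⟩
  rcases eq_or_ne m 0 with rfl | hm
  · rw [PDHull.dp_zero]
    exact one_mem _
  have h1 := PDHull.mk_eq_of_rel (PDHullRel.compat (p := p)
    (⟨_, hk⟩ : kerTheta p (KeyRing p B n)) rfl m)
  rw [map_mul, map_natCast, map_pow, map_natCast] at h1
  have hu : IsUnit ((m.factorial / p ^ padicValNat p m.factorial : ℕ) :
      AcrisHull p (KeyRing p B n)) := by
    have := (isUnit_natCast_of_isAdicComplete p (WFlat p (KeyRing p B n)) _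
      (Nat.not_dvd_ordCompl (Fact.out : p.Prime) (Nat.factorial_ne_zero m))).map
        (algebraMap _ (AcrisHull p (KeyRing p B n)))
    rw [map_natCast, Nat.factorization_def _ (Fact.out : p.Prime)] at this
    exact this
  -- By `compat`, γ_m(p) is up to a unit p^(m - v), where v is the valuation of m!; the exponent is
  -- positive for m ≠ 0.
  refine mem_hullSubring_of_dvd ((hu.dvd_mul_left).1 (Dvd.dvd.trans ?_ (dvd_of_eq h1.symm)))
  exact dvd_pow_self _ (Nat.sub_ne_zero_of_lt (padicValNat_factorial_lt_of_ne_zero (p := p) hm))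

theorem xKer_mem_hullSubringIdeal (i : Fin n) :
    (xKer p B i : WFlat p (KeyRing p B n)) ∈ hullSubringIdeal p B n := by
  refine ⟨(xKer p B i).2, fun m => ?_⟩
  rw [← hullMonomial_single_ofNat]
  refine hullTerms_subset ⟨1, 1, Pi.single i (Exponent.ofNat m), ?_⟩
  rw [map_one (WittVector.teichmuller p), map_one, map_one, Nat.cast_one, mul_one, one_mul]

theorem teichmuller_pow_mem_hullSubringIdeal {z : Perfection (KeyRing p B n) p}
    (hz : z ∈ kerNu p (KeyRing p B n) 0) :
    WittVector.teichmuller p z ^ p ∈ hullSubringIdeal p B n := by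
  have hk : WittVector.teichmuller p z ∈ kerTheta p (KeyRing p B n) := by
    rw [RingHom.mem_ker, theta_teichmuller]
    exact hz
  refine ⟨Ideal.pow_mem_of_mem _ hk p (Fact.out : p.Prime).pos, fun m => ?_⟩
  rcases eq_or_ne m 0 with rfl | hm
  · rw [PDHull.dp_zero]
    exact one_mem _
  · exact mem_hullSubring_of_dvd (PDHull.p_dvd_dp_pow ⟨_, hk⟩ hm _ rfl)

/-- Ker θ is generated by p, the [x_i] and the [z]^p with z ∈ Ker ν_0, and the divided powers of
each are monomials or multiples of p in positive degree. -/
theorem kerTheta_le_hullSubringIdeal :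
    kerTheta p (KeyRing p B n) ≤ hullSubringIdeal p B n := by
  intro b hb
  let J := (hullSubringIdeal p B n).map (WittVector.constantCoeff (p := p))
  have hJ : ∀ w ∈ hullSubringIdeal p B n, w.coeff 0 ∈ J := fun w hw =>
    Ideal.mem_map_of_mem (WittVector.constantCoeff (p := p)) hw
  suffices h : b.coeff 0 ∈ J by
    obtain ⟨d, hd, hdb⟩ := (Ideal.mem_map_iff_of_surjective _
      (WittVector.constantCoeff_surjective (p := p))).1 h
    have h1 : (p : WFlat p (KeyRing p B n)) ∣ b - d := by
      rw [p_dvd_iff_coeff_zero]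
      change WittVector.constantCoeff (b - d) = 0
      rw [map_sub, hdb]
      exact sub_self _
    rw [← sub_add_cancel b d]
    exact add_mem (Ideal.mem_of_dvd _ h1 natCast_mem_hullSubringIdeal) hd
  obtain ⟨q, z, hz, hqz⟩ := exists_toFlat_add_pow (b.coeff 0)
  rw [hqz]
  refine add_mem ?_ ?_
  · have h1 : q ∈ Ideal.span (Set.range (PerfectPolynomial.x p B n)) := by
      rw [← Ideal.Quotient.eq_zero_iff_mem]
      have h2 := congrArg (Perfection.coeff _ p 0) hqz
      rw [map_add, map_pow, RingHom.mem_ker.1 hz, zero_pow (Fact.out : p.Prime).ne_zero, add_zero,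
        coeff_toFlat, Function.iterate_zero_apply, ← theta_apply, RingHom.mem_ker.1 hb] at h2
      exact h2.symm
    rw [← Ideal.mem_comap]
    refine (Ideal.span_le).2 ?_ h1
    rintro _ ⟨i, rfl⟩
    rw [SetLike.mem_coe, Ideal.mem_comap, PerfectPolynomial.x_eq]
    have h3 := hJ _ (xKer_mem_hullSubringIdeal (B := B) i)
    change (flatMonomial p B n (.ofAdd (Pi.single i (Exponent.ofNat 1)))).coeff 0 ∈ J at h3
    rwa [flatMonomial_apply, WittVector.teichmuller_coeff_zero] at h3
  · have h3 := hJ _ (teichmuller_pow_mem_hullSubringIdeal hz)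
    rwa [← map_pow (WittVector.teichmuller p), WittVector.teichmuller_coeff_zero] at h3

theorem exists_hullSum_add (k : ℕ) (h : AcrisHull p (KeyRing p B n)) :
    ∃ l h', h = hullSum p B n l + (p : AcrisHull p (KeyRing p B n)) ^ k * h' := by
  have htop : ∀ h, h ∈ hullSubring p B n := fun h => PDHull.induction_on h
    algebraMap_mem_hullSubring (fun m x => (kerTheta_le_hullSubringIdeal x.2).2 m)
    (fun _ _ => add_mem) fun _ _ => mul_mem
  induction k generalizing h with
  | zero => exact ⟨0, h, by rw [map_zero, zero_add, pow_zero, one_mul]⟩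
  | succ k ih =>
    obtain ⟨l, h', rfl⟩ := ih h
    obtain ⟨l', h'', rfl⟩ := exists_hullSum_add_of_mem (htop h')
    refine ⟨l + p ^ k • l', h'', ?_⟩
    rw [map_add, map_nsmul, nsmul_eq_mul, Nat.cast_pow]
    ring

end Generation

/-! ### Frobenius on `A_cris(C)` in terms of divided power monomials -/

section Structure

variable {p : ℕ} [Fact p.Prime] {B : Type u} [CommRing B] [CharP B p] [PerfectRing B p] {n : ℕ}

theorem exists_acris_hullSum_add (k : ℕ) (u : Acris p (KeyRing p B n)) :
    ∃ l u', u = toAcris p _ (hullSum p B n l) + (p : Acris p (KeyRing p B n)) ^ k * u' := by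
  obtain ⟨s, y, rfl⟩ := exists_algebraMap_add p k u
  obtain ⟨l, h', rfl⟩ := exists_hullSum_add k s
  refine ⟨l, toAcris p _ h' + y, ?_⟩
  change toAcris p _ (_ + _) + _ = _
  rw [map_add, map_mul, map_pow, map_natCast]
  ring

theorem pow_dvd_of_pow_dvd_acris {k : ℕ} {l : (Fin n → Exponent p) →₀ WittVector p B}
    (h : (p : Acris p (KeyRing p B n)) ^ k ∣ toAcris p _ (hullSum p B n l))
    (α : Fin n → Exponent p) : (p : WittVector p B) ^ k ∣ l α :=
  pow_dvd_of_pow_dvd_hullSum k l ((pow_dvd_algebraMap_iff p k _).1 h) α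

theorem pow_dvd_hullSum {k : ℕ} {l : (Fin n → Exponent p) →₀ WittVector p B}
    (h : ∀ α, (p : WittVector p B) ^ k ∣ l α) :
    (p : Acris p (KeyRing p B n)) ^ k ∣ toAcris p _ (hullSum p B n l) := by
  rw [hullSum_apply, Finsupp.sum, map_sum]
  refine Finset.dvd_sum fun α _ => ?_
  obtain ⟨c, hc⟩ := h α
  rw [hc, map_mul (flatConst p B n), map_pow, map_natCast, map_mul, map_mul, map_mul, map_pow,
    map_natCast, map_pow, map_natCast, mul_assoc]
  exact dvd_mul_right _ _

variable (p B n) in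
-- If p u = 0, then p times the coefficients of u modulo p^k are divisible by p^(k+1), by
-- independence of the monomials. W(B) has no p-torsion.
theorem acris_isFlatAt : IsFlatAt p (Acris p (KeyRing p B n)) where
  eq_zero_of_mul u hu := by
    refine eq_zero_of_pow_dvd p fun k => ?_
    obtain ⟨l, u', rfl⟩ := exists_acris_hullSum_add k u
    refine dvd_add (pow_dvd_hullSum fun α => ?_) (dvd_mul_right _ _)
    have h1 : (p : Acris p (KeyRing p B n)) ^ (1 + k) ∣ toAcris p _ (hullSum p B n (p • l)) := by
      refine ⟨-u', ?_⟩
      rw [map_nsmul, map_nsmul, nsmul_eq_mul, pow_add, pow_one]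
      linear_combination hu
    have h2 := pow_dvd_of_pow_dvd_acris h1 α
    rw [Finsupp.smul_apply, nsmul_eq_mul] at h2
    nth_rewrite 2 [← pow_one (p : WittVector p B)] at h2
    exact (wittVector_isFlatAt p B).pow_dvd_of_pow_add_dvd h2
  isUnit := isUnit_natCast_of_isAdicComplete p _

theorem weight_dvd_weight_nsmul (α : Fin n → Exponent p) : weight α ∣ weight (p • α) := by
  have h : p • α = α + (p - 1) • α := by
    rw [← succ_nsmul', Nat.sub_add_cancel (Fact.out : p.Prime).one_le]
  rw [h]
  exact (dvd_mul_right _ _).trans (weight_mul_weight_dvd _ _)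

/-- The factor by which Frobenius multiplies the divided power monomial. -/
def weightRatio (α : Fin n → Exponent p) : ℕ := weight (p • α) / weight α

theorem weight_mul_weightRatio (α : Fin n → Exponent p) :
    weight α * weightRatio α = weight (p • α) :=
  Nat.mul_div_cancel' (weight_dvd_weight_nsmul α)

/-- Multiplied by the weight of α, both sides become [x^(pα)]. -/
theorem acrisFrobenius_hullMonomial (α : Fin n → Exponent p) :
    acrisFrobenius p _ (toAcris p _ (hullMonomial p B α)) =
      (weightRatio α : Acris p (KeyRing p B n)) * toAcris p _ (hullMonomial p B (p • α)) := by
  refine (acris_isFlatAt p B n).natCast_mul_cancel (weight_ne_zero α) ?_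
  have e1 := congrArg (fun h => acrisFrobenius p (KeyRing p B n) (toAcris p _ h))
    (weight_mul_hullMonomial (B := B) α)
  have e2 := congrArg (toAcris p (KeyRing p B n)) (weight_mul_hullMonomial (B := B) (p • α))
  simp only [map_mul, map_natCast] at e1 e2
  rw [e1, ← mul_assoc, ← Nat.cast_mul, weight_mul_weightRatio, e2, ← acris_algebraMap,
    acrisFrobenius_algebraMap, ← acris_algebraMap, flatMonomial_apply, frobenius_teichmuller,
    ← map_pow (WittVector.teichmuller p), flatMonomial_apply, ← map_pow,
    AddMonoidAlgebra.single_pow, one_pow]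

variable (p B n) in
/-- The action of Frobenius on the coefficients of `hullSum p B n`. -/
def coeffFrobenius : ((Fin n → Exponent p) →₀ WittVector p B) →+
    ((Fin n → Exponent p) →₀ WittVector p B) :=
  Finsupp.liftAddHom fun α => (Finsupp.singleAddHom (p • α)).comp
    ((AddMonoidHom.mulLeft (weightRatio α : WittVector p B)).comp
      (WittVector.frobenius (p := p) (R := B)).toAddMonoidHom)

omit [CharP B p] [PerfectRing B p] in
theorem coeffFrobenius_single (α : Fin n → Exponent p) (c : WittVector p B) :
    coeffFrobenius p B n (Finsupp.single α c) =
      Finsupp.single (p • α) (weightRatio α * WittVector.frobenius c) := by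
  rw [coeffFrobenius, Finsupp.liftAddHom_apply_single]
  rfl

theorem acrisFrobenius_hullSum (l : (Fin n → Exponent p) →₀ WittVector p B) :
    acrisFrobenius p _ (toAcris p _ (hullSum p B n l)) =
      toAcris p _ (hullSum p B n (coeffFrobenius p B n l)) := by
  induction l using Finsupp.induction_linear with
  | zero => simp only [map_zero]
  | add l l' h h' => simp only [map_add, h, h']
  | single α c =>
    have h1 : WittVector.frobenius (flatConst p B n c) = flatConst p B n (WittVector.frobenius c) :=
      ((WittVector.frobenius_isPoly p).map _ c).symm
    rw [coeffFrobenius_single, hullSum_single, hullSum_single, map_mul, map_mul, map_mul,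
      acrisFrobenius_hullMonomial, map_mul (flatConst p B n), map_natCast, map_mul, map_mul,
      ← acris_algebraMap, acrisFrobenius_algebraMap, h1, acris_algebraMap, map_natCast, map_natCast]
    ring

omit [CharP B p] [PerfectRing B p] in
theorem coeffFrobenius_apply (l : (Fin n → Exponent p) →₀ WittVector p B)
    (α : Fin n → Exponent p) : coeffFrobenius p B n l (p • α) =
      weightRatio α * WittVector.frobenius (l α) := by
  classical
  induction l using Finsupp.induction_linear with
  | zero => simp
  | add l l' h h' => rw [map_add, Finsupp.add_apply, h, h', Finsupp.add_apply, map_add, mul_add]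
  | single β c =>
    rw [coeffFrobenius_single, Finsupp.single_apply, Finsupp.single_apply]
    by_cases h : β = α
    · subst h
      rw [if_pos rfl, if_pos rfl]
    · rw [if_neg h, if_neg fun h' => h (nsmul_injective_exponent h'), map_zero, mul_zero]

theorem pow_dvd_of_pow_dvd_frobenius {k : ℕ} {c : WittVector p B}
    (h : (p : WittVector p B) ^ k ∣ WittVector.frobenius c) : (p : WittVector p B) ^ k ∣ c := by
  have h1 := map_dvd (WittVector.frobeniusEquiv p B).symm h
  rw [map_pow, map_natCast] at h1
  rwa [show (WittVector.frobeniusEquiv p B).symm (WittVector.frobenius c) = c from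
    (WittVector.frobeniusEquiv p B).symm_apply_apply c] at h1

theorem exists_pow_dvd_of_pow_dvd_mul {m : ℕ} (hm : m ≠ 0) : ∃ v, ∀ (k : ℕ) (c : WittVector p B),
    (p : WittVector p B) ^ (v + k) ∣ m * c → (p : WittVector p B) ^ k ∣ c := by
  obtain ⟨v, m', hm', rfl⟩ := Nat.exists_eq_pow_mul_and_not_dvd hm p (Fact.out : p.Prime).ne_one
  refine ⟨v, fun k c h => ?_⟩
  rw [Nat.cast_mul, Nat.cast_pow, mul_assoc] at h
  exact (((wittVector_isFlatAt p B).isUnit m' hm').dvd_mul_left).1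
    ((wittVector_isFlatAt p B).pow_dvd_of_pow_add_dvd h)

variable (p B n) in
-- Frobenius permutes the monomials up to nonzero integers, and it is bijective on W(B).
theorem acrisFrobenius_injective :
    Function.Injective (acrisFrobenius p (KeyRing p B n)) := by
  rw [injective_iff_map_eq_zero]
  intro u hu
  refine eq_zero_of_pow_dvd p fun k => ?_
  obtain ⟨l, u', hl⟩ := exists_acris_hullSum_add k u
  rw [hl]
  refine dvd_add (pow_dvd_hullSum fun α => ?_) (dvd_mul_right _ _)
  have hr : weightRatio α ≠ 0 := fun h => weight_ne_zero (p • α) (by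
    rw [← weight_mul_weightRatio, h, mul_zero])
  -- The precision v lost by dividing by the ratio depends on α and is not bounded in advance. So
  -- for each α a second expansion modulo p^(v+k) is taken and compared with the first modulo p^k.
  obtain ⟨v, hv⟩ := exists_pow_dvd_of_pow_dvd_mul (B := B) hr
  obtain ⟨l', u'', hl'⟩ := exists_acris_hullSum_add (v + k) u
  have h1 : (p : Acris p (KeyRing p B n)) ^ (v + k) ∣
      toAcris p _ (hullSum p B n (coeffFrobenius p B n l')) := by
    refine ⟨- acrisFrobenius p _ u'', ?_⟩
    rw [hl', map_add, map_mul, map_pow, map_natCast, acrisFrobenius_hullSum] at hu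
    linear_combination hu
  have h2 := pow_dvd_of_pow_dvd_acris h1 (p • α)
  rw [coeffFrobenius_apply] at h2
  have h3 := pow_dvd_of_pow_dvd_frobenius (hv k _ h2)
  have h4 : (p : Acris p (KeyRing p B n)) ^ k ∣ toAcris p _ (hullSum p B n (l - l')) := by
    refine ⟨p ^ v * u'' - u', ?_⟩
    rw [map_sub, map_sub]
    rw [pow_add] at hl'
    linear_combination hl' - hl
  have h5 := pow_dvd_of_pow_dvd_acris h4 α
  rw [Finsupp.sub_apply] at h5
  exact (dvd_iff_dvd_of_dvd_sub h5).2 h3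

theorem toAcris_hullMonomial_mem_Icris {α : Fin n → Exponent p} {i : Fin n}
    (h : Exponent.floor (α i) ≠ 0) :
    toAcris p _ (hullMonomial p B α) ∈ Icris p (KeyRing p B n) := by
  rw [hullMonomial, ← Finset.mul_prod_erase _ _ (Finset.mem_univ i), map_mul, hullFactor, map_mul]
  exact Ideal.mul_mem_right _ _ (Ideal.mul_mem_left _ _ (toAcris_dp_mem_Icris h _))

/-- If all α_i < 1, then ⌊pα_i⌋ < p, so the Frobenius factor is prime to p and the coefficient at α
is divisible by p. If some α_i ≥ 1, the monomial contains a positive divided power and lies in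
I_cris. -/
theorem mem_Icris_of_p_dvd_acrisFrobenius (a : Acris p (KeyRing p B n))
    (h : (p : Acris p (KeyRing p B n)) ∣ acrisFrobenius p (KeyRing p B n) a) :
    a ∈ Icris p (KeyRing p B n) := by
  obtain ⟨l, a', rfl⟩ := exists_acris_hullSum_add 1 a
  rw [pow_one] at h ⊢
  refine add_mem ?_ (Ideal.mul_mem_right _ _ natCast_p_mem_Icris)
  have h1 : (p : Acris p (KeyRing p B n)) ^ 1 ∣
      toAcris p _ (hullSum p B n (coeffFrobenius p B n l)) := by
    rw [pow_one, ← acrisFrobenius_hullSum]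
    rw [map_add, map_mul, map_natCast] at h
    exact (dvd_add_left (dvd_mul_right _ _)).1 h
  rw [hullSum_apply, Finsupp.sum, map_sum]
  refine sum_mem fun α _ => ?_
  rw [map_mul]
  by_cases hα : ∀ i, Exponent.floor (α i) = 0
  · refine Ideal.mul_mem_right _ _ ?_
    have h2 := pow_dvd_of_pow_dvd_acris h1 (p • α)
    have h3 : ¬ p ∣ weightRatio α := by
      have h4 : weight α = 1 := Finset.prod_eq_one fun i _ => by rw [hα i, Nat.factorial_zero]
      have h5 := weight_mul_weightRatio α
      rw [h4, one_mul] at h5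
      rw [h5, weight, (Fact.out : p.Prime).prime.dvd_finsetProd_iff]
      rintro ⟨i, -, hi⟩
      rw [(Fact.out : p.Prime).dvd_factorial] at hi
      exact absurd (Exponent.floor_nsmul_lt (hα i)) (not_lt.2 hi)
    rw [coeffFrobenius_apply, (((wittVector_isFlatAt p B).isUnit _ h3).dvd_mul_left)] at h2
    obtain ⟨c, hc⟩ := pow_dvd_of_pow_dvd_frobenius h2
    rw [hc, pow_one, map_mul, map_natCast, map_mul, map_natCast, map_mul, map_natCast]
    exact Ideal.mul_mem_right _ _ natCast_p_mem_Icris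
  · obtain ⟨i, hi⟩ := not_forall.1 hα
    exact Ideal.mul_mem_left _ _ (toAcris_hullMonomial_mem_Icris hi)

variable (p B n) in
theorem coeff_zero_surjective : Function.Surjective (Perfection.coeff (KeyRing p B n) p 0) := by
  intro c
  obtain ⟨q, rfl⟩ := Ideal.Quotient.mk_surjective c
  exact ⟨toFlat p q, coeff_toFlat 0 q⟩

end Structure

end Fontaine

theorem mainTheorem4 (p : ℕ) [Fact p.Prime] (B : Type*) [CommRing B] [CharP B p] [PerfectRing B p]
    (n : ℕ) :
    (∃! γ : DividedPowers (Fontaine.Icris p (Fontaine.KeyRing p B n)),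
      Fontaine.IsCanonicalDividedPowers p (Fontaine.KeyRing p B n) γ) ∧
    ∀ γ : DividedPowers (Fontaine.Icris p (Fontaine.KeyRing p B n)),
      Fontaine.IsCanonicalDividedPowers p (Fontaine.KeyRing p B n) γ →
      (∃! F' : Fontaine.Icris p (Fontaine.KeyRing p B n)
            →ₛₗ[Fontaine.acrisFrobenius p (Fontaine.KeyRing p B n)]
              Fontaine.Acris p (Fontaine.KeyRing p B n),
        Fontaine.IsFPrime p (Fontaine.KeyRing p B n) γ F') ∧
      ∀ F' : Fontaine.Icris p (Fontaine.KeyRing p B n)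
            →ₛₗ[Fontaine.acrisFrobenius p (Fontaine.KeyRing p B n)]
              Fontaine.Acris p (Fontaine.KeyRing p B n),
        Fontaine.IsFPrime p (Fontaine.KeyRing p B n) γ F' →
        (∃! f : Fontaine.M p (Fontaine.KeyRing p B n)
              →ₗ[Fontaine.WFlat p (Fontaine.KeyRing p B n)]
                Fontaine.Acris p (Fontaine.KeyRing p B n),
          Fontaine.IsCanonicalMap F' f) ∧
        ∀ f : Fontaine.M p (Fontaine.KeyRing p B n)
              →ₗ[Fontaine.WFlat p (Fontaine.KeyRing p B n)]
                Fontaine.Acris p (Fontaine.KeyRing p B n),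
          Fontaine.IsCanonicalMap F' f →
            Function.Injective f ∧
              Set.range f = Fontaine.AcrisDoublePrime p (Fontaine.KeyRing p B n) := by
  have hA := Fontaine.acris_isFlatAt p B n
  refine ⟨Fontaine.existsUnique_dividedPowers hA, fun γ _ =>
    ⟨Fontaine.existsUnique_isFPrime hA, fun F' hF' => ?_⟩⟩
  refine ⟨Fontaine.existsUnique_isCanonicalMap hA hF'.p_mul, fun f hf => ?_⟩
  -- Flatness suffices up to here; only (d) depends on the finer structure of Frobenius.
  have hFI := Fontaine.acrisFrobenius_injective p B n
  refine ⟨hf.injective hA hF'.p_mul hFI, Set.Subset.antisymm ?_ fun u hu => ?_⟩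
  · rintro _ ⟨x, rfl⟩
    exact hf.mem_doublePrime hA hF'.p_mul x
  · exact hf.doublePrime_subset_range hA hF'.p_mul hFI
      Fontaine.mem_Icris_of_p_dvd_acrisFrobenius (Fontaine.coeff_zero_surjective p B n) hu
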